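/- **Proposition.** Let $G$ be a compact semisimple Lie group of rank $n$ with Lie algebra $\mathfrak g$, and let $G^{\mathbb C}$ be its complexification: a complex Lie group containing $G$ as a Lie subgroup, with Lie algebra $\mathfrak g\oplus i\mathfrak g$, each of whose connected components meets $G$. Fix an $\mathrm{Ad}(G)$-invariant inner product on $\mathfrak g$ and a Cartan subalgebra $\mathfrak h\subset\mathfrak g$, and identify $\mathfrak h$ with $\mathbb R^n$ by orthonormal coordinates $x_1,\dots,x_n$. Let $W=N_G(\mathfrak h)/Z_G(\mathfrak h)$ be the Weyl group, and let the roots be the nonzero real linear forms $\alpha$ on $\mathfrak h$ for which there is a nonzero $z\in\mathfrak g\otimes\mathbb C$ with $[x,z]=i\alpha(x)z$ for all $x\in\mathfrak h$. Let $\tilde K:\mathfrak h\to\mathbb R$ be a smooth convex $W$-invariant solution, for some smooth $W$-invariant function $\tilde u:\mathfrak h\to\mathbb R$, of the Monge–Ampère equation $$\Bigl(\prod_{\alpha}\alpha(\nabla\tilde K)\Bigr)\det\Bigl(\frac{\partial^2\tilde K}{\partial x_i\partial x_j}\Bigr)=e^{\tilde u(x)}\prod_{\alpha}\sinh\alpha(x),$$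 the products being taken over all roots. Let $g$ be the $G\times G$-invariant Kähler metric on $G^{\mathbb C}$ given by $\tilde K$: up to a positive constant factor, its Kähler form is $i\partial\bar\partial K$, where $K$ is the smooth $G\times G$-invariant function on $G^{\mathbb C}$ with $K(\exp(ix))=\tilde K(x)$ for $x\in\mathfrak h$. Then $g$ is complete if and only if $$\sum_{i,j}\frac{\partial^2\tilde K}{\partial x_i\partial x_j}\,dx_i\otimes dx_j$$ is a complete Riemannian metric on $\mathbb R^n$. -/

import Mathlib

open Set Filter Topology Manifold Bundle
open scoped ContDiff TensorProduct

noncomputable section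

/-! ### Manifolds and Lie groups -/

/-- A complex manifold is, with the same charts, a smooth real manifold. -/
instance realManifoldOfComplex {E : Type*} [NormedAddCommGroup E] [NormedSpace ℂ E]
    {M : Type*} [TopologicalSpace M] [ChartedSpace E M] [IsManifold 𝓘(ℂ, E) ω M] :
    IsManifold 𝓘(ℝ, E) ∞ M := by
  apply isManifold_of_contDiffOn
  intro e e' he he'
  have h := (contDiffGroupoid ω 𝓘(ℂ, E)).compatible (H := E) he he'
  have h2 := h.1
  simp only [contDiffPregroupoid, modelWithCornersSelf_coe, modelWithCornersSelf_coe_symm,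
    Function.id_comp, Function.comp_id, preimage_id_eq, id_eq, range_id, inter_univ] at h2 ⊢
  exact (ContDiffOn.restrict_scalars ℝ h2).of_le le_top

/-- A smooth real Lie group has the regularity under which Mathlib defines its Lie algebra. -/
instance lieGroupMinSmoothness {E : Type*} [NormedAddCommGroup E] [NormedSpace ℝ E]
    {G : Type*} [TopologicalSpace G] [ChartedSpace E G] [Group G] [LieGroup 𝓘(ℝ, E) ∞ G] :
    LieGroup 𝓘(ℝ, E) (minSmoothness ℝ 3) G := by
  rw [minSmoothness_of_isRCLikeNormedField]
  exact LieGroup.of_le (n := ∞) ENat.LEInfty.out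

section LieGroups

variable {E : Type*} [NormedAddCommGroup E] [NormedSpace ℝ E]
  {G : Type*} [TopologicalSpace G] [ChartedSpace E G] [Group G]

/-- The adjoint representation: `Ad a` is the derivative at `1` of `x ↦ a x a⁻¹`. -/
def lieAd (a : G) : GroupLieAlgebra 𝓘(ℝ, E) G →L[ℝ] GroupLieAlgebra 𝓘(ℝ, E) G :=
  (mfderiv 𝓘(ℝ, E) 𝓘(ℝ, E) (fun x : G => a * x * a⁻¹) 1 : E →L[ℝ] E)

/-- `γ` is the one-parameter subgroup with initial velocity `v`. -/
def IsOneParameterSubgroup (v : GroupLieAlgebra 𝓘(ℝ, E) G) (γ : ℝ → G) : Prop :=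
  (∀ s t, γ (s + t) = γ s * γ t) ∧
    HasMFDerivAt 𝓘(ℝ, ℝ) 𝓘(ℝ, E) γ 0 (ContinuousLinearMap.toSpanSingleton ℝ (v : E))

open Classical in
/-- The exponential map of a Lie group: the value at time `1` of the one-parameter subgroup with
initial velocity `v`. -/
def lieExp (v : GroupLieAlgebra 𝓘(ℝ, E) G) : G :=
  if h : ∃ γ : ℝ → G, IsOneParameterSubgroup v γ then h.choose 1 else 1

end LieGroups

/-! ### Complete Riemannian metrics -/

/-- A Riemannian metric is complete if every Cauchy sequence for the Riemannian distance (the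
infimum of the lengths of `C¹` paths) converges. -/
def RiemannianMetricComplete {E : Type*} [NormedAddCommGroup E] [NormedSpace ℝ E]
    {M : Type*} [TopologicalSpace M] [ChartedSpace E M] [IsManifold 𝓘(ℝ, E) ∞ M]
    (g : ContMDiffRiemannianMetric 𝓘(ℝ, E) ∞ E (fun p : M => TangentSpace 𝓘(ℝ, E) p)) : Prop :=
  letI : RiemannianBundle (fun p : M => TangentSpace 𝓘(ℝ, E) p) := ⟨g.toRiemannianMetric⟩
  ∀ u : ℕ → M,
    (∀ ε : ENNReal, 0 < ε → ∃ N, ∀ m ≥ N, ∀ k ≥ N, riemannianEDist 𝓘(ℝ, E) (u m) (u k) < ε) →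
    ∃ p, Tendsto u atTop (𝓝 p)

/-- The second derivative of a function on a normed space, as a bilinear form. -/
def hessianForm {V : Type*} [NormedAddCommGroup V] [NormedSpace ℝ V] (f : V → ℝ) (x v w : V) : ℝ :=
  fderiv ℝ (fderiv ℝ f) x v w

/-- The matrix of second partial derivatives. -/
def hessianMatrix {n : ℕ} (f : EuclideanSpace ℝ (Fin n) → ℝ) (x : EuclideanSpace ℝ (Fin n)) :
    Matrix (Fin n) (Fin n) ℝ :=
  Matrix.of fun i j =>
    hessianForm f x (EuclideanSpace.single i 1) (EuclideanSpace.single j 1)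

/-- The symmetric tensor `∑ ∂²f/∂xᵢ∂xⱼ dxᵢ ⊗ dxⱼ` is a complete Riemannian metric on `ℝⁿ`. -/
def HessianMetricComplete {n : ℕ} (f : EuclideanSpace ℝ (Fin n) → ℝ) : Prop :=
  ∃ q : ContMDiffRiemannianMetric 𝓘(ℝ, EuclideanSpace ℝ (Fin n)) ∞ (EuclideanSpace ℝ (Fin n))
      (fun x : EuclideanSpace ℝ (Fin n) => TangentSpace 𝓘(ℝ, EuclideanSpace ℝ (Fin n)) x),
    (∀ x v w : EuclideanSpace ℝ (Fin n),
      q.inner x v w = ∑ i, ∑ j, hessianMatrix f x i j * (v i * w j)) ∧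
    RiemannianMetricComplete q

/-! ### Compact Lie algebras: Cartan subalgebra, Weyl group, roots -/

section Compact

variable {E : Type*} [NormedAddCommGroup E] [NormedSpace ℝ E] [CompleteSpace E]
  {G : Type*} [TopologicalSpace G] [ChartedSpace E G] [Group G] [LieGroup 𝓘(ℝ, E) ∞ G]

/-- `B` is an `Ad`-invariant inner product on the Lie algebra of `G`. -/
structure IsAdInvariantInner (B : LinearMap.BilinForm ℝ (GroupLieAlgebra 𝓘(ℝ, E) G)) : Prop where
  symm : ∀ v w, B v w = B w v
  pos : ∀ v, v ≠ 0 → 0 < B v v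
  invariant : ∀ (a : G) v w, B (lieAd a v) (lieAd a w) = B v w

variable {n : ℕ} {𝔥 : LieSubalgebra ℝ (GroupLieAlgebra 𝓘(ℝ, E) G)}

/-- A function on the Cartan subalgebra `𝔥`, written in linear coordinates `e : ℝⁿ ≃ 𝔥`, is
invariant under the Weyl group `N_G(𝔥) / Z_G(𝔥)`. -/
def IsWeylInvariant (e : EuclideanSpace ℝ (Fin n) ≃ₗ[ℝ] 𝔥)
    (f : EuclideanSpace ℝ (Fin n) → ℝ) : Prop :=
  ∀ a : G, 𝔥.toSubmodule.map (lieAd (E := E) a).toLinearMap = 𝔥.toSubmodule →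
    ∀ x y : EuclideanSpace ℝ (Fin n),
      lieAd a (e x : GroupLieAlgebra 𝓘(ℝ, E) G) = e y → f y = f x

/-- The (real) roots, in the coordinates `e : ℝⁿ ≃ 𝔥`: the nonzero linear functionals `α` on `𝔥`
such that `ad x` acts on some nonzero vector of `𝔤 ⊗ ℂ` as multiplication by `i α(x)`,
for all `x ∈ 𝔥`. -/
def realRoots (e : EuclideanSpace ℝ (Fin n) ≃ₗ[ℝ] 𝔥) :
    Set (Module.Dual ℝ (EuclideanSpace ℝ (Fin n))) :=
  {α | α ≠ 0 ∧ ∃ z : ℂ ⊗[ℝ] GroupLieAlgebra 𝓘(ℝ, E) G, z ≠ 0 ∧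
    ∀ x, ⁅(1 : ℂ) ⊗ₜ[ℝ] (e x : GroupLieAlgebra 𝓘(ℝ, E) G), z⁆ = (Complex.I * (α x : ℂ)) • z}

/-- The Weyl-invariant Monge–Ampère equation
`(∏ α(∇f)) det D²f = exp(u) ∏ sinh α`, products over all roots. -/
def SolvesWeylMongeAmpere (e : EuclideanSpace ℝ (Fin n) ≃ₗ[ℝ] 𝔥)
    (u f : EuclideanSpace ℝ (Fin n) → ℝ) : Prop :=
  ∀ x, (∏ᶠ α ∈ realRoots e, α (gradient f x)) * (hessianMatrix f x).det =
    Real.exp (u x) * ∏ᶠ α ∈ realRoots e, Real.sinh (α x)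

end Compact

/-! ### The complexification and Kähler metrics with a potential -/

section Complexification

variable {E : Type*} [NormedAddCommGroup E] [NormedSpace ℝ E]
  {G : Type*} [TopologicalSpace G] [ChartedSpace E G] [Group G]
  {F : Type*} [NormedAddCommGroup F] [NormedSpace ℂ F]
  {GC : Type*} [TopologicalSpace GC] [ChartedSpace F GC] [Group GC]

/-- The differential at the identity of a homomorphism from a real to a complex Lie group. -/
def homDeriv (ι : G →* GC) : GroupLieAlgebra 𝓘(ℝ, E) G →L[ℝ] F :=
  (mfderiv 𝓘(ℝ, E) 𝓘(ℝ, F) ι 1 : E →L[ℝ] F)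

/-- The complex Lie group `GC` is a complexification of the compact semisimple Lie group `G`: it
contains `G` as a real form, that is, `G` is a Lie subgroup, `Lie(GC) = Lie(G) ⊕ i Lie(G)`, and `G`
meets every connected component of `GC` (so `GC` is connected if `G` is). -/
structure IsComplexification (ι : G →* GC) : Prop where
  smooth : ContMDiff 𝓘(ℝ, E) 𝓘(ℝ, F) ∞ ι
  injective : Function.Injective ι
  realForm : Function.Bijective
    (fun v : GroupLieAlgebra 𝓘(ℝ, E) G × GroupLieAlgebra 𝓘(ℝ, E) G =>
      homDeriv (F := F) ι v.1 + Complex.I • homDeriv (F := F) ι v.2)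
  components : ∀ p : GC, ∃ a : G, p ∈ connectedComponent (ι a)

/-- The element `exp(i v)` of the complexification, for `v` in the Lie algebra of `G`. -/
def expI (ι : G →* GC) (v : GroupLieAlgebra 𝓘(ℝ, E) G) : GC :=
  lieExp (E := F) (Complex.I • homDeriv (F := F) ι v : F)

/-- The real symmetric form `D²K(v, w) + D²K(iv, iw)`, computed in the preferred holomorphic chart
at `p` (through which the tangent space at `p` is identified with the model space). It does not
depend on the holomorphic chart, and is a constant multiple of the symmetric form
`(v, w) ↦ ω(v, iw)` of the real `(1,1)`-form `ω = i∂∂̄K`. -/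
def leviForm (K : GC → ℝ) (p : GC) (v w : F) : ℝ :=
  hessianForm (K ∘ (chartAt F p).symm) (chartAt F p p) v w +
    hessianForm (K ∘ (chartAt F p).symm) (chartAt F p p) (Complex.I • v) (Complex.I • w)

/-- The Riemannian metric `g` on `GC` is (up to homothety) the `G × G`-invariant Kähler metric given
by `Kt`: it is the metric of the closed `(1,1)`-form `i∂∂̄K`, up to a positive constant, where the
potential `K` is the smooth `G × G`-invariant function with `K(exp(i x)) = Kt(x)` on the Cartan
subalgebra. -/
def IsKahlerMetricGivenBy [IsManifold 𝓘(ℝ, F) ∞ GC] (ι : G →* GC) {n : ℕ}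
    (e : EuclideanSpace ℝ (Fin n) → GroupLieAlgebra 𝓘(ℝ, E) G)
    (Kt : EuclideanSpace ℝ (Fin n) → ℝ)
    (g : ContMDiffRiemannianMetric 𝓘(ℝ, F) ∞ F (fun p : GC => TangentSpace 𝓘(ℝ, F) p)) : Prop :=
  ∃ (c : ℝ) (K : GC → ℝ), 0 < c ∧ ContMDiff 𝓘(ℝ, F) 𝓘(ℝ, ℝ) ∞ K ∧
    (∀ (a b : G) (p : GC), K (ι a * p * ι b) = K p) ∧
    (∀ x, K (expI (F := F) ι (e x)) = Kt x) ∧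
    ∀ (p : GC) (v w : F), g.inner p v w = c * leviForm K p v w

end Complexification

end

/-! Everything is reduced to `𝔥` by the map `(a, x, b) ↦ a exp(i x) b` from `G × 𝔥 × G` to `Gᶜ`. The
curve `exp(i σ)` is exactly `√c` times as long as `σ`; conversely a path in `Gᶜ` of length less than
`r` from the double coset of `exp(i x)` ends in the double coset of some `exp(i y)` with `y` at
Hessian distance at most `r / √c` from `x`. Since `G` is compact, Cauchy sequences can be moved
between the two sides and their limits brought back.

Metric input. The invariant potential `K` has zero derivative in all directions of `𝔤`. Hence the
Levi form at `exp(i x)`, restricted to `i 𝔥`, is the Hessian of `Kt` (`leftLevi_torus`), and the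
directions `Ad(exp(-i x)) 𝔤 + 𝔤` tangent to the double coset are orthogonal to `i 𝔥`
(`leftLevi_orthogonal`). As `g` is positive, the Hessian is positive definite, and it bounds the
Levi form of a vector from below through its `i 𝔥`-component (`hessianForm_le_leftLevi`).

Group input. The operator `P = ad(i x)` is symmetric for the natural inner product on `𝔤ᶜ` and
satisfies `2 P² ≤ P (exp P - exp(-P))` (`two_mul_bracket_sq_le`). This one inequality replaces the
root space decomposition. It bounds `x` in terms of `Ad(exp(i x))`, so the decomposition map is
proper (`isProperMap_cartanMap`), and it yields `𝔤ᶜ = Ad(exp(-i x)) 𝔤 + i 𝔷(x) + 𝔤`, where `𝔷(x)` is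
the centralizer of `x` (`exists_eq_add_add`). An element `ξ` of `𝔷(x)` is conjugated into `𝔥` by
maximising `B (Ad b ξ) y`; this never takes it further from the given `y ∈ 𝔥` (`exists_conj_mem`).
With the inverse function theorem, `G exp(i 𝔥) G` is open; being closed as well, it is all of `Gᶜ`
(`surjective_cartanMap`). The same argument gives, for a curve differentiable at a time `s₀`,
representatives in `𝔥` that are differentiable at `s₀` (`exists_torus_curve`). They need not be
continuous at other times, so lengths are compared by continuous induction along the path
(`exists_metricEDist_torus_le`).

Conclusion. If `g` is complete, a Cauchy sequence in `𝔥` has convergent image under `exp(i ·)`, and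
properness returns a cluster point (`metricComplete_torus`). If the Hessian metric is complete, a
rapidly Cauchy subsequence in `Gᶜ` is followed step by step by points of `𝔥`, which converge, while
the factors in `G` accumulate by compactness (`metricComplete_of_torus`). A Cauchy sequence with a
cluster point converges. -/

noncomputable section

set_option linter.unusedSectionVars false

/-! ### The chart at the unit of a Lie group -/

section UnitChart

variable {E : Type*} [NormedAddCommGroup E]
  {H : Type*} [TopologicalSpace H] [ChartedSpace E H] [Group H]

/-- The preferred chart at the unit of a Lie group, translated so that the unit goes to `0`. -/
def unitChart (p : H) : E := chartAt E (1 : H) p - chartAt E (1 : H) 1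

/-- The inverse of `unitChart`. -/
def unitChartInv (a : E) : H := (chartAt E (1 : H)).symm (a + chartAt E (1 : H) 1)

@[simp] lemma unitChart_one : (unitChart (1 : H) : E) = 0 := by simp [unitChart]

@[simp] lemma unitChartInv_zero : (unitChartInv (0 : E) : H) = 1 := by simp [unitChartInv]

lemma unitChartInv_unitChart :
    ∀ᶠ p in 𝓝 (1 : H), unitChartInv (unitChart p : E) = p := by
  filter_upwards [chart_source_mem_nhds E (1 : H)] with p hp
  simp [unitChart, unitChartInv, hp]

lemma eventually_add_mem_target : ∀ᶠ a in 𝓝 (0 : E),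
    a + chartAt E (1 : H) 1 ∈ (chartAt E (1 : H)).target := by
  have : ContinuousAt (fun a : E => a + chartAt E (1 : H) 1) 0 := by fun_prop
  apply this.eventually_mem
  simpa using chart_target_mem_nhds E (1 : H)

lemma unitChart_unitChartInv :
    ∀ᶠ a in 𝓝 (0 : E), unitChart (unitChartInv a : H) = a := by
  filter_upwards [eventually_add_mem_target (H := H)] with a ha
  simp [unitChart, unitChartInv, ha]

lemma continuousAt_unitChart : ContinuousAt (unitChart : H → E) 1 :=
  ((chartAt E (1 : H)).continuousAt (mem_chart_source E 1)).sub continuousAt_const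

lemma eventually_continuousAt_unitChartInv :
    ∀ᶠ a in 𝓝 (0 : E), ContinuousAt (unitChartInv : E → H) a := by
  filter_upwards [eventually_add_mem_target (H := H)] with a ha
  exact ((chartAt E (1 : H)).continuousAt_symm ha).comp
    (f := fun a : E => a + chartAt E (1 : H) 1) (by fun_prop)

lemma continuousAt_unitChartInv : ContinuousAt (unitChartInv : E → H) 0 :=
  eventually_continuousAt_unitChartInv.self_of_nhds

lemma tendsto_unitChart : Tendsto (unitChart : H → E) (𝓝 1) (𝓝 0) := by
  simpa using (continuousAt_unitChart (E := E) (H := H)).tendsto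

lemma tendsto_unitChartInv : Tendsto (unitChartInv : E → H) (𝓝 0) (𝓝 1) := by
  simpa using (continuousAt_unitChartInv (E := E) (H := H)).tendsto

/-- A chart separates its centre from the other points of its domain, and the domain separates it
from all remaining points; this is T1, and a T1 topological group is Hausdorff. -/
lemma t2Space_of_chartedSpace (E : Type*) [NormedAddCommGroup E]
    (H : Type*) [TopologicalSpace H] [ChartedSpace E H] [Group H] [IsTopologicalGroup H] :
    T2Space H := by
  have : T1Space H := by
    refine t1Space_iff_exists_open.2 fun x y hxy => ?_
    by_cases hy : y ∈ (chartAt E x).source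
    · have hne : chartAt E x x ≠ chartAt E x y := fun h =>
        hxy ((chartAt E x).injOn (mem_chart_source E x) hy h)
      refine ⟨_, (chartAt E x).isOpen_inter_preimage (isOpen_compl_singleton
        (x := chartAt E x y)), ⟨mem_chart_source E x, hne⟩, fun h => h.2 rfl⟩
    · exact ⟨_, (chartAt E x).open_source, mem_chart_source E x, hy⟩
  infer_instance

variable {𝕜 : Type*} [NontriviallyNormedField 𝕜] [NormedSpace 𝕜 E]

lemma contMDiffAt_unitChart {n : ℕ∞ω} [IsManifold 𝓘(𝕜, E) n H] :
    ContMDiffAt 𝓘(𝕜, E) 𝓘(𝕜, E) n (unitChart : H → E) 1 := by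
  have h : ContMDiffAt 𝓘(𝕜, E) 𝓘(𝕜, E) n (chartAt E (1 : H)) 1 := contMDiffAt_extChartAt
  exact h.sub contMDiffAt_const

lemma contMDiffAt_unitChartInv {n : ℕ∞ω} [IsManifold 𝓘(𝕜, E) n H] :
    ContMDiffAt 𝓘(𝕜, E) 𝓘(𝕜, E) n (unitChartInv : E → H) 0 := by
  have h : ContMDiffAt 𝓘(𝕜, E) 𝓘(𝕜, E) n (chartAt E (1 : H)).symm
      (0 + chartAt E (1 : H) 1) := by
    have := (contMDiffOn_extChartAt_symm (I := 𝓘(𝕜, E)) (n := n) (1 : H)).contMDiffAt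
      (x := 0 + chartAt E (1 : H) 1) (by simpa using chart_target_mem_nhds E (1 : H))
    simpa using this
  exact ContMDiffAt.comp (0 : E) (f := fun a : E => a + chartAt E (1 : H) 1) h
    (by rw [contMDiffAt_iff_contDiffAt]; fun_prop)

/-- The preferred chart at `f x = 1` is, up to a translation, `unitChart`, so no change of
coordinates enters. -/
lemma hasMFDerivAt_iff_of_eq_one {V : Type*} [NormedAddCommGroup V] [NormedSpace 𝕜 V]
    {f : V → H} {x : V} (hx : f x = 1) {f' : V →L[𝕜] E} :
    HasMFDerivAt 𝓘(𝕜, V) 𝓘(𝕜, E) f x (f' : TangentSpace 𝓘(𝕜, V) x →L[𝕜] TangentSpace 𝓘(𝕜, E) (f x)) ↔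
      ContinuousAt f x ∧ HasFDerivAt (fun y => (unitChart (f y) : E)) f' x := by
  have h : HasFDerivAt (fun y => (unitChart (f y) : E)) f' x ↔
      HasFDerivAt (fun y => (chartAt E (1 : H) (f y) : E)) f' x := hasFDerivAt_sub_const_iff _
  rw [h]
  unfold HasMFDerivAt
  simp only [writtenInExtChartAt, hx]
  simp only [Function.comp_def, extChartAt, mfld_simps]
  exact and_congr_right fun _ => hasFDerivWithinAt_univ

end UnitChart

/-! ### Calculus in the chart at the unit -/

section Calculus

variable {𝕜 : Type*} [NontriviallyNormedField 𝕜] {E : Type*} [NormedAddCommGroup E] [NormedSpace 𝕜 E]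
  {H : Type*} [TopologicalSpace H] [ChartedSpace E H] [Group H]

section Smooth

variable {n : ℕ∞ω} [LieGroup 𝓘(𝕜, E) n H]

lemma contDiffAt_unitChart_mul : ContDiffAt 𝕜 n
    (fun x : E × E => (unitChart (unitChartInv x.1 * unitChartInv x.2 : H) : E)) 0 := by
  rw [← contMDiffAt_iff_contDiffAt]
  have h1 : ContMDiffAt 𝓘(𝕜, E × E) 𝓘(𝕜, E) n (fun x : E × E => (unitChartInv x.1 : H)) 0 :=
    ContMDiffAt.comp (0 : E × E) (g := unitChartInv) (contMDiffAt_unitChartInv (H := H) (E := E))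
      (by rw [contMDiffAt_iff_contDiffAt]; fun_prop)
  have h2 : ContMDiffAt 𝓘(𝕜, E × E) 𝓘(𝕜, E) n (fun x : E × E => (unitChartInv x.2 : H)) 0 :=
    ContMDiffAt.comp (0 : E × E) (g := unitChartInv) (contMDiffAt_unitChartInv (H := H) (E := E))
      (by rw [contMDiffAt_iff_contDiffAt]; fun_prop)
  refine ContMDiffAt.comp (0 : E × E) (g := (unitChart : H → E)) ?_ (h1.mul h2)
  simpa using contMDiffAt_unitChart (H := H) (E := E) (𝕜 := 𝕜) (n := n)

lemma contDiffAt_unitChart_conj : ContDiffAt 𝕜 n (fun x : E × E =>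
    (unitChart (unitChartInv x.1 * unitChartInv x.2 * (unitChartInv x.1)⁻¹ : H) : E)) 0 := by
  rw [← contMDiffAt_iff_contDiffAt]
  have h1 : ContMDiffAt 𝓘(𝕜, E × E) 𝓘(𝕜, E) n (fun x : E × E => (unitChartInv x.1 : H)) 0 :=
    ContMDiffAt.comp (0 : E × E) (g := unitChartInv) (contMDiffAt_unitChartInv (H := H) (E := E))
      (by rw [contMDiffAt_iff_contDiffAt]; fun_prop)
  have h2 : ContMDiffAt 𝓘(𝕜, E × E) 𝓘(𝕜, E) n (fun x : E × E => (unitChartInv x.2 : H)) 0 :=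
    ContMDiffAt.comp (0 : E × E) (g := unitChartInv) (contMDiffAt_unitChartInv (H := H) (E := E))
      (by rw [contMDiffAt_iff_contDiffAt]; fun_prop)
  refine ContMDiffAt.comp (0 : E × E) (g := (unitChart : H → E)) ?_ ((h1.mul h2).mul h1.inv)
  simpa using contMDiffAt_unitChart (H := H) (E := E) (𝕜 := 𝕜) (n := n)

lemma contDiffAt_unitChart_conj_const (p : H) : ContDiffAt 𝕜 n (fun x : E =>
    (unitChart (p * unitChartInv x * p⁻¹ : H) : E)) 0 := by
  rw [← contMDiffAt_iff_contDiffAt]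
  have h2 : ContMDiffAt 𝓘(𝕜, E) 𝓘(𝕜, E) n (fun x : E => (unitChartInv x : H)) 0 :=
    contMDiffAt_unitChartInv (H := H) (E := E)
  refine ContMDiffAt.comp (0 : E) (g := (unitChart : H → E)) ?_
    (((contMDiffAt_const (c := p)).mul h2).mul (contMDiffAt_const (c := p⁻¹)))
  simpa using contMDiffAt_unitChart (H := H) (E := E) (𝕜 := 𝕜) (n := n)

end Smooth

end Calculus

/-! ### Logarithmic derivatives of maps into a Lie group -/

section LogDeriv

variable {E : Type*} [NormedAddCommGroup E] [NormedSpace ℝ E]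
  {H : Type*} [TopologicalSpace H] [ChartedSpace E H] [Group H]
  {V : Type*} [NormedAddCommGroup V] [NormedSpace ℝ V]

/-- The adjoint action on the model space, in the chart at the unit. -/
def groupAd (p : H) : E →L[ℝ] E := fderiv ℝ (fun b : E => unitChart (p * unitChartInv b * p⁻¹)) 0

/-- The left logarithmic derivative `f⁻¹ df` of a map from a vector space to a Lie group,
read in the chart at the unit. -/
def HasLogDerivAt (f : V → H) (f' : V →L[ℝ] E) (x : V) : Prop :=
  ContinuousAt f x ∧ HasFDerivAt (fun y => (unitChart ((f x)⁻¹ * f y) : E)) f' x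

variable [LieGroup 𝓘(ℝ, E) ∞ H] [IsTopologicalGroup H]

/-- Both partial derivatives are read off on the axes, where one of the factors is the unit. -/
lemma hasStrictFDerivAt_unitChart_mul : HasStrictFDerivAt
    (fun x : E × E => (unitChart (unitChartInv x.1 * unitChartInv x.2 : H) : E))
    (ContinuousLinearMap.fst ℝ E E + ContinuousLinearMap.snd ℝ E E) 0 := by
  have h := (contDiffAt_unitChart_mul (𝕜 := ℝ) (n := ∞) (H := H) (E := E)).hasStrictFDerivAt
    (by simp)
  convert! h using 1
  have h1 : HasFDerivAt (fun a : E => (unitChart (unitChartInv a : H) : E))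
      (ContinuousLinearMap.id ℝ E) 0 :=
    (hasFDerivAt_id _).congr_of_eventuallyEq unitChart_unitChartInv
  have hl := HasFDerivAt.comp (0 : E) (f := fun a : E => (a, (0 : E))) h.hasFDerivAt
    (hasFDerivAt_prodMk_left 0 0)
  have hr := HasFDerivAt.comp (0 : E) (f := fun a : E => ((0 : E), a)) h.hasFDerivAt
    (hasFDerivAt_prodMk_right 0 0)
  simp only [Function.comp_def, unitChartInv_zero, mul_one, one_mul] at hl hr
  have el := hl.unique h1
  have er := hr.unique h1
  ext v
  · simpa using (congrArg (fun L => L v) el).symm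
  · simpa using (congrArg (fun L => L v) er).symm

lemma HasLogDerivAt.tendsto {f : V → H} {f' : V →L[ℝ] E} {x : V}
    (hf : HasLogDerivAt f f' x) : Tendsto (fun y => (f x)⁻¹ * f y) (𝓝 x) (𝓝 1) := by
  simpa using hf.1.tendsto.const_mul (f x)⁻¹

lemma HasLogDerivAt.eventually {f : V → H} {f' : V →L[ℝ] E} {x : V}
    (hf : HasLogDerivAt f f' x) :
    ∀ᶠ y in 𝓝 x, f x * unitChartInv (unitChart ((f x)⁻¹ * f y) : E) = f y := by
  filter_upwards [hf.tendsto.eventually (unitChartInv_unitChart (E := E) (H := H))] with y hy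
  rw [hy, mul_inv_cancel_left]

lemma hasFDerivAt_unitChart_conj (p : H) :
    HasFDerivAt (fun b : E => (unitChart (p * unitChartInv b * p⁻¹) : E)) (groupAd p) 0 :=
  ((contDiffAt_unitChart_conj_const (𝕜 := ℝ) (n := ∞) p).differentiableAt (by simp)).hasFDerivAt

lemma hasLogDerivAt_unitChartInv : HasLogDerivAt (unitChartInv : E → H)
    (ContinuousLinearMap.id ℝ E) 0 :=
  ⟨continuousAt_unitChartInv, by
    simpa using! (hasFDerivAt_id _).congr_of_eventuallyEq unitChart_unitChartInv⟩

/-- Relative to its value at `x`, the product is `(g x)⁻¹ ((f x)⁻¹ f y) (g x)` times `(g x)⁻¹ g y`: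
a conjugation, then a product, both near the unit. -/
lemma HasLogDerivAt.mul {f g : V → H} {f' g' : V →L[ℝ] E} {x : V}
    (hf : HasLogDerivAt f f' x) (hg : HasLogDerivAt g g' x) :
    HasLogDerivAt (fun y => f y * g y) ((groupAd (g x)⁻¹).comp f' + g') x := by
  refine ⟨hf.1.mul hg.1, ?_⟩
  have h1 : HasFDerivAt (fun y => (unitChart ((g x)⁻¹ * ((f x)⁻¹ * f y) * g x) : E))
      ((groupAd (g x)⁻¹).comp f') x := by
    have h := HasFDerivAt.comp x
      (g := fun b : E => (unitChart ((g x)⁻¹ * unitChartInv b * ((g x)⁻¹)⁻¹) : E))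
      (by simpa using hasFDerivAt_unitChart_conj (E := E) (g x)⁻¹) hf.2
    refine h.congr_of_eventuallyEq ?_
    filter_upwards [hf.tendsto.eventually (unitChartInv_unitChart (E := E))] with y hy
    simp only [Function.comp, inv_inv, hy]
  have h2 := HasFDerivAt.comp x
    (g := fun x : E × E => (unitChart (unitChartInv x.1 * unitChartInv x.2 : H) : E))
    (f := fun y => ((unitChart ((g x)⁻¹ * ((f x)⁻¹ * f y) * g x) : E),
      (unitChart ((g x)⁻¹ * g y) : E)))
    (by simpa using! hasStrictFDerivAt_unitChart_mul.hasFDerivAt) (h1.prodMk hg.2)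
  have h3 : Tendsto (fun y => (g x)⁻¹ * ((f x)⁻¹ * f y) * g x) (𝓝 x) (𝓝 1) := by
    simpa using (hf.tendsto.const_mul (g x)⁻¹).mul_const (g x)
  convert! h2.congr_of_eventuallyEq ?_ using 1
  filter_upwards [h3.eventually (unitChartInv_unitChart (E := E)),
    hg.tendsto.eventually (unitChartInv_unitChart (E := E))] with y hy1 hy2
  simp only [Function.comp]
  rw [hy1, hy2]
  congr 1
  group

lemma HasLogDerivAt.const_mul {f : V → H} {f' : V →L[ℝ] E} {x : V}
    (hf : HasLogDerivAt f f' x) (p : H) : HasLogDerivAt (fun y => p * f y) f' x :=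
  ⟨continuousAt_const.mul hf.1, by simpa [mul_assoc] using hf.2⟩

lemma HasLogDerivAt.mul_const {f : V → H} {f' : V →L[ℝ] E} {x : V}
    (hf : HasLogDerivAt f f' x) (p : H) :
    HasLogDerivAt (fun y => f y * p) ((groupAd p⁻¹).comp f') x := by
  have h : HasLogDerivAt (fun _ : V => p) (0 : V →L[ℝ] E) x :=
    ⟨continuousAt_const, by simpa using! hasFDerivAt_const (0 : E) x⟩
  simpa using hf.mul h

lemma HasLogDerivAt.comp {W : Type*} [NormedAddCommGroup W] [NormedSpace ℝ W]
    {f : V → H} {f' : V →L[ℝ] E} {g : W → V} {g' : W →L[ℝ] V} {x : W}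
    (hf : HasLogDerivAt f f' (g x)) (hg : HasFDerivAt g g' x) :
    HasLogDerivAt (fun y => f (g y)) (f'.comp g') x :=
  ⟨ContinuousAt.comp hf.1 hg.continuousAt, hf.2.comp x hg⟩

lemma HasLogDerivAt.unique {f : V → H} {f' g' : V →L[ℝ] E} {x : V}
    (hf : HasLogDerivAt f f' x) (hg : HasLogDerivAt f g' x) : f' = g' := hf.2.unique hg.2

lemma HasLogDerivAt.hasFDerivAt_unitChart {f : V → H} {f' : V →L[ℝ] E} {x : V}
    (hf : HasLogDerivAt f f' x) (hx : f x = 1) : HasFDerivAt (fun y => (unitChart (f y) : E)) f' x := by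
  simpa [hx] using hf.2

lemma hasLogDerivAt_iff_of_eq_one {f : V → H} {f' : V →L[ℝ] E} {x : V} (hx : f x = 1) :
    HasLogDerivAt f f' x ↔ HasMFDerivAt 𝓘(ℝ, V) 𝓘(ℝ, E) f x f' := by
  rw [hasMFDerivAt_iff_of_eq_one hx, HasLogDerivAt]
  simp [hx]

end LogDeriv

/-! ### The adjoint representation -/

section Adjoint

variable {E : Type*} [NormedAddCommGroup E] [NormedSpace ℝ E]
  {H : Type*} [TopologicalSpace H] [ChartedSpace E H] [Group H]
  [LieGroup 𝓘(ℝ, E) ∞ H] [IsTopologicalGroup H]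

@[simp] lemma groupAd_one : groupAd (E := E) (1 : H) = ContinuousLinearMap.id ℝ E := by
  refine (hasFDerivAt_unitChart_conj (1 : H)).unique ?_
  simpa using (hasFDerivAt_id (0 : E)).congr_of_eventuallyEq
    (unitChart_unitChartInv (H := H))

lemma HasLogDerivAt.conj {V : Type*} [NormedAddCommGroup V] [NormedSpace ℝ V]
    {f : V → H} {f' : V →L[ℝ] E} {x : V} (hf : HasLogDerivAt f f' x) (p : H) :
    HasLogDerivAt (fun y => p * f y * p⁻¹) ((groupAd p).comp f') x := by
  simpa using (hf.const_mul p).mul_const p⁻¹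

lemma groupAd_mul (p q : H) : groupAd (E := E) (p * q) = (groupAd p).comp (groupAd q) := by
  have h := (hasLogDerivAt_unitChartInv (E := E) (H := H)).conj (p * q)
  have h2 := ((hasLogDerivAt_unitChartInv (E := E) (H := H)).conj q).conj p
  have := h.unique (by simpa [mul_assoc] using h2)
  simpa using this

lemma groupAd_mul_apply (p q : H) (v : E) : groupAd (p * q) v = groupAd p (groupAd q v) := by
  rw [groupAd_mul]; rfl

@[simp] lemma groupAd_inv_groupAd (p : H) (v : E) : groupAd p⁻¹ (groupAd p v) = v := by
  rw [← groupAd_mul_apply]; simp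

lemma HasLogDerivAt.of_hasMFDerivAt {E' : Type*} [NormedAddCommGroup E'] [NormedSpace ℝ E']
    {H' : Type*} [TopologicalSpace H'] [ChartedSpace E' H'] [Group H']
    [LieGroup 𝓘(ℝ, E') ∞ H'] [IsTopologicalGroup H'] {f : H → H'}
    {L : E →L[ℝ] E'} (hf : HasMFDerivAt 𝓘(ℝ, E) 𝓘(ℝ, E') f 1 L) (h1 : f 1 = 1) :
    HasLogDerivAt (fun a : E => f (unitChartInv a)) L 0 := by
  have h := (hasLogDerivAt_iff_of_eq_one (by simp)).1 (hasLogDerivAt_unitChartInv (E := E) (H := H))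
  refine (hasLogDerivAt_iff_of_eq_one (by simp [h1])).2 ?_
  have e : (unitChartInv (0 : E) : H) = 1 := unitChartInv_zero
  rw [← e] at hf
  exact hf.comp (0 : E) h

lemma lieAd_apply (p : H) (v : GroupLieAlgebra 𝓘(ℝ, E) H) :
    lieAd p v = groupAd (E := E) p v := by
  have hd : MDifferentiableAt 𝓘(ℝ, E) 𝓘(ℝ, E) (fun x : H => p * x * p⁻¹) 1 :=
    (((contMDiffAt_const (c := p)).mul contMDiffAt_id).mul
      (contMDiffAt_const (c := p⁻¹)) : ContMDiffAt 𝓘(ℝ, E) 𝓘(ℝ, E) ∞ _ _).mdifferentiableAt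
      (by simp)
  have h := HasLogDerivAt.of_hasMFDerivAt (E' := E) hd.hasMFDerivAt (by simp)
  have h2 := (hasLogDerivAt_unitChartInv (E := E) (H := H)).conj p
  exact congrArg (fun L : E →L[ℝ] E => L v) (h.unique h2)

/-- The derivative at the unit of the adjoint representation. -/
def groupBracket (H : Type*) [TopologicalSpace H] [ChartedSpace E H] [Group H] : E →L[ℝ] E →L[ℝ] E :=
  fderiv ℝ (fun a : E => groupAd (E := E) (unitChartInv a : H)) 0

/-- Near the unit, `Ad` is a partial derivative of the smooth map `(a, b) ↦ a b a⁻¹`; smoothness in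
`a` follows. -/
lemma eventually_groupAd_unitChartInv : ∀ᶠ a in 𝓝 (0 : E), groupAd (unitChartInv a : H) =
    (fderiv ℝ (fun x : E × E =>
      (unitChart (unitChartInv x.1 * unitChartInv x.2 * (unitChartInv x.1)⁻¹ : H) : E)) (a, 0)).comp
      (ContinuousLinearMap.inr ℝ E E) := by
  have h := (contDiffAt_unitChart_conj (𝕜 := ℝ) (n := ∞) (H := H) (E := E)).of_le
    (m := 1) (by exact_mod_cast le_top)
  have h2 := (h.eventually (by simp)).filter_mono (le_refl _)
  have h3 : Tendsto (fun a : E => (a, (0 : E))) (𝓝 0) (𝓝 (0 : E × E)) := by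
    have : ContinuousAt (fun a : E => (a, (0 : E))) 0 := by fun_prop
    exact this
  filter_upwards [h3.eventually h2] with a ha
  have := (ha.differentiableAt (by simp)).hasFDerivAt.comp (0 : E)
    (hasFDerivAt_prodMk_right a 0)
  exact this.fderiv

lemma contDiffAt_groupAd_unitChartInv :
    ContDiffAt ℝ ∞ (fun a : E => groupAd (E := E) (unitChartInv a : H)) 0 := by
  refine ContDiffAt.congr_of_eventuallyEq ?_ eventually_groupAd_unitChartInv
  have h := (contDiffAt_unitChart_conj (𝕜 := ℝ) (n := ∞) (H := H) (E := E)).fderiv_right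
    (m := ∞) (by simp)
  have h2 : ContDiffAt ℝ ∞ (fun a : E => (a, (0 : E))) 0 := by fun_prop
  exact (ContDiffAt.comp (0 : E) (f := fun a : E => (a, (0 : E))) h h2).clm_comp contDiffAt_const

lemma hasFDerivAt_groupAd_unitChartInv :
    HasFDerivAt (fun a : E => groupAd (E := E) (unitChartInv a : H)) (groupBracket H) 0 :=
  (contDiffAt_groupAd_unitChartInv.differentiableAt (by simp)).hasFDerivAt

lemma HasLogDerivAt.hasFDerivAt_groupAd {V : Type*} [NormedAddCommGroup V] [NormedSpace ℝ V]
    {f : V → H} {f' : V →L[ℝ] E} {x : V} (hf : HasLogDerivAt f f' x) :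
    HasFDerivAt (fun y => groupAd (E := E) (f y))
      ((ContinuousLinearMap.compL ℝ E E E (groupAd (f x))).comp ((groupBracket H).comp f')) x := by
  have h := HasFDerivAt.comp x (g := fun a : E => groupAd (E := E) (unitChartInv a : H))
    (by simpa using hasFDerivAt_groupAd_unitChartInv (E := E) (H := H)) hf.2
  have h2 := ((ContinuousLinearMap.compL ℝ E E E (groupAd (f x))).hasFDerivAt.comp x h)
  refine h2.congr_of_eventuallyEq ?_
  filter_upwards [hf.eventually] with y hy
  simp only [Function.comp, ContinuousLinearMap.compL_apply]
  rw [← groupAd_mul, hy]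

/-- Continuity at the unit spreads to every `p` through `Ad q = Ad p ∘ Ad (p⁻¹ q)`. -/
lemma continuous_groupAd : Continuous (fun p : H => groupAd (E := E) p) := by
  rw [continuous_iff_continuousAt]
  intro p
  have h1 : ContinuousAt (fun q : H => groupAd (E := E)
      (p * unitChartInv (unitChart (p⁻¹ * q) : E))) p := by
    simp_rw [groupAd_mul]
    refine continuousAt_const.clm_comp ?_
    have h3 : ContinuousAt (fun q : H => (unitChart (p⁻¹ * q) : E)) p :=
      ContinuousAt.comp (f := fun q : H => p⁻¹ * q) (g := (unitChart : H → E))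
        (by simpa using continuousAt_unitChart) (by fun_prop)
    refine ContinuousAt.comp (f := fun q : H => (unitChart (p⁻¹ * q) : E))
      (g := fun a : E => groupAd (E := E) (unitChartInv a : H)) ?_ h3
    simpa using (hasFDerivAt_groupAd_unitChartInv (E := E) (H := H)).continuousAt
  refine h1.congr ?_
  have h4 : Tendsto (fun q => p⁻¹ * q) (𝓝 p) (𝓝 1) := by
    simpa using (continuous_const_mul p⁻¹).tendsto p
  filter_upwards [h4.eventually (unitChartInv_unitChart (E := E))] with q hq
  rw [hq, mul_inv_cancel_left]

end Adjoint

/-! ### The Lie bracket is the derivative of the adjoint representation -/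

section BracketAd

variable {E : Type*} [NormedAddCommGroup E] [NormedSpace ℝ E]
  {H : Type*} [TopologicalSpace H] [ChartedSpace E H] [Group H]
  [LieGroup 𝓘(ℝ, E) ∞ H] [IsTopologicalGroup H]

lemma hasMFDerivAt_unitChartInv : HasMFDerivAt 𝓘(ℝ, E) 𝓘(ℝ, E) (unitChartInv : E → H) 0
    (ContinuousLinearMap.id ℝ E) :=
  (hasLogDerivAt_iff_of_eq_one (by simp)).1 (hasLogDerivAt_unitChartInv (E := E) (H := H))

lemma hasFDerivAt_chart_mul {A B : E →L[ℝ] E} {p : H}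
    (hA : HasMFDerivAt 𝓘(ℝ, E) 𝓘(ℝ, E) (chartAt E (1 : H)) p A)
    (hB : HasMFDerivAt 𝓘(ℝ, E) 𝓘(ℝ, E) (fun x : H => p * x) 1 B) :
    HasFDerivAt (fun b : E => (unitChart (p * unitChartInv b : H) : E)) (A.comp B) 0 := by
  have e : (unitChartInv (0 : E) : H) = 1 := unitChartInv_zero
  have e2 : (fun x : H => p * x) (unitChartInv (0 : E)) = p := by simp
  rw [← e] at hB
  have hA' : HasMFDerivAt 𝓘(ℝ, E) 𝓘(ℝ, E) (chartAt E (1 : H))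
      ((fun x : H => p * x) (unitChartInv (0 : E))) A := by
    rw [e2]; exact hA
  have h := hA'.comp (0 : E) (hB.comp (0 : E) hasMFDerivAt_unitChartInv)
  have h2 : HasFDerivAt (fun b : E => (chartAt E (1 : H) (p * unitChartInv b : H) : E))
    (A.comp B) 0 := hasMFDerivAt_iff_hasFDerivAt.1 h
  exact h2.sub_const _

lemma hasMFDerivAt_const_mul (p q : H) : HasMFDerivAt 𝓘(ℝ, E) 𝓘(ℝ, E) (fun x : H => p * x) q
    (mfderiv 𝓘(ℝ, E) 𝓘(ℝ, E) (fun x : H => p * x) q) :=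
  ((contMDiff_mul_left (n := ∞)).contMDiffAt.mdifferentiableAt (by simp)).hasMFDerivAt

/-- Left translation by `a` is `b ↦ m (a, b)` in the chart, with `m` the multiplication, so a
left-invariant field is a partial derivative of `m` along `b = 0`. -/
lemma mpullbackWithin_mulInvariantVectorField (v : GroupLieAlgebra 𝓘(ℝ, E) H) :
    ∀ᶠ y in 𝓝 (chartAt E (1 : H) 1), VectorField.mpullbackWithin 𝓘(ℝ, E) 𝓘(ℝ, E) (extChartAt 𝓘(ℝ, E) (1 : H)).symm
      (mulInvariantVectorField v) (range 𝓘(ℝ, E)) y =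
    fderiv ℝ (fun x : E × E => (unitChart (unitChartInv x.1 * unitChartInv x.2 : H) : E))
      (y - chartAt E (1 : H) 1, 0) ((0 : E), (v : E)) := by
  have h := (contDiffAt_unitChart_mul (𝕜 := ℝ) (n := ∞) (H := H) (E := E)).of_le
    (m := 1) (by exact_mod_cast le_top)
  have h2 := h.eventually (by simp)
  have h3 : Tendsto (fun y : E => (y - chartAt E (1 : H) 1, (0 : E))) (𝓝 (chartAt E (1 : H) 1))
      (𝓝 (0 : E × E)) := by
    have : ContinuousAt (fun y : E => (y - chartAt E (1 : H) 1, (0 : E))) (chartAt E (1 : H) 1) := by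
      fun_prop
    have e : ((chartAt E (1 : H) 1 - chartAt E (1 : H) 1, 0) : E × E) = 0 := by simp
    rw [ContinuousAt, e] at this
    exact this
  filter_upwards [h3.eventually h2, chart_target_mem_nhds E (1 : H)] with y hy hyt
  have hd := (hy.differentiableAt (by simp)).hasFDerivAt.comp (0 : E)
    (hasFDerivAt_prodMk_right (y - chartAt E (1 : H) 1) (0 : E))
  set p : H := (chartAt E (1 : H)).symm y with hp
  have hps : p ∈ (chartAt E (1 : H)).source := (chartAt E (1 : H)).map_target hyt
  have hA := hasMFDerivAt_extChartAt (I := 𝓘(ℝ, E)) hps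
  have hC := hasFDerivAt_chart_mul hA (hasMFDerivAt_const_mul p 1)
  have e1 : (unitChartInv (y - chartAt E (1 : H) 1) : H) = p := by simp [unitChartInv, hp]
  simp only [Function.comp_def, e1] at hd
  have key := hC.unique hd
  have hl := mfderiv_extChartAt_comp_mfderivWithin_extChartAt_symm (I := 𝓘(ℝ, E))
    (x := (1 : H)) (y := y) (by simpa using hyt)
  have hr := mfderivWithin_extChartAt_symm_comp_mfderiv_extChartAt (I := 𝓘(ℝ, E))
    (x := (1 : H)) (y := y) (by simpa using hyt)
  rw [VectorField.mpullbackWithin_apply, ContinuousLinearMap.inverse_eq hr hl]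
  have := congrArg (fun L : E →L[ℝ] E => L v) key
  exact this

/-- Differentiate `m (a, b) = m (a b a⁻¹, a)` in `b` at `0`, then in `a` at `0`: the left side gives
one mixed second derivative, the right side the other one plus the derivative of `Ad`. -/
lemma groupBracket_apply_eq (v w : E) :
    groupBracket H v w =
      fderiv ℝ (fderiv ℝ (fun x : E × E => (unitChart (unitChartInv x.1 * unitChartInv x.2 : H) : E)))
        0 (v, 0) (0, w) -
      fderiv ℝ (fderiv ℝ (fun x : E × E => (unitChart (unitChartInv x.1 * unitChartInv x.2 : H) : E)))
        0 (w, 0) (0, v) := by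
  set m : E × E → E := fun x => (unitChart (unitChartInv x.1 * unitChartInv x.2 : H) : E) with hm
  have hmc : ContDiffAt ℝ ∞ m 0 := contDiffAt_unitChart_mul
  have hM : HasFDerivAt (fderiv ℝ m) (fderiv ℝ (fderiv ℝ m) 0) 0 :=
    ((hmc.fderiv_right (m := ∞) (by simp)).differentiableAt (by simp)).hasFDerivAt
  have hsymm : IsSymmSndFDerivAt ℝ m 0 := hmc.isSymmSndFDerivAt (by simpa using! ENat.LEInfty.out)
  have hM0 : fderiv ℝ m 0 = ContinuousLinearMap.fst ℝ E E + ContinuousLinearMap.snd ℝ E E :=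
    (hasStrictFDerivAt_unitChart_mul (E := E) (H := H)).hasFDerivAt.fderiv
  -- the two sides of `L(a) w = R(a) (Ad(a) w)`
  have hL : HasFDerivAt (fun a : E => fderiv ℝ m (a, 0) (0, w))
      (((ContinuousLinearMap.apply ℝ E ((0 : E), w)).comp (fderiv ℝ (fderiv ℝ m) 0)).comp
        (ContinuousLinearMap.inl ℝ E E)) 0 :=
    ((ContinuousLinearMap.apply ℝ E ((0 : E), w)).hasFDerivAt.comp (0 : E)
      (HasFDerivAt.comp (0 : E) (f := fun a : E => (a, (0 : E))) hM
        (hasFDerivAt_prodMk_left (0 : E) (0 : E))))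
  have hR1 : HasFDerivAt (fun a : E => fderiv ℝ m (0, a))
      ((fderiv ℝ (fderiv ℝ m) 0).comp (ContinuousLinearMap.inr ℝ E E)) 0 :=
    HasFDerivAt.comp (0 : E) (f := fun a : E => ((0 : E), a)) hM
      (hasFDerivAt_prodMk_right (0 : E) (0 : E))
  have hR2 : HasFDerivAt (fun a : E => ContinuousLinearMap.inl ℝ E E (groupAd (unitChartInv a : H) w))
      ((ContinuousLinearMap.inl ℝ E E).comp
        ((ContinuousLinearMap.apply ℝ E w).comp (groupBracket H))) 0 :=
    (ContinuousLinearMap.inl ℝ E E).hasFDerivAt.comp (0 : E)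
      ((ContinuousLinearMap.apply ℝ E w).hasFDerivAt.comp (0 : E) hasFDerivAt_groupAd_unitChartInv)
  have hR := hR1.clm_apply hR2
  have hLR : (fun a : E => fderiv ℝ m (a, 0) (0, w)) =ᶠ[𝓝 0]
      fun a : E => fderiv ℝ m (0, a) (ContinuousLinearMap.inl ℝ E E (groupAd (unitChartInv a : H) w)) := by
    have h1 := (hmc.of_le (m := 1) (by exact_mod_cast le_top)).eventually (by simp)
    have hl : Tendsto (fun a : E => (a, (0 : E))) (𝓝 0) (𝓝 (0 : E × E)) := by
      have : ContinuousAt (fun a : E => (a, (0 : E))) 0 := by fun_prop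
      exact this
    have hr : Tendsto (fun a : E => ((0 : E), a)) (𝓝 0) (𝓝 (0 : E × E)) := by
      have : ContinuousAt (fun a : E => ((0 : E), a)) 0 := by fun_prop
      exact this
    filter_upwards [hl.eventually h1, hr.eventually h1,
      unitChart_unitChartInv (E := E) (H := H), 
      (tendsto_unitChartInv (E := E) (H := H)).eventually
        (unitChartInv_unitChart (E := E) (H := H))] with a hal har ha1 ha2
    have d1 := (hal.differentiableAt (by simp)).hasFDerivAt.comp (0 : E)
      (hasFDerivAt_prodMk_right a (0 : E))
    have d2 := hasFDerivAt_unitChart_conj (E := E) (unitChartInv a : H)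
    have d3 := HasFDerivAt.comp (0 : E) (g := m)
      (f := fun b : E => ((unitChart (unitChartInv a * unitChartInv b * (unitChartInv a)⁻¹ : H) : E), a))
      (by simpa using! (har.differentiableAt (by simp)).hasFDerivAt)
      (d2.prodMk (hasFDerivAt_const a (0 : E)))
    have d4 : HasFDerivAt (fun b : E => m (a, b)) _ 0 := d1
    have e : (fun b : E => m (a, b)) =ᶠ[𝓝 0] (m ∘ fun b : E =>
        ((unitChart (unitChartInv a * unitChartInv b * (unitChartInv a)⁻¹ : H) : E), a)) := by
      have ht : Tendsto (fun b : E => (unitChartInv a * unitChartInv b * (unitChartInv a)⁻¹ : H))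
          (𝓝 0) (𝓝 1) := by
        simpa using ((tendsto_unitChartInv (E := E) (H := H)).const_mul
          (unitChartInv a)).mul_const (unitChartInv a)⁻¹
      filter_upwards [ht.eventually (unitChartInv_unitChart (E := E) (H := H))] with b hb
      simp [hm, hb]
    have := d4.unique (d3.congr_of_eventuallyEq e)
    simpa using! congrArg (fun L : E →L[ℝ] E => L w) this
  have key := congrArg (fun L : E →L[ℝ] E => L v) (hL.unique (hR.congr_of_eventuallyEq hLR))
  simp only [ContinuousLinearMap.comp_apply, ContinuousLinearMap.inl_apply,
    ContinuousLinearMap.apply_apply, add_apply, ContinuousLinearMap.inr_apply,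
    ContinuousLinearMap.flip_apply, unitChartInv_zero, groupAd_one,
    ContinuousLinearMap.id_apply] at key
  rw [hsymm.eq (0, v) (w, 0)] at key
  have h0 : fderiv ℝ m (0, 0) (groupBracket H v w, 0) = groupBracket H v w := by
    change fderiv ℝ m 0 _ = _
    rw [hM0]; simp
  rw [key, h0]
  abel

variable [CompleteSpace E]

omit [CompleteSpace E] in
lemma lieBracketWithin_univ_of_hasFDerivAt {V W : E → E} {V' W' : E →L[ℝ] E} {c v w : E}
    (hV : HasFDerivAt V V' c) (hW : HasFDerivAt W W' c) (hv : V c = v) (hw : W c = w) :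
    VectorField.lieBracketWithin ℝ V W univ c = W' v - V' w := by
  rw [VectorField.lieBracketWithin_univ, VectorField.lieBracket, hV.fderiv, hW.fderiv, hv, hw]

/-- In the chart the two left-invariant fields are partial derivatives of the multiplication, and
their bracket at the unit is the antisymmetrised mixed derivative of `groupBracket_apply_eq`. Lie
algebra computations can then be done with `groupBracket` on the model space. -/
lemma lie_eq_groupBracket (v w : GroupLieAlgebra 𝓘(ℝ, E) H) :
    ⁅v, w⁆ = groupBracket (E := E) H v w := by
  set m : E × E → E := fun x => (unitChart (unitChartInv x.1 * unitChartInv x.2 : H) : E) with hm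
  have hmc : ContDiffAt ℝ ∞ m 0 := contDiffAt_unitChart_mul
  have hM : HasFDerivAt (fderiv ℝ m) (fderiv ℝ (fderiv ℝ m) 0) 0 :=
    ((hmc.fderiv_right (m := ∞) (by simp)).differentiableAt (by simp)).hasFDerivAt
  have hM0 : fderiv ℝ m 0 = ContinuousLinearMap.fst ℝ E E + ContinuousLinearMap.snd ℝ E E :=
    (hasStrictFDerivAt_unitChart_mul (E := E) (H := H)).hasFDerivAt.fderiv
  set c := chartAt E (1 : H) 1
  have hd (w : E) : HasFDerivAt (fun y : E => fderiv ℝ m (y - c, 0) (0, w))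
      (((ContinuousLinearMap.apply ℝ E ((0 : E), w)).comp (fderiv ℝ (fderiv ℝ m) 0)).comp
        (ContinuousLinearMap.inl ℝ E E)) c := by
    refine (ContinuousLinearMap.apply ℝ E ((0 : E), w)).hasFDerivAt.comp c
      (HasFDerivAt.comp c (f := fun y : E => (y - c, (0 : E))) (by simpa using! hM) ?_)
    exact ((hasFDerivAt_id c).sub_const c).prodMk (hasFDerivAt_const (0 : E) c)
  have hf (w : E) : HasFDerivAt (VectorField.mpullbackWithin 𝓘(ℝ, E) 𝓘(ℝ, E)
      (extChartAt 𝓘(ℝ, E) (1 : H)).symm (mulInvariantVectorField (I := 𝓘(ℝ, E)) (G := H) w)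
        (range 𝓘(ℝ, E)) : E → E)
      (((ContinuousLinearMap.apply ℝ E ((0 : E), w)).comp (fderiv ℝ (fderiv ℝ m) 0)).comp
        (ContinuousLinearMap.inl ℝ E E)) c :=
    (hd w).congr_of_eventuallyEq (mpullbackWithin_mulInvariantVectorField w)
  have hv (w : E) : (VectorField.mpullbackWithin 𝓘(ℝ, E) 𝓘(ℝ, E)
      (extChartAt 𝓘(ℝ, E) (1 : H)).symm (mulInvariantVectorField (I := 𝓘(ℝ, E)) (G := H) w)
        (range 𝓘(ℝ, E)) : E → E) c = w := by
    refine (mpullbackWithin_mulInvariantVectorField (H := H) w).self_of_nhds.trans ?_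
    have e : ((chartAt E (1 : H) 1 - chartAt E (1 : H) 1, 0) : E × E) = 0 := by simp
    rw [e]
    change fderiv ℝ m 0 _ = _
    rw [hM0]; simp
  have key : VectorField.lieBracketWithin ℝ
      (VectorField.mpullbackWithin 𝓘(ℝ, E) 𝓘(ℝ, E)
        (extChartAt 𝓘(ℝ, E) (1 : H)).symm (mulInvariantVectorField v) (range 𝓘(ℝ, E)) : E → E)
      (VectorField.mpullbackWithin 𝓘(ℝ, E) 𝓘(ℝ, E)
        (extChartAt 𝓘(ℝ, E) (1 : H)).symm (mulInvariantVectorField w) (range 𝓘(ℝ, E)) : E → E)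
      univ c = groupBracket (E := E) H v w := by
    refine (lieBracketWithin_univ_of_hasFDerivAt (hf v) (hf w) (hv v) (hv w)).trans ?_
    exact (groupBracket_apply_eq (H := H) (E := E) v w).symm
  have h1 : (mfderiv 𝓘(ℝ, E) 𝓘(ℝ, E) (extChartAt 𝓘(ℝ, E) (1 : H)) 1).inverse =
      ContinuousLinearMap.id ℝ _ := by
    rw [mfderiv_extChartAt_self]
    exact ContinuousLinearMap.inverse_id
  have h2 := VectorField.mlieBracketWithin_apply (I := 𝓘(ℝ, E)) (s := univ) (x₀ := (1 : H))
    (V := mulInvariantVectorField v) (W := mulInvariantVectorField w)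
  rw [VectorField.mlieBracketWithin_univ, ← GroupLieAlgebra.bracket_def] at h2
  refine h2.trans ?_
  refine (congrArg (fun L : E →L[ℝ] E => L _) h1).trans ?_
  have hs : ((extChartAt 𝓘(ℝ, E) (1 : H)).symm ⁻¹' univ ∩ range 𝓘(ℝ, E)) = univ := by simp
  rw [hs]
  exact key

end BracketAd

/-! ### One-parameter subgroups and the exponential map -/

section Translation

variable {E : Type*} [NormedAddCommGroup E] [NormedSpace ℝ E]
  {H : Type*} [TopologicalSpace H] [ChartedSpace E H] [Group H]
  [LieGroup 𝓘(ℝ, E) ∞ H] [IsTopologicalGroup H]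

/-- The derivative at the unit of the left translation by `p`. -/
def leftTrans (p : H) : E →L[ℝ] E := mfderiv 𝓘(ℝ, E) 𝓘(ℝ, E) (fun x : H => p * x) 1

lemma hasMFDerivAt_leftTrans (p : H) :
    HasMFDerivAt 𝓘(ℝ, E) 𝓘(ℝ, E) (fun x : H => p * x) 1 (leftTrans (E := E) p) :=
  hasMFDerivAt_const_mul p 1

lemma leftTrans_mul {p q : H} {L : E →L[ℝ] E}
    (hL : HasMFDerivAt 𝓘(ℝ, E) 𝓘(ℝ, E) (fun x : H => p * x) q L) :
    leftTrans (E := E) (p * q) = L.comp (leftTrans q) := by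
  have hL' : HasMFDerivAt 𝓘(ℝ, E) 𝓘(ℝ, E) (fun x : H => p * x) (q * 1) L := by
    rw [mul_one]; exact hL
  have h := HasMFDerivAt.comp (1 : H) (f := fun x : H => q * x) hL' (hasMFDerivAt_leftTrans q)
  have h2 := hasMFDerivAt_leftTrans (E := E) (p * q)
  have e : (fun x : H => p * q * x) = (fun x : H => p * x) ∘ fun x : H => q * x := by
    funext x; simp [mul_assoc]
  rw [e] at h2
  exact hasMFDerivAt_unique h2 h

lemma leftTrans_one : leftTrans (E := E) (1 : H) = ContinuousLinearMap.id ℝ E := by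
  have h2 := hasMFDerivAt_leftTrans (E := E) (1 : H)
  have e : (fun x : H => 1 * x) = id := by funext x; simp
  rw [e] at h2
  exact hasMFDerivAt_unique h2 (hasMFDerivAt_id 1)

lemma HasLogDerivAt.hasMFDerivAt {V : Type*} [NormedAddCommGroup V] [NormedSpace ℝ V]
    {f : V → H} {f' : V →L[ℝ] E} {x : V} (hf : HasLogDerivAt f f' x) :
    HasMFDerivAt 𝓘(ℝ, V) 𝓘(ℝ, E) f x
      ((leftTrans (E := E) (f x)).comp f' : V →L[ℝ] E) := by
  have h1 := (hasLogDerivAt_iff_of_eq_one (by simp)).1 (hf.const_mul (f x)⁻¹)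
  have h2 : HasMFDerivAt 𝓘(ℝ, E) 𝓘(ℝ, E) (fun q : H => f x * q) ((f x)⁻¹ * f x)
      (leftTrans (E := E) (f x)) := by
    rw [inv_mul_cancel]; exact hasMFDerivAt_leftTrans (f x)
  have h3 := HasMFDerivAt.comp x (f := fun y => (f x)⁻¹ * f y) h2 h1
  have e : (fun q : H => f x * q) ∘ (fun y => (f x)⁻¹ * f y) = f := by funext y; simp
  rw [e] at h3
  exact h3

lemma HasLogDerivAt.of_leftTrans {V : Type*} [NormedAddCommGroup V] [NormedSpace ℝ V]
    {f : V → H} {f' : V →L[ℝ] E} {x : V}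
    (hf : HasMFDerivAt 𝓘(ℝ, V) 𝓘(ℝ, E) f x
      ((leftTrans (E := E) (f x)).comp f' : V →L[ℝ] E)) :
    HasLogDerivAt f f' x := by
  have h1 : HasMFDerivAt 𝓘(ℝ, E) 𝓘(ℝ, E) (fun q : H => (f x)⁻¹ * q) (f x) _ :=
    hasMFDerivAt_const_mul (f x)⁻¹ (f x)
  have h2 := leftTrans_mul (E := E) h1
  rw [inv_mul_cancel, leftTrans_one] at h2
  have h3 := HasMFDerivAt.comp x (f := f) h1 hf
  have h4 : HasLogDerivAt (fun y => (f x)⁻¹ * f y) f' x := by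
    rw [hasLogDerivAt_iff_of_eq_one (by simp)]
    refine h3.congr_mfderiv ?_
    have := congrArg (fun L : E →L[ℝ] E => L.comp f') h2
    exact this.symm
  simpa using h4.const_mul (f x)

end Translation

lemma groupBracket_swap {E : Type*} [NormedAddCommGroup E] [NormedSpace ℝ E]
    {H : Type*} [TopologicalSpace H] [ChartedSpace E H] [Group H]
    [LieGroup 𝓘(ℝ, E) ∞ H] [IsTopologicalGroup H] (v w : E) :
    groupBracket H v w = -groupBracket H w v := by
  rw [groupBracket_apply_eq, groupBracket_apply_eq, neg_sub]

section Exp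

variable {E : Type*} [NormedAddCommGroup E] [NormedSpace ℝ E] [CompleteSpace E]
  {H : Type*} [TopologicalSpace H] [ChartedSpace E H] [Group H]
  [LieGroup 𝓘(ℝ, E) ∞ H] [IsTopologicalGroup H] [T2Space H]

lemma contMDiff_one_mulInvariantVectorField (v : GroupLieAlgebra 𝓘(ℝ, E) H) :
    ContMDiff 𝓘(ℝ, E) (𝓘(ℝ, E).tangent) 1
      (fun g : H => (⟨g, mulInvariantVectorField v g⟩ : TangentBundle 𝓘(ℝ, E) H)) :=
  (contMDiff_mulInvariantVectorField v).of_le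
    (le_trans (by norm_num) (le_minSmoothness (𝕜 := ℝ) (n := 2)))

lemma hasLogDerivAt_of_integral {γ : ℝ → H} {v : GroupLieAlgebra 𝓘(ℝ, E) H} {t : ℝ}
    (h : HasMFDerivAt 𝓘(ℝ, ℝ) 𝓘(ℝ, E) γ t
      ((1 : ℝ →L[ℝ] ℝ).smulRight (mulInvariantVectorField v (γ t)))) :
    HasLogDerivAt (E := E) γ (ContinuousLinearMap.toSpanSingleton ℝ (v : E)) t := by
  refine HasLogDerivAt.of_leftTrans (h.congr_mfderiv ?_)
  ext
  change (1 : ℝ) • (leftTrans (E := E) (γ t) v) = leftTrans (E := E) (γ t) ((1 : ℝ) • (v : E))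
  rw [one_smul, one_smul]

lemma HasLogDerivAt.integral {γ : ℝ → H} {v : E} {t : ℝ}
    (h : HasLogDerivAt (E := E) γ (ContinuousLinearMap.toSpanSingleton ℝ v) t) :
    HasMFDerivAt 𝓘(ℝ, ℝ) 𝓘(ℝ, E) γ t
      ((1 : ℝ →L[ℝ] ℝ).smulRight (mulInvariantVectorField (I := 𝓘(ℝ, E)) (G := H) v (γ t))) := by
  refine h.hasMFDerivAt.congr_mfderiv ?_
  ext
  change leftTrans (E := E) (γ t) ((1 : ℝ) • (v : E)) = (1 : ℝ) • (leftTrans (E := E) (γ t) v)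
  rw [one_smul, one_smul]

/-- Both are integral curves of the left-invariant field with value `v` at the unit, hence equal by
uniqueness. -/
lemma eq_of_hasLogDerivAt {γ η : ℝ → H} {v : E} {t₀ : ℝ}
    (hγ : ∀ t, HasLogDerivAt γ (ContinuousLinearMap.toSpanSingleton ℝ v) t)
    (hη : ∀ t, HasLogDerivAt η (ContinuousLinearMap.toSpanSingleton ℝ v) t) (h : γ t₀ = η t₀) :
    γ = η :=
  isMIntegralCurve_Ioo_eq_of_contMDiff_boundaryless
    (contMDiff_one_mulInvariantVectorField (H := H) v)
    (fun t => (hγ t).integral) (fun t => (hη t).integral) h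

/-- Left translates of one local integral curve are integral curves through every point, on a common
time interval; this uniform time of existence makes the flow global. -/
lemma exists_hasLogDerivAt (v : E) : ∃ γ : ℝ → H, γ 0 = 1 ∧
    ∀ t, HasLogDerivAt γ (ContinuousLinearMap.toSpanSingleton ℝ v) t := by
  have hv := contMDiff_one_mulInvariantVectorField (H := H) (E := E) v
  obtain ⟨γ, hγ0, hγ⟩ := exists_isMIntegralCurveAt_of_contMDiffAt_boundaryless 0
    (hv.contMDiffAt (x := (1 : H)))
  obtain ⟨ε, hε, hγε⟩ := isMIntegralCurveAt_iff'.1 hγ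
  obtain ⟨η, hη0, hη⟩ := exists_isMIntegralCurve_of_isMIntegralCurveOn hv hε (fun p => by
    refine ⟨fun t => p * γ t, by simp [hγ0], fun t ht => ?_⟩
    have ht' : t ∈ Metric.ball (0 : ℝ) ε := by
      rw [Real.ball_eq_Ioo]; simpa using ht
    have h1 := (hγε t ht').hasMFDerivAt (Metric.isOpen_ball.mem_nhds ht')
    exact ((hasLogDerivAt_of_integral h1).const_mul p).integral.hasMFDerivWithinAt) (1 : H)
  exact ⟨η, hη0, fun t => hasLogDerivAt_of_integral (hη t)⟩

lemma mul_of_hasLogDerivAt {γ : ℝ → H} {v : E} (h0 : γ 0 = 1)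
    (hγ : ∀ t, HasLogDerivAt γ (ContinuousLinearMap.toSpanSingleton ℝ v) t) (s t : ℝ) :
    γ (s + t) = γ s * γ t := by
  have h1 : (fun t => γ (s + t)) = fun t => γ s * γ t := by
    refine eq_of_hasLogDerivAt (v := v) (t₀ := 0) (fun t => ?_)
      (fun t => (hγ t).const_mul _) (by simp [h0])
    have := (hγ (s + t)).comp (g := fun t => s + t) ((hasFDerivAt_id t).const_add s)
    simpa using this
  exact congrFun h1 t

omit [ChartedSpace E H] [LieGroup 𝓘(ℝ, E) ∞ H] [IsTopologicalGroup H] [T2Space H]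
    [TopologicalSpace H] in
lemma map_zero_of_mul {γ : ℝ → H} (h : ∀ s t, γ (s + t) = γ s * γ t) : γ 0 = 1 := by
  have := h 0 0
  simpa using this

lemma IsOneParameterSubgroup.hasLogDerivAt {v : GroupLieAlgebra 𝓘(ℝ, E) H} {γ : ℝ → H}
    (h : IsOneParameterSubgroup v γ) (t : ℝ) :
    HasLogDerivAt (E := E) γ (ContinuousLinearMap.toSpanSingleton ℝ (v : E)) t := by
  have h0 := map_zero_of_mul h.1
  have h1 := (hasLogDerivAt_iff_of_eq_one (E := E) h0).2 h.2
  have h2 := HasLogDerivAt.comp (E := E) (f := γ) (g := fun s => s - t) (x := t)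
    (by simpa using h1) ((hasFDerivAt_id t).sub_const t)
  have h3 := h2.const_mul (γ t)
  simp only [← h.1] at h3
  simpa using! h3

/-- The exponential map of a Lie group, with the Lie algebra written as the model space. -/
def groupExp (v : E) : H := lieExp (E := E) (G := H) v

/-- Uniqueness of integral curves makes the choice in `lieExp` harmless. -/
lemma groupExp_eq {γ : ℝ → H} {v : E} (h0 : γ 0 = 1)
    (hγ : ∀ t, HasLogDerivAt γ (ContinuousLinearMap.toSpanSingleton ℝ v) t) :
    groupExp v = γ 1 := by
  have hex : ∃ γ : ℝ → H, IsOneParameterSubgroup (E := E) (G := H) v γ :=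
    ⟨γ, mul_of_hasLogDerivAt h0 hγ, (hasLogDerivAt_iff_of_eq_one h0).1 (hγ 0)⟩
  have h := hex.choose_spec
  refine (dif_pos hex : groupExp v = hex.choose 1).trans ?_
  exact congrFun (eq_of_hasLogDerivAt (v := v) (t₀ := 0) (fun t => h.hasLogDerivAt t) hγ
    ((map_zero_of_mul h.1).trans h0.symm)) 1

lemma groupExp_smul_eq {γ : ℝ → H} {v : E} (h0 : γ 0 = 1)
    (hγ : ∀ t, HasLogDerivAt γ (ContinuousLinearMap.toSpanSingleton ℝ v) t) (t : ℝ) :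
    groupExp (t • v) = γ t := by
  rw [groupExp_eq (γ := fun s => γ (t * s)) (v := t • v) (by simp [h0]) (fun s => ?_), mul_one]
  have := (hγ (t * s)).comp (g := fun s => t * s) ((hasDerivAt_id s).const_mul t).hasFDerivAt
  convert! this using 1
  ext; simp

lemma hasLogDerivAt_groupExp_smul (v : E) (t : ℝ) :
    HasLogDerivAt (fun t : ℝ => (groupExp (t • v) : H))
      (ContinuousLinearMap.toSpanSingleton ℝ v) t := by
  obtain ⟨γ, h0, hγ⟩ := exists_hasLogDerivAt (H := H) v
  have : (fun t : ℝ => (groupExp (t • v) : H)) = γ := funext (groupExp_smul_eq h0 hγ)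
  rw [this]; exact hγ t

@[simp] lemma groupExp_zero : (groupExp (0 : E) : H) = 1 := by
  obtain ⟨γ, h0, hγ⟩ := exists_hasLogDerivAt (H := H) (0 : E)
  simpa [h0] using groupExp_smul_eq h0 hγ 0

lemma groupExp_add_smul (v : E) (s t : ℝ) :
    (groupExp ((s + t) • v) : H) = groupExp (s • v) * groupExp (t • v) :=
  mul_of_hasLogDerivAt (γ := fun t : ℝ => (groupExp (t • v) : H)) (v := v) (by simp)
    (hasLogDerivAt_groupExp_smul v) s t

lemma groupExp_neg (v : E) : (groupExp (-v) : H) = (groupExp v)⁻¹ := by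
  have := groupExp_add_smul (H := H) v (-1) 1
  simp only [neg_add_cancel, zero_smul, groupExp_zero, neg_smul, one_smul] at this
  exact eq_inv_of_mul_eq_one_left this.symm

lemma groupExp_conj (p : H) (v : E) : p * groupExp v * p⁻¹ = groupExp (groupAd p v) := by
  refine Eq.symm ((groupExp_eq (γ := fun t : ℝ => p * groupExp (t • v) * p⁻¹) (by simp)
    (fun t => ?_)).trans (by simp))
  convert! (hasLogDerivAt_groupExp_smul (H := H) v t).conj p using 1
  ext; simp

lemma hasDerivAt_groupAd_groupExp (v : E) (t : ℝ) :
    HasDerivAt (fun t : ℝ => groupAd (E := E) (groupExp (t • v) : H))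
      ((groupAd (E := E) (groupExp (t • v) : H)).comp (groupBracket H v)) t := by
  have := (hasLogDerivAt_groupExp_smul (H := H) v t).hasFDerivAt_groupAd.hasDerivAt
  simpa using! this

lemma groupAd_groupExp_of_bracket_eq_zero {v w : E} (h : groupBracket H v w = 0) :
    groupAd (groupExp v : H) w = w := by
  have hd (t : ℝ) : HasDerivAt (fun t : ℝ => groupAd (E := E) (groupExp (t • v) : H) w) 0 t := by
    have := (hasDerivAt_groupAd_groupExp (H := H) v t).clm_apply (hasDerivAt_const t w)
    simpa [h] using this
  have := is_const_of_deriv_eq_zero (fun t => (hd t).differentiableAt)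
    (fun t => (hd t).deriv) 1 0
  simpa using this

lemma groupExp_add {v w : E} (h : groupBracket H v w = 0) :
    (groupExp (v + w) : H) = groupExp v * groupExp w := by
  refine (groupExp_eq (γ := fun t : ℝ => (groupExp (t • v) * groupExp (t • w) : H)) (by simp)
    (fun t => ?_)).trans (by simp)
  have hsw (s : ℝ) : groupBracket H (s • w) v = 0 := by
    rw [groupBracket_swap, map_smul, h, smul_zero, neg_zero]
  convert! (hasLogDerivAt_groupExp_smul (H := H) v t).mul (hasLogDerivAt_groupExp_smul w t) using 1
  ext
  have h1 : groupAd (E := E) (groupExp (t • w) : H)⁻¹ v = v := by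
    rw [← groupExp_neg, ← neg_smul]
    exact groupAd_groupExp_of_bracket_eq_zero (hsw _)
  simp [h1]

end Exp

/-! ### The exponential map near the origin -/

section ExpStrict

variable {E : Type*} [NormedAddCommGroup E] [NormedSpace ℝ E]
  {H : Type*} [TopologicalSpace H] [ChartedSpace E H] [Group H]
  [LieGroup 𝓘(ℝ, E) ∞ H] [IsTopologicalGroup H]

/-- Left invariant vector fields, read in the chart at the unit. -/
def chartLeftTrans (H : Type*) [TopologicalSpace H] [ChartedSpace E H] [Group H] (a : E) : E →L[ℝ] E :=
  (fderiv ℝ (fun x : E × E => (unitChart (unitChartInv x.1 * unitChartInv x.2 : H) : E)) (a, 0)).comp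
    (ContinuousLinearMap.inr ℝ E E)

lemma tendsto_prodMk_zero : Tendsto (fun a : E => (a, (0 : E))) (𝓝 0) (𝓝 (0 : E × E)) := by
  have : ContinuousAt (fun a : E => (a, (0 : E))) 0 := by fun_prop
  exact this

lemma contDiffAt_chartLeftTrans : ContDiffAt ℝ ∞ (chartLeftTrans (E := E) H) 0 := by
  have h := (contDiffAt_unitChart_mul (𝕜 := ℝ) (n := ∞) (H := H) (E := E)).fderiv_right
    (m := ∞) (by simp)
  have h2 : ContDiffAt ℝ ∞ (fun a : E => (a, (0 : E))) 0 := by fun_prop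
  exact (ContDiffAt.comp (0 : E) (f := fun a : E => (a, (0 : E))) h h2).clm_comp contDiffAt_const

lemma chartLeftTrans_zero : chartLeftTrans (E := E) H 0 = ContinuousLinearMap.id ℝ E := by
  ext v
  have := (hasStrictFDerivAt_unitChart_mul (E := E) (H := H)).hasFDerivAt.fderiv
  have h0 : ((0 : E), (0 : E)) = 0 := rfl
  simp only [chartLeftTrans, ContinuousLinearMap.comp_apply, h0, this]
  simp

lemma eventually_hasFDerivAt_chartLeftTrans : ∀ᶠ a in 𝓝 (0 : E),
    HasFDerivAt (fun b : E => (unitChart (unitChartInv a * unitChartInv b : H) : E))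
      (chartLeftTrans H a) 0 := by
  have h := ((contDiffAt_unitChart_mul (𝕜 := ℝ) (n := ∞) (H := H) (E := E)).of_le
    (m := 1) (by exact_mod_cast le_top)).eventually (by simp)
  filter_upwards [tendsto_prodMk_zero.eventually h] with a ha
  exact (ha.differentiableAt (by simp)).hasFDerivAt.comp (0 : E) (hasFDerivAt_prodMk_right a 0)

lemma contDiffAt_unitChart_inv_mul : ContDiffAt ℝ ∞
    (fun x : E × E => (unitChart ((unitChartInv x.1)⁻¹ * unitChartInv x.2 : H) : E)) 0 := by
  rw [← contMDiffAt_iff_contDiffAt]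
  have h1 : ContMDiffAt 𝓘(ℝ, E × E) 𝓘(ℝ, E) ∞ (fun x : E × E => (unitChartInv x.1 : H)) 0 :=
    ContMDiffAt.comp (0 : E × E) (g := unitChartInv) (contMDiffAt_unitChartInv (H := H) (E := E))
      (by rw [contMDiffAt_iff_contDiffAt]; fun_prop)
  have h2 : ContMDiffAt 𝓘(ℝ, E × E) 𝓘(ℝ, E) ∞ (fun x : E × E => (unitChartInv x.2 : H)) 0 :=
    ContMDiffAt.comp (0 : E × E) (g := unitChartInv) (contMDiffAt_unitChartInv (H := H) (E := E))
      (by rw [contMDiffAt_iff_contDiffAt]; fun_prop)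
  refine ContMDiffAt.comp (0 : E × E) (g := (unitChart : H → E)) ?_ (h1.inv.mul h2)
  simpa using contMDiffAt_unitChart (H := H) (E := E) (𝕜 := ℝ) (n := ∞)

/-- The two derivatives are inverse because `a⁻¹ (a b) = b`. The relation turns solutions of `x' =
chartLeftTrans H x v` in the chart into curves of constant logarithmic derivative `v`. -/
lemma eventually_hasLogDerivAt_unitChartInv : ∀ᶠ a in 𝓝 (0 : E), ∃ A : E →L[ℝ] E,
    HasLogDerivAt (unitChartInv : E → H) A a ∧
      A.comp (chartLeftTrans H a) = ContinuousLinearMap.id ℝ E := by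
  have h := ((contDiffAt_unitChart_inv_mul (H := H) (E := E)).of_le
    (m := 1) (by exact_mod_cast le_top)).eventually (by simp)
  have hdiag : Tendsto (fun a : E => (a, a)) (𝓝 0) (𝓝 (0 : E × E)) := by
    have : ContinuousAt (fun a : E => (a, a)) 0 := by fun_prop
    exact this
  filter_upwards [hdiag.eventually h, eventually_hasFDerivAt_chartLeftTrans (E := E) (H := H),
    eventually_continuousAt_unitChartInv (E := E) (H := H),
    unitChart_unitChartInv (E := E) (H := H),
    (tendsto_unitChartInv (E := E) (H := H)).eventually (unitChartInv_unitChart (E := E)).eventually_nhds] with a ha hL hc ha0 hau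
  have hA := (ha.differentiableAt (by simp)).hasFDerivAt.comp a (hasFDerivAt_prodMk_right a a)
  refine ⟨_, ⟨hc, hA⟩, ?_⟩
  have hA' := HasFDerivAt.comp (0 : E)
    (g := fun y : E => (unitChart ((unitChartInv a)⁻¹ * unitChartInv y : H) : E))
    (f := fun b : E => (unitChart (unitChartInv a * unitChartInv b : H) : E))
    (by simpa [ha0] using! hA) hL
  refine hA'.unique ((hasFDerivAt_id (0 : E)).congr_of_eventuallyEq ?_)
  have ht : Tendsto (fun b : E => (unitChartInv a * unitChartInv b : H)) (𝓝 0)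
      (𝓝 (unitChartInv a)) := by
    simpa using (tendsto_unitChartInv (E := E) (H := H)).const_mul (unitChartInv a : H)
  filter_upwards [ht.eventually hau, unitChart_unitChartInv (E := E) (H := H)] with b hb hb2
  simp [hb, hb2]

variable [CompleteSpace E]

/-- In the system `x' = chartLeftTrans H x v`, `v' = 0` on `E × E` the parameter `v` is part of the
initial value, so Lipschitz dependence on initial values becomes Lipschitz dependence of `x v t` on
`v`. The last bound compares with `v = 0`, whose solution is constant. -/
lemma exists_chart_flow (H : Type*) [TopologicalSpace H] [ChartedSpace E H] [Group H]
    [LieGroup 𝓘(ℝ, E) ∞ H] [IsTopologicalGroup H] :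
    ∃ (T : ℝ) (r : ℝ) (C : ℝ) (x : E → ℝ → E), 0 < T ∧ 0 < r ∧ 0 ≤ C ∧
      (∀ v ∈ Metric.closedBall (0 : E) r, x v 0 = 0) ∧
      (∀ v ∈ Metric.closedBall (0 : E) r, ∀ t ∈ Icc (-T) T,
        HasDerivWithinAt (x v) (chartLeftTrans H (x v t) v) (Icc (-T) T) t) ∧
      (∀ v ∈ Metric.closedBall (0 : E) r, ∀ w ∈ Metric.closedBall (0 : E) r, ∀ t ∈ Icc (-T) T,
        ‖x v t - x w t‖ ≤ C * ‖v - w‖) ∧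
      (∀ v ∈ Metric.closedBall (0 : E) r, ∀ t ∈ Icc (-T) T, ‖x v t‖ ≤ C * ‖v‖) := by
  have hf : ContDiffAt ℝ 1 (fun y : E × E => (chartLeftTrans H y.1 y.2, (0 : E))) 0 := by
    have h1 : ContDiffAt ℝ 1 (fun y : E × E => chartLeftTrans (E := E) H y.1) 0 :=
      ContDiffAt.comp (0 : E × E) (g := chartLeftTrans (E := E) H)
        ((contDiffAt_chartLeftTrans (H := H)).of_le (by exact_mod_cast le_top)) contDiffAt_fst
    exact (h1.clm_apply contDiffAt_snd).prodMk contDiffAt_const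
  obtain ⟨T, hT, a, r, L, K, hr, hpl⟩ := IsPicardLindelof.of_contDiffAt_one hf
  obtain ⟨α, hα, C, hC⟩ :=
    (hpl 0).exists_forall_mem_closedBall_eq_hasDerivWithinAt_lipschitzOnWith
  simp only [zero_sub, zero_add] at hα hC
  have hmem (v : E) (hv : v ∈ Metric.closedBall (0 : E) r) :
      ((0 : E), v) ∈ Metric.closedBall (0 : E × E) r := by
    simpa [Prod.norm_def] using hv
  have h0 : (0 : ℝ) ∈ Icc (-T) T := ⟨by linarith, hT.le⟩
  have hsnd (v : E) (hv : v ∈ Metric.closedBall (0 : E) r) (t : ℝ) (ht : t ∈ Icc (-T) T) :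
      (α (0, v) t).2 = v := by
    have hd (t : ℝ) (ht : t ∈ Icc (-T) T) :
        HasDerivWithinAt (fun t => (α (0, v) t).2) 0 (Icc (-T) T) t :=
      ((hα _ (hmem v hv)).2 t ht).snd
    have := (convex_Icc (-T) T).is_const_of_fderivWithin_eq_zero (𝕜 := ℝ)
      (f := fun t => (α (0, v) t).2) (fun t ht => (hd t ht).differentiableWithinAt)
      (fun t ht => by
        rw [((hd t ht).hasFDerivWithinAt).fderivWithin (uniqueDiffOn_Icc (by linarith) t ht)]
        ext; simp) ht h0
    simpa [(hα _ (hmem v hv)).1] using this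
  have hfst (v : E) (hv : v ∈ Metric.closedBall (0 : E) r) (t : ℝ) (ht : t ∈ Icc (-T) T) :
      HasDerivWithinAt (fun t => (α (0, v) t).1) (chartLeftTrans H (α (0, v) t).1 v) (Icc (-T) T) t := by
    have : HasDerivWithinAt (fun t => (α (0, v) t).1)
        (chartLeftTrans H (α (0, v) t).1 (α (0, v) t).2) (Icc (-T) T) t :=
      ((hα _ (hmem v hv)).2 t ht).fst
    rwa [hsnd v hv t ht] at this
  have hz : (0 : E) ∈ Metric.closedBall (0 : E) r := by simp
  have hconst (t : ℝ) (ht : t ∈ Icc (-T) T) : (α (0, 0) t).1 = 0 := by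
    have hd (t : ℝ) (ht : t ∈ Icc (-T) T) :
        HasDerivWithinAt (fun t => (α ((0 : E), (0 : E)) t).1) 0 (Icc (-T) T) t := by
      simpa using hfst 0 hz t ht
    have := (convex_Icc (-T) T).is_const_of_fderivWithin_eq_zero (𝕜 := ℝ)
      (f := fun t => (α ((0 : E), (0 : E)) t).1) (fun t ht => (hd t ht).differentiableWithinAt)
      (fun t ht => by
        rw [((hd t ht).hasFDerivWithinAt).fderivWithin (uniqueDiffOn_Icc (by linarith) t ht)]
        ext; simp) ht h0
    simpa [(hα _ (hmem 0 hz)).1] using this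
  have hlip (v : E) (hv : v ∈ Metric.closedBall (0 : E) r) (w : E)
      (hw : w ∈ Metric.closedBall (0 : E) r) (t : ℝ) (ht : t ∈ Icc (-T) T) :
      ‖(α (0, v) t).1 - (α (0, w) t).1‖ ≤ C * ‖v - w‖ := by
    have h := (hC t ht).dist_le_mul _ (hmem v hv) _ (hmem w hw)
    rw [dist_eq_norm, dist_eq_norm] at h
    refine (norm_fst_le _).trans (h.trans ?_)
    simp [Prod.norm_def]
  refine ⟨T, r, C, fun v t => (α (0, v) t).1, hT, hr, C.2, fun v hv => ?_, hfst, hlip, ?_⟩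
  · simp [(hα _ (hmem v hv)).1]
  · intro v hv t ht
    simpa [hconst t ht] using hlip v hv 0 hz t ht

variable [T2Space H]

/-- The flow in the chart exists only for a short time, hence the factor `T`. Strict
differentiability holds because the velocities of `x v` and `x w` differ by `v - w` up to a small
multiple of `‖v - w‖`: `chartLeftTrans` is the identity at `0` and Lipschitz nearby. -/
lemma exists_groupExp_chart (H : Type*) [TopologicalSpace H] [ChartedSpace E H] [Group H]
    [LieGroup 𝓘(ℝ, E) ∞ H] [IsTopologicalGroup H] [T2Space H] :
    ∃ T : ℝ, 0 < T ∧ HasStrictFDerivAt (fun v : E => (unitChart (groupExp (T • v) : H) : E))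
      (T • ContinuousLinearMap.id ℝ E) 0 ∧
      ∀ᶠ v in 𝓝 (0 : E), unitChartInv (unitChart (groupExp (T • v) : H) : E) =
        (groupExp (T • v) : H) := by
  obtain ⟨T, r, C, x, hT, hr, hC, hx0, hxd, hxl, hxb⟩ := exists_chart_flow (E := E) H
  have hball {P : E → Prop} (hP : ∀ᶠ a in 𝓝 (0 : E), P a) :
      ∀ᶠ v in 𝓝 (0 : E), ∀ t ∈ Icc (-T) T, P (x v t) := by
    obtain ⟨δ, hδ, hP⟩ := Metric.eventually_nhds_iff_ball.1 hP
    have h1 : ∀ᶠ v in 𝓝 (0 : E), C * ‖v‖ < δ := by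
      have : ContinuousAt (fun v : E => C * ‖v‖) 0 := by fun_prop
      exact this.eventually_lt continuousAt_const (by simpa using hδ)
    filter_upwards [h1, Metric.closedBall_mem_nhds (0 : E) hr] with v hv hvr t ht
    exact hP _ (by simpa using (hxb v hvr t ht).trans_lt hv)
  have hexp : ∀ᶠ v in 𝓝 (0 : E), ∀ t ∈ Ioo (-T) T, (groupExp (t • v) : H) = unitChartInv (x v t) := by
    filter_upwards [hball (eventually_hasLogDerivAt_unitChartInv (E := E) (H := H)),
      Metric.closedBall_mem_nhds (0 : E) hr] with v hv hvr
    have hd (t : ℝ) (ht : t ∈ Ioo (-T) T) : HasLogDerivAt (fun t => (unitChartInv (x v t) : H))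
        (ContinuousLinearMap.toSpanSingleton ℝ v) t := by
      obtain ⟨A, hA, hAL⟩ := hv t (Ioo_subset_Icc_self ht)
      have := hA.comp ((hxd v hvr t (Ioo_subset_Icc_self ht)).hasDerivAt
        (Icc_mem_nhds ht.1 ht.2)).hasFDerivAt
      convert! this using 1
      ext
      simpa using congrArg (fun L : E →L[ℝ] E => L v) hAL.symm
    exact isMIntegralCurveOn_Ioo_eqOn_of_contMDiff_boundaryless (t₀ := 0) ⟨by linarith, hT⟩
      (contMDiff_one_mulInvariantVectorField (H := H) v)
      (fun t _ => (hasLogDerivAt_groupExp_smul v t).integral.hasMFDerivWithinAt)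
      (fun t ht => (hd t ht).integral.hasMFDerivWithinAt) (by simp [hx0 v hvr])
  -- The flow and the exponential are compared on the open interval only, so time `T / 2` serves.
  have hT2 : T / 2 ∈ Ioo (-T) T := ⟨by linarith, by linarith⟩
  have hchart : ∀ᶠ v in 𝓝 (0 : E), (unitChart (groupExp ((T / 2) • v) : H) : E) = x v (T / 2) := by
    filter_upwards [hexp, hball (unitChart_unitChartInv (E := E) (H := H))] with v hv hv2
    rw [hv _ hT2, hv2 _ (Ioo_subset_Icc_self hT2)]
  refine ⟨T / 2, by linarith, ?_, ?_⟩
  · have hst : HasStrictFDerivAt (fun v : E => x v (T / 2))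
        ((T / 2) • ContinuousLinearMap.id ℝ E) 0 := by
      obtain ⟨K, s, hs, hK⟩ := ((contDiffAt_chartLeftTrans (E := E) (H := H)).of_le (m := 1)
        (by exact_mod_cast le_top)).exists_lipschitzOnWith
      rw [hasStrictFDerivAt_iff_isLittleO, Asymptotics.isLittleO_iff]
      intro c hc
      -- Two error terms of size `c / T` each, integrated over a time `T / 2`, add up to `c`.
      have hη : 0 < c / T := by positivity
      have h1 : ∀ᶠ a in 𝓝 (0 : E),
          ‖chartLeftTrans (E := E) H a - ContinuousLinearMap.id ℝ E‖ < c / T := by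
        have : ContinuousAt (fun a => ‖chartLeftTrans (E := E) H a -
            ContinuousLinearMap.id ℝ E‖) 0 :=
          ((contDiffAt_chartLeftTrans (E := E) (H := H)).continuousAt.sub continuousAt_const).norm
        exact this.eventually_lt continuousAt_const (by simpa [chartLeftTrans_zero] using hη)
      have h2 : ∀ᶠ w in 𝓝 (0 : E), K * C * ‖w‖ < c / T := by
        have : ContinuousAt (fun v : E => K * C * ‖v‖) 0 := by fun_prop
        exact this.eventually_lt continuousAt_const (by simpa using hη)
      have h3 : ∀ᶠ v in 𝓝 (0 : E), v ∈ Metric.closedBall (0 : E) r :=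
        Metric.closedBall_mem_nhds (0 : E) hr
      have hall := (hball h1).and ((hball (P := fun a => a ∈ s) hs).and (h2.and h3))
      rw [nhds_prod_eq]
      filter_upwards [hall.prod_mk hall] with p ⟨⟨ha1, ha2, ha3, ha4⟩, hb1, hb2, hb3, hb4⟩
      obtain ⟨v, w⟩ := p
      simp only at *
      have hz (t : ℝ) (ht : t ∈ Icc 0 (T / 2)) : HasDerivWithinAt
          (fun t => x v t - x w t - t • (v - w))
          (chartLeftTrans H (x v t) v - chartLeftTrans H (x w t) w - (v - w)) (Icc 0 (T / 2)) t := by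
        have hsub : Icc 0 (T / 2) ⊆ Icc (-T) T := Icc_subset_Icc (by linarith) (by linarith)
        have hd := (hasDerivWithinAt_id t (Icc 0 (T / 2))).smul_const (v - w)
        rw [one_smul] at hd
        exact (((hxd v ha4 t (hsub ht)).mono hsub).sub ((hxd w hb4 t (hsub ht)).mono hsub)).sub hd
      have hbd (t : ℝ) (ht : t ∈ Ico 0 (T / 2)) :
          ‖chartLeftTrans H (x v t) v - chartLeftTrans H (x w t) w - (v - w)‖ ≤
            2 * (c / T) * ‖v - w‖ := by
        have ht' : t ∈ Icc (-T) T := ⟨by linarith [ht.1], by linarith [ht.2]⟩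
        have e : chartLeftTrans H (x v t) v - chartLeftTrans H (x w t) w - (v - w) =
            (chartLeftTrans H (x v t) - ContinuousLinearMap.id ℝ E) (v - w) +
            (chartLeftTrans H (x v t) - chartLeftTrans H (x w t)) w := by
          simp only [sub_apply, map_sub, ContinuousLinearMap.id_apply]
          abel
        have hl := hK.norm_sub_le (ha2 t ht') (hb2 t ht')
        rw [e]
        calc _ ≤ _ := norm_add_le _ _
          _ ≤ c / T * ‖v - w‖ + (K * (C * ‖v - w‖)) * ‖w‖ := by
            refine add_le_add ?_ ?_
            · exact (ContinuousLinearMap.le_opNorm _ _).trans (by gcongr; exact (ha1 t ht').le)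
            · refine (ContinuousLinearMap.le_opNorm _ _).trans ?_
              gcongr
              exact hl.trans (by gcongr; exact hxl v ha4 w hb4 t ht')
          _ = c / T * ‖v - w‖ + (K * C * ‖w‖) * ‖v - w‖ := by ring
          _ ≤ c / T * ‖v - w‖ + c / T * ‖v - w‖ := by gcongr
          _ = _ := by ring
      have := norm_image_sub_le_of_norm_deriv_le_segment' hz hbd (T / 2)
        ⟨by linarith, le_refl _⟩
      simp only [hx0 v ha4, hx0 w hb4, zero_smul, sub_zero] at this
      refine (le_of_eq ?_).trans (this.trans (le_of_eq ?_))
      · simp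
      · field_simp
    exact hst.congr_of_eventuallyEq (hchart.mono fun v hv => hv.symm)
  · filter_upwards [hexp, hchart] with v hv hv2
    rw [hv2, hv _ hT2]

lemma hasStrictFDerivAt_groupExp :
    HasStrictFDerivAt (fun v : E => (unitChart (groupExp v : H) : E))
      (ContinuousLinearMap.id ℝ E) 0 := by
  obtain ⟨T, hT, hs, -⟩ := exists_groupExp_chart (E := E) H
  have hl : HasStrictFDerivAt (fun v : E => T⁻¹ • v) (T⁻¹ • ContinuousLinearMap.id ℝ E) 0 :=
    (T⁻¹ • ContinuousLinearMap.id ℝ E).hasStrictFDerivAt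
  have h := HasStrictFDerivAt.comp (0 : E) (f := fun v : E => T⁻¹ • v)
    (g := fun v : E => (unitChart (groupExp (T • v) : H) : E)) (by simpa using hs) hl
  simp only [smul_smul, mul_inv_cancel₀ hT.ne', one_smul] at h
  convert! h using 1
  ext v; simp [smul_smul, hT.ne']

lemma eventually_unitChartInv_unitChart_groupExp :
    ∀ᶠ v in 𝓝 (0 : E), unitChartInv (unitChart (groupExp v : H) : E) = (groupExp v : H) := by
  obtain ⟨T, hT, -, h⟩ := exists_groupExp_chart (E := E) H
  have ht : Tendsto (fun v : E => T⁻¹ • v) (𝓝 0) (𝓝 0) := by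
    have : ContinuousAt (fun v : E => T⁻¹ • v) 0 := by fun_prop
    simpa [ContinuousAt] using this
  filter_upwards [ht.eventually h] with v hv
  simpa [smul_smul, hT.ne'] using hv

lemma hasLogDerivAt_groupExp_zero :
    HasLogDerivAt (groupExp : E → H) (ContinuousLinearMap.id ℝ E) 0 := by
  have hd := (hasStrictFDerivAt_groupExp (E := E) (H := H)).hasFDerivAt
  refine ⟨?_, by simpa using hd⟩
  have h1 : ContinuousAt (fun v : E => (unitChartInv (unitChart (groupExp v : H) : E) : H)) 0 :=
    ContinuousAt.comp (g := (unitChartInv : E → H)) (by simpa using continuousAt_unitChartInv)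
      hd.continuousAt
  exact h1.congr eventually_unitChartInv_unitChart_groupExp

/-- A homomorphism from a vector space to a Lie group that is differentiable at `0` has a constant
logarithmic derivative. -/
lemma HasLogDerivAt.of_add {V : Type*} [NormedAddCommGroup V] [NormedSpace ℝ V] {f : V → H}
    {f' : V →L[ℝ] E} (hf : HasLogDerivAt f f' 0) (hadd : ∀ x y, f (x + y) = f x * f y) (x : V) :
    HasLogDerivAt f f' x := by
  have h := HasLogDerivAt.comp (f := f) (g := fun y => y - x) (x := x) (by simpa using hf)
    ((hasFDerivAt_id x).sub_const x)
  have h2 := h.const_mul (f x)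
  simp only [← hadd] at h2
  simpa using h2

/-- In the chart, the derivative at `x` near `0` is `chartLeftTrans` at the image point composed
with the fixed `f'`, so it is continuous; `f y = f x * f (y - x)` carries this to every point. -/
lemma contMDiff_one_of_add {V : Type*} [NormedAddCommGroup V] [NormedSpace ℝ V] {f : V → H}
    {f' : V →L[ℝ] E} (hf : HasLogDerivAt f f' 0) (hadd : ∀ x y, f (x + y) = f x * f y) :
    ContMDiff 𝓘(ℝ, V) 𝓘(ℝ, E) 1 f := by
  have hall := hf.of_add hadd
  have h0 : f 0 = 1 := by have := hadd 0 0; simpa using this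
  have hc : Tendsto f (𝓝 0) (𝓝 1) := by simpa [ContinuousAt, h0] using hf.1
  have hchart : Tendsto (fun x => (unitChart (f x) : E)) (𝓝 0) (𝓝 0) := tendsto_unitChart.comp hc
  have hloc : ContMDiffAt 𝓘(ℝ, V) 𝓘(ℝ, E) 1 f 0 := by
    have hd : ∀ᶠ x in 𝓝 (0 : V), HasFDerivAt (fun x => (unitChart (f x) : E))
        ((chartLeftTrans H (unitChart (f x))).comp f') x := by
      filter_upwards [hchart.eventually (eventually_hasFDerivAt_chartLeftTrans (E := E) (H := H)),
        hc.eventually (unitChartInv_unitChart (E := E) (H := H))] with x hx hx2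
      have h1 := HasFDerivAt.comp x (f := fun y => (unitChart ((f x)⁻¹ * f y) : E))
        (by simpa using hx) (hall x).2
      refine h1.congr_of_eventuallyEq ?_
      filter_upwards [(hall x).tendsto.eventually (unitChartInv_unitChart (E := E) (H := H))] with y hy
      simp [hy, hx2]
    have hC : ContDiffAt ℝ 1 (fun x => (unitChart (f x) : E)) 0 := by
      rw [contDiffAt_one_iff]
      obtain ⟨u, hu, hdu⟩ := hd.exists_mem
      have hcont : ∀ᶠ a in 𝓝 (0 : E), ContinuousAt (chartLeftTrans (E := E) H) a := by
        have := ((contDiffAt_chartLeftTrans (E := E) (H := H)).of_le (m := 1)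
          (by exact_mod_cast le_top)).eventually (by simp)
        exact this.mono fun a ha => ha.continuousAt
      refine ⟨_, u ∩ {x | ContinuousAt (chartLeftTrans (E := E) H) (unitChart (f x))},
        inter_mem hu (hchart.eventually hcont), ?_, fun x hx => hdu x hx.1⟩
      intro x hx
      have hcx : ContinuousAt (fun x => (unitChart (f x) : E)) x := (hdu x hx.1).continuousAt
      exact ((ContinuousAt.comp (f := fun x => (unitChart (f x) : E)) (g := chartLeftTrans (E := E) H)
        hx.2 hcx).clm_comp continuousAt_const).continuousWithinAt
    have h2 : ContMDiffAt 𝓘(ℝ, V) 𝓘(ℝ, E) 1 (fun x => (unitChartInv (unitChart (f x) : E) : H)) 0 := by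
      refine ContMDiffAt.comp (0 : V) (g := (unitChartInv : E → H)) ?_ (contMDiffAt_iff_contDiffAt.2 hC)
      simpa [h0] using contMDiffAt_unitChartInv (𝕜 := ℝ) (E := E) (H := H) (n := 1)
    refine h2.congr_of_eventuallyEq ?_
    filter_upwards [hc.eventually (unitChartInv_unitChart (E := E) (H := H))] with x hx
    exact hx.symm
  intro x
  have h3 : ContMDiffAt 𝓘(ℝ, V) 𝓘(ℝ, E) 1 (fun y => f x * f (y - x)) x := by
    refine ContMDiffAt.mul contMDiffAt_const ?_
    refine ContMDiffAt.comp x (g := f) (f := fun y => y - x) (by simpa using hloc) ?_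
    rw [contMDiffAt_iff_contDiffAt]; fun_prop
  simpa [← hadd] using h3

end ExpStrict

/-! ### Conjugation into a maximal abelian subalgebra -/

section Compact

variable {E : Type*} [NormedAddCommGroup E] [NormedSpace ℝ E] [FiniteDimensional ℝ E]
  [CompleteSpace E]
  {G : Type*} [TopologicalSpace G] [ChartedSpace E G] [Group G]
  [LieGroup 𝓘(ℝ, E) ∞ G] [IsTopologicalGroup G] [T2Space G]

lemma groupAd_groupBracket (p : G) (v w : E) :
    groupAd p (groupBracket G v w) = groupBracket G (groupAd p v) (groupAd (E := E) p w) := by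
  have h1 := ((hasDerivAt_groupAd_groupExp (H := G) v 0).clm_apply (hasDerivAt_const 0 w))
  have h2 := (groupAd (E := E) p).hasFDerivAt.comp_hasDerivAt 0 h1
  have h3 := ((hasDerivAt_groupAd_groupExp (H := G) (groupAd p v) 0).clm_apply
    (hasDerivAt_const 0 (groupAd (E := E) p w)))
  have h4 : (fun t : ℝ => groupAd (E := E) (groupExp (t • groupAd p v) : G) (groupAd p w)) =
      (groupAd (E := E) p) ∘ fun t : ℝ => groupAd (E := E) (groupExp (t • v) : G) w := by
    funext t
    rw [← map_smul, ← groupExp_conj, groupAd_mul_apply, groupAd_mul_apply]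
    simp
  rw [h4] at h3
  simpa using h2.unique h3

lemma lie_lie_eq_groupBracket (u v w : GroupLieAlgebra 𝓘(ℝ, E) G) :
    ⁅u, ⁅v, w⁆⁆ = groupBracket (E := E) G u (groupBracket (E := E) G v w) :=
  (lie_eq_groupBracket u ⁅v, w⁆).trans
    (congrArg (fun z : E => groupBracket (E := E) G u z) (lie_eq_groupBracket v w))

lemma lie_lie_eq_groupBracket' (u v w : GroupLieAlgebra 𝓘(ℝ, E) G) :
    ⁅⁅u, v⁆, w⁆ = groupBracket (E := E) G (groupBracket (E := E) G u v) w :=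
  (lie_eq_groupBracket ⁅u, v⁆ w).trans
    (congrArg (fun z : E => groupBracket (E := E) G z w) (lie_eq_groupBracket u v))

lemma groupBracket_jacobi (u v w : E) :
    groupBracket G u (groupBracket G v w) =
      groupBracket G (groupBracket G u v) w + groupBracket G v (groupBracket G u w) := by
  have h (a b c : GroupLieAlgebra 𝓘(ℝ, E) G) := leibniz_lie a b c
  simp only [lie_lie_eq_groupBracket, lie_lie_eq_groupBracket'] at h
  exact h u v w

variable (G) in
/-- `B` is an inner product on the Lie algebra of `G`, invariant under the adjoint action. -/
structure IsInvariantForm (B : E →L[ℝ] E →L[ℝ] ℝ) : Prop where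
  symm : ∀ v w, B v w = B w v
  pos : ∀ v, v ≠ 0 → 0 < B v v
  invariant : ∀ (a : G) v w, B (groupAd a v) (groupAd a w) = B v w

variable {B : E →L[ℝ] E →L[ℝ] ℝ}

lemma IsInvariantForm.eq_zero (hB : IsInvariantForm G B) {v : E} (h : B v v = 0) : v = 0 := by
  by_contra hv
  exact (hB.pos v hv).ne' h

lemma IsInvariantForm.nonneg (hB : IsInvariantForm G B) (v : E) : 0 ≤ B v v := by
  by_cases hv : v = 0
  · simp [hv]
  · exact (hB.pos v hv).le

lemma IsInvariantForm.skew (hB : IsInvariantForm G B) (u v w : E) :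
    B (groupBracket G u v) w = - B v (groupBracket G u w) := by
  have h1 (v : E) := ((hasDerivAt_groupAd_groupExp (H := G) u 0).clm_apply (hasDerivAt_const 0 v))
  have h2 := (B.hasFDerivAt.comp_hasDerivAt 0 (h1 v)).clm_apply (h1 w)
  have h3 : (fun t : ℝ => (B ∘ fun t : ℝ => groupAd (E := E) (groupExp (t • u) : G) v) t
      (groupAd (E := E) (groupExp (t • u) : G) w)) = fun _ => B v w := by
    funext t
    exact hB.invariant _ _ _
  rw [h3] at h2
  have h4 := h2.unique (hasDerivAt_const 0 _)
  simp at h4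
  linarith

lemma continuous_groupAd_apply (v : E) : Continuous (fun p : G => groupAd p v) :=
  continuous_groupAd.clm_apply continuous_const

variable [CompactSpace G]

/-- Take `b` maximising `B (Ad b ξ) y` on the stabilizer of `A`, which is compact. Being at least
the value at `b = 1`, the maximum also gives the final inequality. -/
lemma IsInvariantForm.exists_commute (hB : IsInvariantForm G B) {A : Set E} {ξ y : E}
    (hξ : ∀ a ∈ A, groupBracket G a ξ = 0) (hy : ∀ a ∈ A, groupBracket G a y = 0) :
    ∃ b : G, (∀ a ∈ A, groupAd b a = a) ∧ groupBracket G (groupAd b ξ) y = 0 ∧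
      (∀ a ∈ A, groupBracket G a (groupAd b ξ) = 0) ∧ B ξ y ≤ B (groupAd b ξ) y := by
  set S : Set G := {b | ∀ a ∈ A, groupAd b a = a} with hS
  have hSc : IsClosed S := by
    simp only [hS, ofPred_forall]
    exact isClosed_biInter fun a _ => isClosed_eq (continuous_groupAd_apply a) continuous_const
  obtain ⟨b, hb, hmax⟩ := hSc.isCompact.exists_isMaxOn ⟨1, by simp [hS]⟩
    ((B.continuous.comp (continuous_groupAd_apply (G := G) ξ)).clm_apply
      continuous_const : Continuous fun b : G => B (groupAd b ξ) y).continuousOn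
  set ξ' := groupAd b ξ with hξ'
  have hcomm : ∀ a ∈ A, groupBracket G a ξ' = 0 := by
    intro a ha
    have : groupBracket G a ξ' = groupAd b (groupBracket G a ξ) := by
      rw [groupAd_groupBracket, hb a ha]
    rw [this, hξ a ha, map_zero]
  refine ⟨b, hb, ?_, hcomm, ?_⟩
  -- By the Jacobi identity `Z` commutes with `A`, so `exp(t Z) b` stays in the stabilizer.
  -- Stationarity in this direction reads `0 = B [Z, ξ'] y = B Z Z`.
  · set Z := groupBracket G ξ' y with hZ
    have hZA : ∀ a ∈ A, groupBracket G Z a = 0 := by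
      intro a ha
      rw [groupBracket_swap, hZ, groupBracket_jacobi, hcomm a ha, hy a ha]
      simp
    have hd := (B.hasFDerivAt.comp_hasDerivAt 0 ((hasDerivAt_groupAd_groupExp (H := G) Z 0).clm_apply
      (hasDerivAt_const 0 ξ'))).clm_apply (hasDerivAt_const 0 y)
    have hloc : IsLocalMax (fun t : ℝ =>
        (B ∘ fun t : ℝ => groupAd (E := E) (groupExp (t • Z) : G) ξ') t y) 0 := by
      refine Eventually.of_forall fun t => ?_
      have hmem : (groupExp (t • Z) * b : G) ∈ S := by
        intro a ha
        rw [groupAd_mul_apply, hb a ha, groupAd_groupExp_of_bracket_eq_zero]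
        simp [hZA a ha]
      have := hmax hmem
      simpa [groupAd_mul_apply] using! this
    have h0 := hloc.hasDerivAt_eq_zero hd
    simp at h0
    have h1 : B (groupBracket G Z ξ') y = B Z Z := by
      rw [groupBracket_swap, map_neg, neg_apply, hB.skew, neg_neg, ← hZ]
    rw [h1] at h0
    exact hB.eq_zero h0
  · have := hmax (show (1 : G) ∈ S by simp [hS])
    simpa using! this

/-- Each vector of the list, once treated, joins the set to be fixed, so later conjugations keep the
commutation already gained. -/
lemma IsInvariantForm.exists_commute_list (hB : IsInvariantForm G B) (L : List E) {A : Set E} {ξ : E}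
    (hξ : ∀ a ∈ A, groupBracket G a ξ = 0) (hL : ∀ l ∈ L, ∀ a ∈ A, groupBracket G a l = 0)
    (hLL : ∀ l ∈ L, ∀ l' ∈ L, groupBracket G l l' = 0) :
    ∃ b : G, (∀ a ∈ A, groupAd b a = a) ∧ (∀ l ∈ L, groupBracket G l (groupAd b ξ) = 0) := by
  induction L generalizing A ξ with
  | nil => exact ⟨1, by simp⟩
  | cons y L ih =>
    obtain ⟨b, hb, h1, h2, -⟩ := hB.exists_commute hξ (hL y (by simp))
    obtain ⟨b', hb', h'⟩ := ih (A := insert y A) (ξ := groupAd b ξ)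
      (by
        rintro a (rfl | ha)
        · rw [groupBracket_swap, h1, neg_zero]
        · exact h2 a ha)
      (by
        rintro l hl a (rfl | ha)
        · exact hLL _ (by simp) _ (by simp [hl])
        · exact hL l (by simp [hl]) a ha)
      (fun l hl l' hl' => hLL l (by simp [hl]) l' (by simp [hl']))
    refine ⟨b' * b, fun a ha => ?_, ?_⟩
    · rw [groupAd_mul_apply, hb a ha, hb' a (by simp [ha])]
    · intro l hl
      rw [groupAd_mul_apply]
      rcases List.mem_cons.1 hl with rfl | hl
      · have hy : groupAd b' l = l := hb' l (by simp)
        have : groupBracket G l (groupAd b' (groupAd b ξ)) =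
            groupAd b' (groupBracket G l (groupAd b ξ)) := by
          rw [groupAd_groupBracket, hy]
        rw [this, groupBracket_swap, h1]; simp
      · exact h' l hl

/-- An abelian subspace of the Lie algebra that contains its centralizer. -/
structure IsMaximalAbelian (G : Type*) [TopologicalSpace G] [ChartedSpace E G] [Group G]
    (T : Submodule ℝ E) : Prop where
  comm : ∀ v ∈ T, ∀ w ∈ T, groupBracket G v w = 0
  mem : ∀ z, (∀ v ∈ T, groupBracket G v z = 0) → z ∈ T

/-- An element of the centralizer of `A ⊆ T` is conjugate, under the centralizer of `A`, to an
element of the torus `T`, which moreover is not further from a given `y ∈ T`. -/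
lemma IsInvariantForm.exists_conj_mem (hB : IsInvariantForm G B) {T : Submodule ℝ E}
    (hT : IsMaximalAbelian G T) {A : Set E} (hA : A ⊆ T) {ξ y : E} (hy : y ∈ T)
    (hξ : ∀ a ∈ A, groupBracket G a ξ = 0) :
    ∃ b : G, (∀ a ∈ A, groupAd b a = a) ∧ groupAd b ξ ∈ T ∧
      B (groupAd b ξ - y) (groupAd b ξ - y) ≤ B (ξ - y) (ξ - y) := by
  -- The first conjugation does not decrease `B ξ y`; the following ones fix `y` and so preserve
  -- this number. As norms are invariant, the distance to `y` cannot grow.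
  obtain ⟨b, hb, h1, h2, h3⟩ := hB.exists_commute hξ (fun a ha => hT.comm a (hA ha) y hy)
  obtain ⟨s, hs⟩ := (IsNoetherian.noetherian T : T.FG)
  have hsT : ∀ l ∈ s, l ∈ T := fun l hl => hs ▸ Submodule.subset_span hl
  obtain ⟨b', hb', h'⟩ := hB.exists_commute_list s.toList (A := insert y A) (ξ := groupAd b ξ)
      (by
        rintro a (rfl | ha)
        · rw [groupBracket_swap, h1, neg_zero]
        · exact h2 a ha)
      (by
        rintro l hl a (rfl | ha)
        · exact hT.comm _ hy _ (hsT _ (by simpa using hl))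
        · exact hT.comm _ (hA ha) _ (hsT _ (by simpa using hl)))
      (fun l hl l' hl' => hT.comm _ (hsT _ (by simpa using hl)) _ (hsT _ (by simpa using hl')))
  have hy' : groupAd b' y = y := hb' y (by simp)
  refine ⟨b' * b, fun a ha => ?_, ?_, ?_⟩
  · rw [groupAd_mul_apply, hb a ha, hb' a (by simp [ha])]
  · refine hT.mem _ fun v hv => ?_
    rw [groupAd_mul_apply]
    rw [← hs] at hv
    induction hv using Submodule.span_induction with
    | mem x h => exact h' x (by simpa using h)
    | zero => simp
    | add x y _ _ hx hy => simp [hx, hy]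
    | smul a x _ hx => simp [hx]
  · have e1 : B (groupAd (b' * b) ξ) y = B (groupAd b ξ) y := by
      rw [groupAd_mul_apply]
      conv_lhs => rw [← hy']
      exact hB.invariant _ _ _
    have e2 : B (groupAd (b' * b) ξ) (groupAd (b' * b) ξ) = B ξ ξ := hB.invariant _ _ _
    have e3 : B y (groupAd (b' * b) ξ) = B (groupAd b ξ) y := by rw [hB.symm, e1]
    simp only [map_sub, sub_apply, e1, e2, e3]
    rw [hB.symm y ξ]
    linarith

end Compact

/-! ### Cartan subalgebras are maximal abelian -/

section CartanSubalgebra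

variable {E : Type*} [NormedAddCommGroup E] [NormedSpace ℝ E] [FiniteDimensional ℝ E]
  [CompleteSpace E]
  {G : Type*} [TopologicalSpace G] [ChartedSpace E G] [Group G]
  [LieGroup 𝓘(ℝ, E) ∞ G] [IsTopologicalGroup G] [T2Space G]

/-- A bilinear form on a finite-dimensional Lie algebra as a continuous bilinear map. -/
def continuousForm (B : LinearMap.BilinForm ℝ (GroupLieAlgebra 𝓘(ℝ, E) G)) : E →L[ℝ] E →L[ℝ] ℝ :=
  LinearMap.toContinuousLinearMap
    ((LinearMap.toContinuousLinearMap (𝕜 := ℝ) (E := E) (F' := ℝ)).toLinearMap ∘ₗ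
      (show E →ₗ[ℝ] E →ₗ[ℝ] ℝ from B))

lemma IsAdInvariantInner.isInvariantForm {B : LinearMap.BilinForm ℝ (GroupLieAlgebra 𝓘(ℝ, E) G)}
    (hB : IsAdInvariantInner B) : IsInvariantForm G (continuousForm B) where
  symm v w := hB.symm v w
  pos v hv := hB.pos v hv
  invariant a v w := by
    have h (v w : GroupLieAlgebra 𝓘(ℝ, E) G) := hB.invariant a v w
    simp only [lieAd_apply] at h
    exact h v w

/-- `ad u` is skew, so it has the same kernel as its square, hence as all its positive powers. -/
lemma IsInvariantForm.eq_zero_of_pow {B : E →L[ℝ] E →L[ℝ] ℝ} (hB : IsInvariantForm G B) (u : E)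
    (k : ℕ) {v : E} (h : ((groupBracket G u : E → E)^[k]) v = 0) (hk : k ≠ 0) :
    groupBracket G u v = 0 := by
  obtain ⟨k, rfl⟩ := Nat.exists_eq_succ_of_ne_zero hk
  clear hk
  induction k with
  | zero => simpa using h
  | succ k ih =>
    refine ih (hB.eq_zero ?_)
    rw [Function.iterate_succ_apply'] at h
    conv_lhs => enter [1]; rw [Function.iterate_succ_apply']
    rw [hB.skew, h]
    simp

/-- Nilpotency of `𝔥` makes `ad v` nilpotent on `𝔥`, and skewness then makes it zero there. An
element centralizing `𝔥` normalizes it, hence belongs to it. -/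
lemma isMaximalAbelian_of_isCartanSubalgebra {B : E →L[ℝ] E →L[ℝ] ℝ} (hB : IsInvariantForm G B)
    {𝔥 : LieSubalgebra ℝ (GroupLieAlgebra 𝓘(ℝ, E) G)} (h : 𝔥.IsCartanSubalgebra) :
    IsMaximalAbelian (E := E) G (show Submodule ℝ E from 𝔥.toSubmodule) := by
  have hc : ∀ v ∈ 𝔥, ∀ w ∈ 𝔥, ⁅v, w⁆ = 0 := by
    intro v hv w hw
    obtain ⟨k, hk⟩ := LieModule.exists_forall_pow_toEnd_eq_zero ℝ 𝔥 𝔥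
    have h2 (m : ℕ) : ((((LieModule.toEnd ℝ 𝔥 𝔥 ⟨v, hv⟩) ^ m) ⟨w, hw⟩ : 𝔥) :
        GroupLieAlgebra 𝓘(ℝ, E) G) = ((groupBracket (E := E) G v : E → E)^[m]) w := by
      induction m with
      | zero => rfl
      | succ m ih =>
        rw [pow_succ', Module.End.mul_apply, LieModule.toEnd_apply_apply, LieSubalgebra.coe_bracket,
          ih]
        refine (lie_eq_groupBracket _ _).trans ?_
        exact (Function.iterate_succ_apply' _ _ _).symm
    have h3 : ((groupBracket (E := E) G v : E → E)^[k + 1]) w = 0 := by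
      refine (h2 (k + 1)).symm.trans ?_
      rw [pow_succ, hk, zero_mul]
      rfl
    refine (lie_eq_groupBracket _ _).trans ?_
    exact hB.eq_zero_of_pow v (k + 1) h3 (by simp)
  have hn : ∀ z : GroupLieAlgebra 𝓘(ℝ, E) G, (∀ v ∈ 𝔥, ⁅v, z⁆ = 0) → z ∈ 𝔥 := by
    intro z hz
    have : z ∈ 𝔥.normalizer := by
      rw [LieSubalgebra.mem_normalizer_iff']
      intro y hy
      rw [hz y hy]
      exact 𝔥.zero_mem
    rwa [h.self_normalizing] at this
  exact ⟨fun v hv w hw => (lie_eq_groupBracket _ _).symm.trans (hc v hv w hw),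
    fun z hz => hn z fun v hv => (lie_eq_groupBracket _ _).trans (hz v hv)⟩

lemma eq_zero_of_groupBracket_eq_zero [LieAlgebra.IsSemisimple ℝ (GroupLieAlgebra 𝓘(ℝ, E) G)]
    {v : E} (h : ∀ w, groupBracket G v w = 0) : v = 0 := by
  have h1 (v : GroupLieAlgebra 𝓘(ℝ, E) G) (h : ∀ w : GroupLieAlgebra 𝓘(ℝ, E) G, ⁅w, v⁆ = 0) :
      v = 0 := by
    have : v ∈ LieAlgebra.center ℝ (GroupLieAlgebra 𝓘(ℝ, E) G) := by
      rw [LieModule.mem_maxTrivSubmodule]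
      exact h
    rwa [LieAlgebra.center_eq_bot] at this
  refine h1 v fun w => (lie_eq_groupBracket w v).trans ?_
  exact (groupBracket_swap (E := E) (H := G) w v).trans
    ((congrArg (fun z : E => -z) (h w)).trans neg_zero)

end CartanSubalgebra

/-! ### Complex Lie groups: the adjoint action and the bracket are complex linear -/

section ComplexLie

variable {F : Type*} [NormedAddCommGroup F] [NormedSpace ℂ F]
  {M : Type*} [TopologicalSpace M] [ChartedSpace F M] [Group M] [LieGroup 𝓘(ℂ, F) ω M]

/-- A complex Lie group is a real Lie group. -/
lemma realLieGroupOfComplex : LieGroup 𝓘(ℝ, F) ∞ M where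
  contMDiff_mul := by
    have h := (contMDiff_mul 𝓘(ℂ, F) ω (G := M))
    rw [contMDiff_iff] at h ⊢
    exact ⟨h.1, fun x y => ((h.2 x y).restrict_scalars ℝ).of_le le_top⟩
  contMDiff_inv := by
    have h := (contMDiff_inv 𝓘(ℂ, F) ω (G := M))
    rw [contMDiff_iff] at h ⊢
    exact ⟨h.1, fun x y => ((h.2 x y).restrict_scalars ℝ).of_le le_top⟩

end ComplexLie

attribute [local instance] realLieGroupOfComplex

section ComplexLie

variable {F : Type*} [NormedAddCommGroup F] [NormedSpace ℂ F]
  {M : Type*} [TopologicalSpace M] [ChartedSpace F M] [Group M] [LieGroup 𝓘(ℂ, F) ω M]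
  [IsTopologicalGroup M]

lemma groupAd_I_smul (p : M) (v : F) : groupAd p (Complex.I • v) = Complex.I • groupAd (E := F) p v := by
  have h := ((contDiffAt_unitChart_conj_const (𝕜 := ℂ) (n := ω) (E := F) p).differentiableAt
    (by simp)).hasFDerivAt
  have h2 := (h.restrictScalars ℝ).unique (hasFDerivAt_unitChart_conj p)
  rw [← h2]
  simp

variable [CompleteSpace F] [T2Space M]

lemma groupBracket_I_smul_right (v w : F) :
    groupBracket M v (Complex.I • w) = Complex.I • groupBracket M v w := by
  have h (w : F) := ((hasDerivAt_groupAd_groupExp (H := M) v 0).clm_apply (hasDerivAt_const 0 w))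
  have h1 := h (Complex.I • w)
  simp only [groupAd_I_smul] at h1
  have h2 := (h w).const_smul Complex.I
  simpa [groupAd_I_smul] using h1.unique h2

lemma groupBracket_I_smul_left (v w : F) :
    groupBracket M (Complex.I • v) w = Complex.I • groupBracket M v w := by
  rw [groupBracket_swap, groupBracket_I_smul_right, groupBracket_swap v w, smul_neg]

end ComplexLie

/-! ### Naturality of the exponential, `Ad` and the bracket -/

section Hom

variable {E : Type*} [NormedAddCommGroup E] [NormedSpace ℝ E] [CompleteSpace E]
  {G : Type*} [TopologicalSpace G] [ChartedSpace E G] [Group G]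
  [LieGroup 𝓘(ℝ, E) ∞ G] [IsTopologicalGroup G] [T2Space G]
  {F : Type*} [NormedAddCommGroup F] [NormedSpace ℂ F] [CompleteSpace F]
  {M : Type*} [TopologicalSpace M] [ChartedSpace F M] [Group M] [LieGroup 𝓘(ℂ, F) ω M]
  [IsTopologicalGroup M] [T2Space M]

/-- `homDeriv` as a map between the model spaces. -/
def modelDeriv (E F : Type*) [NormedAddCommGroup E] [NormedSpace ℝ E] [NormedAddCommGroup F]
    [NormedSpace ℂ F] {G : Type*} [TopologicalSpace G] [ChartedSpace E G] [Group G]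
    {M : Type*} [TopologicalSpace M] [ChartedSpace F M] [Group M] (ι : G →* M) : E →L[ℝ] F :=
  homDeriv (E := E) (F := F) ι

variable {ι : G →* M}

lemma hasLogDerivAt_hom (hι : ContMDiff 𝓘(ℝ, E) 𝓘(ℝ, F) ∞ ι) :
    HasLogDerivAt (fun a : E => ι (unitChartInv a)) (modelDeriv E F ι) 0 :=
  HasLogDerivAt.of_hasMFDerivAt (hι.mdifferentiable (by simp) 1).hasMFDerivAt (map_one ι)

variable {V : Type*} [NormedAddCommGroup V] [NormedSpace ℝ V]

lemma HasLogDerivAt.map_hom (hι : ContMDiff 𝓘(ℝ, E) 𝓘(ℝ, F) ∞ ι) {f : V → G} {f' : V →L[ℝ] E}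
    {x : V} (hf : HasLogDerivAt f f' x) :
    HasLogDerivAt (fun y => ι (f y)) ((modelDeriv E F ι).comp f') x := by
  refine ⟨hι.continuous.continuousAt.comp hf.1, ?_⟩
  have h1 := (hasLogDerivAt_hom hι).hasFDerivAt_unitChart (by simp)
  have h2 := HasFDerivAt.comp x (g := fun a : E => (unitChart (ι (unitChartInv a)) : F))
    (by simpa using h1) hf.2
  refine h2.congr_of_eventuallyEq ?_
  filter_upwards [hf.tendsto.eventually (unitChartInv_unitChart (E := E))] with y hy
  simp [hy]

lemma map_groupExp (hι : ContMDiff 𝓘(ℝ, E) 𝓘(ℝ, F) ∞ ι) (v : E) :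
    ι (groupExp v) = groupExp (modelDeriv E F ι v) := by
  refine Eq.symm ((groupExp_eq (γ := fun t : ℝ => ι (groupExp (t • v))) (by simp) fun t => ?_).trans
    (by simp))
  convert! (hasLogDerivAt_groupExp_smul (H := G) v t).map_hom hι using 1
  ext; simp

lemma modelDeriv_groupAd (hι : ContMDiff 𝓘(ℝ, E) 𝓘(ℝ, F) ∞ ι) (p : G) (v : E) :
    modelDeriv E F ι (groupAd p v) = groupAd (ι p) (modelDeriv E F ι v) := by
  have h1 := ((hasLogDerivAt_unitChartInv (E := E) (H := G)).conj p).map_hom hι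
  have h2 := ((hasLogDerivAt_unitChartInv (E := E) (H := G)).map_hom hι).conj (ι p)
  simp only [map_mul, map_inv] at h1
  exact congrArg (fun L : E →L[ℝ] F => L v) (h1.unique h2)

lemma modelDeriv_groupBracket (hι : ContMDiff 𝓘(ℝ, E) 𝓘(ℝ, F) ∞ ι) (v w : E) :
    modelDeriv E F ι (groupBracket G v w) =
      groupBracket M (modelDeriv E F ι v) (modelDeriv E F ι w) := by
  have h1 := (modelDeriv E F ι).hasFDerivAt.comp_hasDerivAt 0
    ((hasDerivAt_groupAd_groupExp (H := G) v 0).clm_apply (hasDerivAt_const 0 w))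
  have h2 := (hasDerivAt_groupAd_groupExp (H := M) (modelDeriv E F ι v) 0).clm_apply
    (hasDerivAt_const 0 (modelDeriv E F ι w))
  have h3 : (modelDeriv E F ι) ∘ (fun t : ℝ => groupAd (E := E) (groupExp (t • v) : G) w) =
      fun t : ℝ => groupAd (E := F) (groupExp (t • modelDeriv E F ι v) : M) (modelDeriv E F ι w) := by
    funext t
    simp only [Function.comp]
    rw [modelDeriv_groupAd hι, map_groupExp hι, map_smul]
  rw [h3] at h1
  simpa using h1.unique h2

end Hom

/-! ### The real form -/

section RealForm

variable {E : Type*} [NormedAddCommGroup E] [NormedSpace ℝ E] [FiniteDimensional ℝ E]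
  [CompleteSpace E]
  {G : Type*} [TopologicalSpace G] [ChartedSpace E G] [Group G]
  [LieGroup 𝓘(ℝ, E) ∞ G] [IsTopologicalGroup G] [T2Space G]
  {F : Type*} [NormedAddCommGroup F] [NormedSpace ℂ F] [FiniteDimensional ℂ F] [CompleteSpace F]
  {M : Type*} [TopologicalSpace M] [ChartedSpace F M] [Group M] [LieGroup 𝓘(ℂ, F) ω M]
  [IsTopologicalGroup M] [T2Space M] {ι : G →* M}

/-- The decomposition `F = dι(E) ⊕ i dι(E)`. -/
def realFormEquiv (hι : IsComplexification (E := E) (F := F) ι) : (E × E) ≃L[ℝ] F :=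
  LinearEquiv.toContinuousLinearEquiv (LinearEquiv.ofBijective
    (((modelDeriv E F ι).comp (ContinuousLinearMap.fst ℝ E E) +
      Complex.I • (modelDeriv E F ι).comp (ContinuousLinearMap.snd ℝ E E) :
        (E × E) →L[ℝ] F) : (E × E) →ₗ[ℝ] F) hι.realForm)

lemma realFormEquiv_apply (hι : IsComplexification (E := E) (F := F) ι) (v : E × E) :
    realFormEquiv hι v = modelDeriv E F ι v.1 + Complex.I • modelDeriv E F ι v.2 := rfl

/-- The inner product on `F` for which `dι(E)` and `i dι(E)` are orthogonal copies of `E`. -/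
def complexForm (hι : IsComplexification (E := E) (F := F) ι) (B : E →L[ℝ] E →L[ℝ] ℝ) :
    F →L[ℝ] F →L[ℝ] ℝ :=
  (B.bilinearComp (ContinuousLinearMap.fst ℝ E E) (ContinuousLinearMap.fst ℝ E E) +
    B.bilinearComp (ContinuousLinearMap.snd ℝ E E) (ContinuousLinearMap.snd ℝ E E)).bilinearComp
      ((realFormEquiv hι).symm : F →L[ℝ] E × E) ((realFormEquiv hι).symm : F →L[ℝ] E × E)

lemma complexForm_apply (hι : IsComplexification (E := E) (F := F) ι) (B : E →L[ℝ] E →L[ℝ] ℝ)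
    (v w : E × E) : complexForm hι B (realFormEquiv hι v) (realFormEquiv hι w) =
      B v.1 w.1 + B v.2 w.2 := by
  simp [complexForm, ContinuousLinearMap.bilinearComp_apply]

/-- Complex conjugation with respect to `dι(E)`. -/
def realFormConj (hι : IsComplexification (E := E) (F := F) ι) : F →L[ℝ] F :=
  ((realFormEquiv hι : (E × E) →L[ℝ] F).comp
    ((ContinuousLinearMap.fst ℝ E E).prod (-ContinuousLinearMap.snd ℝ E E))).comp
      ((realFormEquiv hι).symm : F →L[ℝ] (E × E))

lemma realFormConj_apply (hι : IsComplexification (E := E) (F := F) ι) (v : E × E) :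
    realFormConj hι (realFormEquiv hι v) = realFormEquiv hι (v.1, -v.2) := by
  simp [realFormConj]

lemma groupBracket_I_realFormEquiv (hι : IsComplexification (E := E) (F := F) ι) (x : E)
    (v : E × E) : groupBracket M (Complex.I • modelDeriv E F ι x) (realFormEquiv hι v) =
      realFormEquiv hι (-groupBracket G x v.2, groupBracket G x v.1) := by
  simp only [realFormEquiv_apply, map_add, groupBracket_I_smul_left, groupBracket_I_smul_right,
    modelDeriv_groupBracket hι.smooth, map_neg]
  rw [smul_smul, Complex.I_mul_I, neg_one_smul, add_comm]

variable {B : E →L[ℝ] E →L[ℝ] ℝ}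

lemma complexForm_nonneg (hι : IsComplexification (E := E) (F := F) ι) (hB : IsInvariantForm G B)
    (v : F) : 0 ≤ complexForm hι B v v := by
  obtain ⟨v, rfl⟩ := (realFormEquiv hι).surjective v
  rw [complexForm_apply]
  exact add_nonneg (hB.nonneg _) (hB.nonneg _)

lemma eq_zero_of_complexForm (hι : IsComplexification (E := E) (F := F) ι)
    (hB : IsInvariantForm G B) {v : F} (hv : complexForm hι B v v = 0) : v = 0 := by
  obtain ⟨v, rfl⟩ := (realFormEquiv hι).surjective v
  rw [complexForm_apply] at hv
  have h1 := hB.eq_zero (v := v.1) (by linarith [hB.nonneg v.1, hB.nonneg v.2])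
  have h2 := hB.eq_zero (v := v.2) (by linarith [hB.nonneg v.1, hB.nonneg v.2])
  rw [show v = 0 from Prod.ext h1 h2, map_zero]

/-- `ad x` is skew on each of the two copies of `𝔤`, and multiplication by `i` exchanges them with
one sign; the signs combine to make `ad(i x)` symmetric. -/
lemma complexForm_bracket (hι : IsComplexification (E := E) (F := F) ι) (hB : IsInvariantForm G B)
    (x : E) (v w : F) :
    complexForm hι B (groupBracket M (Complex.I • modelDeriv E F ι x) v) w =
      complexForm hι B v (groupBracket M (Complex.I • modelDeriv E F ι x) w) := by
  obtain ⟨v, rfl⟩ := (realFormEquiv hι).surjective v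
  obtain ⟨w, rfl⟩ := (realFormEquiv hι).surjective w
  simp only [groupBracket_I_realFormEquiv, complexForm_apply, map_neg, neg_apply]
  rw [hB.skew, hB.skew]
  ring

/-- Conjugation takes `i x` to `-i x`, which reverses the sign of `ad(i x)`. -/
lemma realFormConj_bracket (hι : IsComplexification (E := E) (F := F) ι) (x : E) (v : F) :
    realFormConj hι (groupBracket M (Complex.I • modelDeriv E F ι x) v) =
      -groupBracket M (Complex.I • modelDeriv E F ι x) (realFormConj hι v) := by
  obtain ⟨v, rfl⟩ := (realFormEquiv hι).surjective v
  rw [realFormConj_apply, groupBracket_I_realFormEquiv, groupBracket_I_realFormEquiv,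
    realFormConj_apply, ← map_neg (realFormEquiv hι)]
  simp

end RealForm

/-! ### Exponentials of a symmetric operator `ad u` -/

section SymmetricExp

variable {F : Type*} [NormedAddCommGroup F] [NormedSpace ℝ F] [FiniteDimensional ℝ F]
  [CompleteSpace F]
  {M : Type*} [TopologicalSpace M] [ChartedSpace F M] [Group M] [LieGroup 𝓘(ℝ, F) ∞ M]
  [IsTopologicalGroup M] [T2Space M]

lemma groupBracket_self (v : F) : groupBracket M v v = 0 := by
  rw [groupBracket_apply_eq, sub_self]

lemma groupAd_groupExp_self (u : F) (t : ℝ) : groupAd (groupExp (t • u) : M) u = u :=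
  groupAd_groupExp_of_bracket_eq_zero (by simp [groupBracket_self])

lemma groupAd_groupExp_bracket (u v : F) (t : ℝ) :
    groupAd (groupExp (t • u) : M) (groupBracket M u v) =
      groupBracket M u (groupAd (groupExp (t • u) : M) v) := by
  rw [groupAd_groupBracket, groupAd_groupExp_self]

lemma groupAd_groupExp_add (u v : F) (s t : ℝ) :
    groupAd (groupExp ((s + t) • u) : M) v =
      groupAd (groupExp (s • u) : M) (groupAd (groupExp (t • u) : M) v) := by
  rw [groupExp_add_smul, groupAd_mul_apply]

lemma hasDerivAt_groupAd_groupExp_apply (u v : F) (t : ℝ) :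
    HasDerivAt (fun t : ℝ => groupAd (groupExp (t • u) : M) v)
      (groupAd (groupExp (t • u) : M) (groupBracket M u v)) t := by
  simpa using (hasDerivAt_groupAd_groupExp (H := M) u t).clm_apply (hasDerivAt_const t v)

lemma hasDerivAt_groupAd_groupExp_neg_apply (u v : F) (t : ℝ) :
    HasDerivAt (fun t : ℝ => groupAd (groupExp ((-t) • u) : M) v)
      (-groupAd (groupExp ((-t) • u) : M) (groupBracket M u v)) t := by
  have := (hasDerivAt_groupAd_groupExp_apply (M := M) u v (-t)).scomp t (hasDerivAt_neg t)
  simpa [Function.comp_def] using! this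

lemma eq_of_hasDerivAt_zero {V : Type*} [NormedAddCommGroup V] [NormedSpace ℝ V] {f : ℝ → V}
    (h : ∀ t, HasDerivAt f 0 t) (s t : ℝ) : f s = f t :=
  is_const_of_deriv_eq_zero (fun t => (h t).differentiableAt) (fun t => (h t).deriv) s t

variable {Q : F →L[ℝ] F →L[ℝ] ℝ} {u : F}

/-- With `P = ad u`, the function `s ↦ Q (exp(s P) v) (exp((t - s) P) w)` is constant; compare `s =
t` with `s = 0`. -/
lemma groupAd_groupExp_symm
    (hu : ∀ v w, Q (groupBracket M u v) w = Q v (groupBracket M u w)) (v w : F) (t : ℝ) :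
    Q (groupAd (groupExp (t • u) : M) v) w = Q v (groupAd (groupExp (t • u) : M) w) := by
  have hd (s : ℝ) : HasDerivAt (fun s : ℝ => Q (groupAd (groupExp (s • u) : M) v)
      (groupAd (groupExp ((t + -s) • u) : M) w)) 0 s := by
    have h1 := hasDerivAt_groupAd_groupExp_apply (M := M) u v s
    have h2 := hasDerivAt_groupAd_groupExp_neg_apply (M := M) u w s
    have h3 := (groupAd (groupExp (t • u) : M)).hasFDerivAt.comp_hasDerivAt s h2
    have h4 := (Q.hasFDerivAt.comp_hasDerivAt s h1).clm_apply h3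
    simp only [groupAd_groupExp_add]
    convert! h4 using 1
    simp only [Function.comp, map_neg, groupAd_groupExp_bracket, hu]
    ring
  have := eq_of_hasDerivAt_zero hd t 0
  simpa using this

/-- With `P = ad u`, this is `(exp(t P / 2) - exp(-t P / 2))² = exp(t P) + exp(-t P) - 2`, which is
nonnegative when `P` is symmetric. -/
lemma groupAd_groupExp_sub_sq (v : F) (t : ℝ) :
    groupAd (groupExp ((t / 2) • u) : M) (groupAd (groupExp ((t / 2) • u) : M) v -
        groupAd (groupExp ((-(t / 2)) • u) : M) v) -
      groupAd (groupExp ((-(t / 2)) • u) : M) (groupAd (groupExp ((t / 2) • u) : M) v -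
        groupAd (groupExp ((-(t / 2)) • u) : M) v) =
      groupAd (groupExp (t • u) : M) v + groupAd (groupExp ((-t) • u) : M) v - (2 : ℝ) • v := by
  simp only [map_sub, ← groupAd_groupExp_add]
  have e1 : t / 2 + t / 2 = t := by ring
  have e2 : t / 2 + -(t / 2) = 0 := by ring
  have e3 : -(t / 2) + t / 2 = 0 := by ring
  have e4 : -(t / 2) + -(t / 2) = -t := by ring
  rw [e1, e2, e3, e4, zero_smul, groupExp_zero, groupAd_one, ContinuousLinearMap.id_apply, two_smul]
  abel

/-- The operator inequality `2 P² ≤ P (exp P - exp (-P))` for the symmetric operator `P = ad u`. -/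
lemma two_mul_bracket_sq_le (hQ : ∀ v, 0 ≤ Q v v)
    (hu : ∀ v w, Q (groupBracket M u v) w = Q v (groupBracket M u w)) (v : F) :
    2 * Q (groupBracket M u v) (groupBracket M u v) ≤
      Q (groupAd (groupExp u : M) v - groupAd (groupExp (-u) : M) v) (groupBracket M u v) := by
  set w := groupBracket M u v with hw
  have hd (t : ℝ) : HasDerivAt (fun t : ℝ => Q (groupAd (groupExp (t • u) : M) v -
      groupAd (groupExp ((-t) • u) : M) v) w - t * (2 * Q w w))
      (Q (groupAd (groupExp (t • u) : M) w + groupAd (groupExp ((-t) • u) : M) w - (2 : ℝ) • w) w)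
      t := by
    have h1 := (hasDerivAt_groupAd_groupExp_apply (M := M) u v t).sub
      (hasDerivAt_groupAd_groupExp_neg_apply (M := M) u v t)
    have h2 := ((Q.hasFDerivAt.comp_hasDerivAt t h1).clm_apply (hasDerivAt_const t w)).sub
      ((hasDerivAt_id t).mul_const (2 * Q w w))
    convert! h2 using 1
    simp [hw]
  -- The derivative is `Q (D² w) w = Q (D w) (D w)`, where `D` is the symmetric operator `exp(t P /
  -- 2) - exp(-t P / 2)` with `P = ad u`.
  have hmono := monotone_of_hasDerivAt_nonneg hd (fun t => by
    rw [Pi.zero_apply, ← groupAd_groupExp_sub_sq]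
    set z := groupAd (groupExp ((t / 2) • u) : M) w - groupAd (groupExp ((-(t / 2)) • u) : M) w
      with hz
    rw [map_sub, sub_apply, groupAd_groupExp_symm hu, groupAd_groupExp_symm hu, ← map_sub, ← hz]
    exact hQ z)
  have := hmono (zero_le_one (α := ℝ))
  simp at this
  rw [map_sub, sub_apply]
  linarith

/-- `exp(s P) σ exp(s P)` is constant in `s`, because `σ P = -P σ` for `P = ad u`. -/
lemma conj_groupAd_groupExp {σ : F →L[ℝ] F}
    (hσ : ∀ v, σ (groupBracket M u v) = -groupBracket M u (σ v)) (v : F) (t : ℝ) :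
    σ (groupAd (groupExp (t • u) : M) v) = groupAd (groupExp ((-t) • u) : M) (σ v) := by
  have hd (s : ℝ) : HasDerivAt (fun s : ℝ => groupAd (groupExp (s • u) : M)
      (σ (groupAd (groupExp (s • u) : M) v))) 0 s := by
    have h1 := σ.hasFDerivAt.comp_hasDerivAt s (hasDerivAt_groupAd_groupExp_apply (M := M) u v s)
    have h2 := (hasDerivAt_groupAd_groupExp (H := M) u s).clm_apply h1
    convert! h2 using 1
    simp [groupAd_groupExp_bracket, hσ]
  have h := eq_of_hasDerivAt_zero hd t 0
  simp only [zero_smul, groupExp_zero, groupAd_one, ContinuousLinearMap.id_apply] at h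
  rw [← h, ← groupAd_groupExp_add, neg_add_cancel, zero_smul, groupExp_zero, groupAd_one]
  rfl

end SymmetricExp

/-! ### Coercivity bounds in finite dimension -/

section Coercive

variable {E : Type*} [NormedAddCommGroup E] [NormedSpace ℝ E] [FiniteDimensional ℝ E]

lemma exists_pos_mul_sq_le {Q : E →L[ℝ] E →L[ℝ] ℝ} (hQ : ∀ v, v ≠ 0 → 0 < Q v v) :
    ∃ m : ℝ, 0 < m ∧ ∀ v, m * ‖v‖ ^ 2 ≤ Q v v := by
  rcases subsingleton_or_nontrivial E with hE | hE
  · exact ⟨1, one_pos, fun v => by simp [Subsingleton.elim v 0]⟩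
  have hc : Continuous fun v : E => Q v v := by fun_prop
  have : ProperSpace E := FiniteDimensional.proper ℝ E
  obtain ⟨v₀, hv₀, hmin⟩ := (isCompact_sphere (0 : E) 1).exists_isMinOn
    (NormedSpace.sphere_nonempty.2 zero_le_one) hc.continuousOn
  refine ⟨Q v₀ v₀, hQ _ (by rintro rfl; simp at hv₀), fun v => ?_⟩
  by_cases hv : v = 0
  · simp [hv]
  have hv' : ‖v‖ ≠ 0 := norm_ne_zero_iff.2 hv
  have h := hmin (show ‖v‖⁻¹ • v ∈ Metric.sphere (0 : E) 1 by simp [norm_smul, hv'])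
  simp only [map_smul, smul_apply, smul_eq_mul, mem_ofPred_eq] at h
  calc Q v₀ v₀ * ‖v‖ ^ 2 ≤ (‖v‖⁻¹ * (‖v‖⁻¹ * Q v v)) * ‖v‖ ^ 2 := by gcongr
    _ = Q v v := by field_simp

lemma exists_norm_le_mul_norm {V : Type*} [NormedAddCommGroup V] [NormedSpace ℝ V]
    {L : E →L[ℝ] V} (hL : Function.Injective L) : ∃ C : ℝ, 0 ≤ C ∧ ∀ v, ‖v‖ ≤ C * ‖L v‖ := by
  obtain ⟨K, -, hK⟩ := LinearMap.exists_antilipschitzWith (L : E →ₗ[ℝ] V) (LinearMap.ker_eq_bot.2 hL)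
  exact ⟨K, K.2, fun v => by simpa using hK.le_mul_dist v 0⟩

end Coercive

/-! ### Growth of `Ad(exp(i x))` and the infinitesimal decomposition -/

section RealForm

variable {E : Type*} [NormedAddCommGroup E] [NormedSpace ℝ E] [FiniteDimensional ℝ E]
  [CompleteSpace E]
  {G : Type*} [TopologicalSpace G] [ChartedSpace E G] [Group G]
  [LieGroup 𝓘(ℝ, E) ∞ G] [IsTopologicalGroup G] [T2Space G]
  {F : Type*} [NormedAddCommGroup F] [NormedSpace ℂ F] [FiniteDimensional ℂ F] [CompleteSpace F]
  {M : Type*} [TopologicalSpace M] [ChartedSpace F M] [Group M] [LieGroup 𝓘(ℂ, F) ω M]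
  [IsTopologicalGroup M] [T2Space M] {ι : G →* M} {B : E →L[ℝ] E →L[ℝ] ℝ}

/-- `exp(i v)`, as a function on the model space. -/
def imagExp (F : Type*) [NormedAddCommGroup F] [NormedSpace ℂ F] [ChartedSpace F M]
    (ι : G →* M) (v : E) : M :=
  groupExp (Complex.I • modelDeriv E F ι v)

lemma imagExp_neg (v : E) : imagExp F ι (-v) = (imagExp F ι v)⁻¹ := by
  rw [imagExp, imagExp, ← groupExp_neg, map_neg, smul_neg]

lemma imagExp_zero : imagExp F ι (0 : E) = 1 := by
  simp [imagExp, groupExp_zero]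

lemma imagExp_add (hι : IsComplexification (E := E) (F := F) ι) {v w : E}
    (h : groupBracket G v w = 0) : imagExp F ι (v + w) = imagExp F ι v * imagExp F ι w := by
  rw [imagExp, map_add, smul_add, groupExp_add]
  · rfl
  · rw [groupBracket_I_smul_left, groupBracket_I_smul_right, ← modelDeriv_groupBracket hι.smooth, h]
    simp

lemma imagExp_conj (hι : IsComplexification (E := E) (F := F) ι) (b : G) (v : E) :
    ι b * imagExp F ι v * (ι b)⁻¹ = imagExp F ι (groupAd b v) := by
  rw [imagExp, groupExp_conj, groupAd_I_smul, ← modelDeriv_groupAd hι.smooth]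
  rfl

lemma hasLogDerivAt_imagExp_zero : HasLogDerivAt (imagExp F ι : E → M)
    (Complex.I • modelDeriv E F ι) 0 := by
  have h := HasLogDerivAt.comp (f := (groupExp : F → M)) (x := (0 : E))
    (g := fun v : E => (Complex.I • modelDeriv E F ι) v)
    (by simpa using hasLogDerivAt_groupExp_zero (E := F) (H := M))
    (Complex.I • modelDeriv E F ι).hasFDerivAt
  simpa using! h

lemma injective_bracket_imag (hι : IsComplexification (E := E) (F := F) ι)
    (hZ : ∀ v : E, (∀ w, groupBracket G v w = 0) → v = 0) :
    Function.Injective fun x : E => groupBracket M (Complex.I • modelDeriv E F ι x) := by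
  have : Function.Injective ((groupBracket (E := F) M).comp (Complex.I • modelDeriv E F ι)) := by
    rw [injective_iff_map_eq_zero]
    intro x hx
    refine hZ x fun w => ?_
    have h1 := congrArg (fun L : F →L[ℝ] F => L (realFormEquiv hι (w, 0))) hx
    have h2 := groupBracket_I_realFormEquiv hι x (w, 0)
    have h3 : realFormEquiv hι (-groupBracket G x 0, groupBracket G x w) = 0 := by
      rw [← h2]; simpa using! h1
    have := (map_eq_zero_iff _ (realFormEquiv hι).injective).1 h3
    exact (Prod.ext_iff.1 this).2
  exact this

/-- With `P = ad(i x)`, the inequality `2 P² ≤ P (exp P - exp(-P))` bounds `‖P‖` by a multiple of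
`‖exp P - exp(-P)‖`, and `‖P‖` controls `‖x‖` because the centre is trivial. This is what makes `x ↦
exp(i x)` proper. -/
lemma exists_norm_le_groupAd_imagExp (hι : IsComplexification (E := E) (F := F) ι)
    (hB : IsInvariantForm G B) (hZ : ∀ v : E, (∀ w, groupBracket G v w = 0) → v = 0) :
    ∃ C : ℝ, ∀ x : E, ‖x‖ ≤ C * ‖groupAd (E := F) (imagExp F ι x) -
      groupAd (imagExp F ι x)⁻¹‖ := by
  set Q := complexForm hι B with hQ
  obtain ⟨m, hm, hmQ⟩ := exists_pos_mul_sq_le (Q := Q) (fun v hv =>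
    (complexForm_nonneg hι hB v).lt_of_ne' fun h => hv (eq_zero_of_complexForm hι hB h))
  obtain ⟨C, hC, hCx⟩ := exists_norm_le_mul_norm
    (L := (groupBracket (E := F) M).comp (Complex.I • modelDeriv E F ι))
    (injective_bracket_imag hι hZ)
  refine ⟨C * (‖Q‖ / (2 * m)), fun x => (hCx x).trans ?_⟩
  rw [mul_assoc]
  refine mul_le_mul_of_nonneg_left ?_ hC
  set D := groupAd (E := F) (imagExp F ι x) - groupAd (imagExp F ι x)⁻¹ with hD
  refine ContinuousLinearMap.opNorm_le_bound _ (by positivity) fun v => ?_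
  set w := groupBracket M (Complex.I • modelDeriv E F ι x) v with hw
  change ‖w‖ ≤ _
  have h1 := two_mul_bracket_sq_le (M := M) (Q := Q) (u := Complex.I • modelDeriv E F ι x)
    (complexForm_nonneg hι hB) (complexForm_bracket hι hB x) v
  have h2 : 2 * Q w w ≤ Q (D v) w := by
    rw [groupExp_neg] at h1
    exact h1
  by_cases hw0 : ‖w‖ = 0
  · rw [hw0]; positivity
  have hw1 : 0 < ‖w‖ := lt_of_le_of_ne (norm_nonneg _) (Ne.symm hw0)
  have h3 : 2 * (m * ‖w‖ ^ 2) ≤ ‖Q‖ * (‖D‖ * ‖v‖) * ‖w‖ := by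
    calc 2 * (m * ‖w‖ ^ 2) ≤ 2 * Q w w := by gcongr; exact hmQ w
      _ ≤ Q (D v) w := h2
      _ ≤ ‖Q (D v) w‖ := Real.le_norm_self _
      _ ≤ ‖Q‖ * ‖D v‖ * ‖w‖ := Q.le_opNorm₂ _ _
      _ ≤ _ := by gcongr; exact D.le_opNorm v
  have h4 : 2 * m * ‖w‖ ≤ ‖Q‖ * (‖D‖ * ‖v‖) := by
    refine le_of_mul_le_mul_right ?_ hw1
    calc _ = 2 * (m * ‖w‖ ^ 2) := by ring
      _ ≤ _ := h3
  calc ‖w‖ = (2 * m * ‖w‖) / (2 * m) := by field_simp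
    _ ≤ ‖Q‖ * (‖D‖ * ‖v‖) / (2 * m) := by gcongr
    _ = _ := by ring

/-- The infinitesimal `G exp(i 𝔷(x)) G` decomposition at `exp(i x)`. -/
lemma exists_eq_add_add (hι : IsComplexification (E := E) (F := F) ι) (hB : IsInvariantForm G B)
    (x : E) (z : F) : ∃ ζ₁ ξ ζ₂ : E, groupBracket G x ξ = 0 ∧
      z = groupAd (imagExp F ι x)⁻¹ (modelDeriv E F ι ζ₁) + Complex.I • modelDeriv E F ι ξ +
        modelDeriv E F ι ζ₂ := by
  set Q := complexForm hι B with hQ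
  set u := Complex.I • modelDeriv E F ι x with hu
  set A : F →L[ℝ] F := groupAd (imagExp F ι x)⁻¹ with hA
  have hAu (t : F) : A t = groupAd (groupExp ((-1 : ℝ) • u) : M) t := by
    rw [neg_smul, one_smul, groupExp_neg]; rfl
  have hAsymm (v w : F) : Q (A v) w = Q v (A w) := by
    rw [hAu, hAu]
    exact groupAd_groupExp_symm (complexForm_bracket hι hB x) v w (-1)
  let Z : Submodule ℝ E := LinearMap.ker (groupBracket G x : E →ₗ[ℝ] E)
  let L : (E × Z) × E →ₗ[ℝ] F :=
    ((((A.comp (modelDeriv E F ι) : E →L[ℝ] F) : E →ₗ[ℝ] F).coprod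
      ((((Complex.I • modelDeriv E F ι : E →L[ℝ] F)) : E →ₗ[ℝ] F) ∘ₗ Z.subtype)).coprod
        ((modelDeriv E F ι : E →L[ℝ] F) : E →ₗ[ℝ] F))
  suffices h : LinearMap.range L = ⊤ by
    obtain ⟨⟨⟨ζ₁, ξ⟩, ζ₂⟩, hz⟩ := LinearMap.range_eq_top.1 h z
    exact ⟨ζ₁, ξ, ζ₂, ξ.2, hz.symm⟩
  -- A functional vanishing on the range is `Q w` for some `w`. Orthogonality to `𝔤` and to `A 𝔤`,
  -- with `A` symmetric, says that both `w` and `A w` are purely imaginary.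
  by_contra hne
  obtain ⟨f, hf0, hf⟩ := Submodule.exists_le_ker_of_lt_top _ (lt_top_iff_ne_top.2 hne)
  have hinj : Function.Injective (LinearMap.toContinuousLinearMap.symm.toLinearMap ∘ₗ
      (Q : F →ₗ[ℝ] F →L[ℝ] ℝ) : F →ₗ[ℝ] (F →ₗ[ℝ] ℝ)) := by
    rw [injective_iff_map_eq_zero]
    intro v hv
    exact eq_zero_of_complexForm hι hB (congrArg (fun g : F →ₗ[ℝ] ℝ => g v) hv)
  obtain ⟨w, rfl⟩ := (LinearMap.injective_iff_surjective_of_finrank_eq_finrank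
    (Subspace.dual_finrank_eq (K := ℝ) (V := F)).symm).1 hinj f
  have hw (ζ₁ ξ ζ₂ : E) (hξ : groupBracket G x ξ = 0) : Q w (A (modelDeriv E F ι ζ₁) +
      Complex.I • modelDeriv E F ι ξ + modelDeriv E F ι ζ₂) = 0 :=
    hf ⟨((ζ₁, ⟨ξ, hξ⟩), ζ₂), rfl⟩
  have hreal (v : F) (hv : ∀ ζ : E, Q v (modelDeriv E F ι ζ) = 0) :
      ((realFormEquiv hι).symm v).1 = 0 := by
    refine hB.eq_zero ?_
    have h1 := hv ((realFormEquiv hι).symm v).1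
    have h2 : modelDeriv E F ι ((realFormEquiv hι).symm v).1 =
        realFormEquiv hι (((realFormEquiv hι).symm v).1, 0) := by
      simp [realFormEquiv_apply]
    rw [h2] at h1
    conv at h1 => lhs; enter [1]; rw [← (realFormEquiv hι).apply_symm_apply v]
    rw [hQ, complexForm_apply] at h1
    simpa using h1
  have hconj (v : F) (hv : ((realFormEquiv hι).symm v).1 = 0) : realFormConj hι v = -v := by
    conv => lhs; rw [← (realFormEquiv hι).apply_symm_apply v]
    conv => rhs; rw [← (realFormEquiv hι).apply_symm_apply v]
    rw [realFormConj_apply, ← map_neg]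
    congr 1
    exact Prod.ext (by simp [hv]) rfl
  have hw1 := hreal w fun ζ => by simpa using hw 0 0 ζ (by simp)
  have hw2 := hreal (A w) fun ζ => by rw [hAsymm]; simpa using hw ζ 0 0 (by simp)
  have hc1 := hconj w hw1
  have hc2 := hconj (A w) hw2
  -- Conjugation turns `exp(-P)` into `exp P`, where `P = ad u`; for imaginary `w` and `A w` this
  -- forces `exp(-P) w = exp P w`.
  have hc3 : realFormConj hι (A w) = -groupAd (groupExp u : M) w := by
    rw [hAu, conj_groupAd_groupExp (realFormConj_bracket hι x), hc1]
    simp [hu]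
  have hAA : groupAd (groupExp u : M) w - groupAd (groupExp (-u) : M) w = 0 := by
    have h1 : A w = groupAd (groupExp u : M) w := by
      rw [hc2] at hc3; exact neg_injective hc3
    rw [← h1, hAu, neg_smul, one_smul, sub_self]
  -- The inequality now gives `P w = 0`, so `w ∈ i 𝔷(x)`; but `w` is also orthogonal to `i 𝔷(x)`,
  -- hence zero.
  have hPw := two_mul_bracket_sq_le (M := M) (Q := Q) (u := u)
    (complexForm_nonneg hι hB) (complexForm_bracket hι hB x) w
  rw [hAA, map_zero, zero_apply] at hPw
  have hPw0 : groupBracket M u w = 0 := eq_zero_of_complexForm hι hB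
    (le_antisymm (by linarith) (complexForm_nonneg hι hB _))
  set w₂ := ((realFormEquiv hι).symm w).2 with hw₂
  have hwI : w = realFormEquiv hι (0, w₂) := by
    rw [← (realFormEquiv hι).apply_symm_apply w]
    congr 1
    exact Prod.ext hw1 rfl
  have hxw : groupBracket G x w₂ = 0 := by
    rw [hwI, hu, groupBracket_I_realFormEquiv, map_eq_zero_iff _ (realFormEquiv hι).injective,
      Prod.ext_iff] at hPw0
    simpa using hPw0.1
  have hww : Q w w = 0 := by
    have := hw 0 w₂ 0 hxw
    rw [map_zero, map_zero, zero_add, add_zero] at this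
    rwa [show Complex.I • modelDeriv E F ι w₂ = w by rw [hwI, realFormEquiv_apply]; simp] at this
  refine hf0 ?_
  rw [eq_zero_of_complexForm hι hB hww, map_zero]

end RealForm

/-! ### Strict differentiability at the unit -/

section Strict

variable {E : Type*} [NormedAddCommGroup E] [NormedSpace ℝ E]
  {H : Type*} [TopologicalSpace H] [ChartedSpace E H] [Group H]
  {V : Type*} [NormedAddCommGroup V] [NormedSpace ℝ V]

/-- `f` maps `0` to the unit and has there the strict derivative `f'`, in the chart at the unit. -/
structure HasStrictLogDerivAtZero (f : V → H) (f' : V →L[ℝ] E) : Prop where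
  map_zero : f 0 = 1
  tendsto : Tendsto f (𝓝 0) (𝓝 1)
  strict : HasStrictFDerivAt (fun y => (unitChart (f y) : E)) f' 0

variable [LieGroup 𝓘(ℝ, E) ∞ H] [IsTopologicalGroup H]

lemma HasStrictLogDerivAtZero.mul {f g : V → H} {f' g' : V →L[ℝ] E}
    (hf : HasStrictLogDerivAtZero f f') (hg : HasStrictLogDerivAtZero g g') :
    HasStrictLogDerivAtZero (fun y => f y * g y) (f' + g') where
  map_zero := by simp [hf.map_zero, hg.map_zero]
  tendsto := by simpa using hf.tendsto.mul hg.tendsto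
  strict := by
    have h := HasStrictFDerivAt.comp (0 : V)
      (g := fun x : E × E => (unitChart (unitChartInv x.1 * unitChartInv x.2 : H) : E))
      (f := fun y => ((unitChart (f y) : E), (unitChart (g y) : E)))
      (by simpa [hf.map_zero, hg.map_zero] using! hasStrictFDerivAt_unitChart_mul (E := E) (H := H))
      (hf.strict.prodMk hg.strict)
    convert! h.congr_of_eventuallyEq ?_ using 1
    filter_upwards [hf.tendsto.eventually (unitChartInv_unitChart (E := E)),
      hg.tendsto.eventually (unitChartInv_unitChart (E := E))] with y hy1 hy2
    simp only [hy1, hy2]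

lemma HasStrictLogDerivAtZero.comp {W : Type*} [NormedAddCommGroup W] [NormedSpace ℝ W]
    {f : V → H} {f' : V →L[ℝ] E} (hf : HasStrictLogDerivAtZero f f') (L : W →L[ℝ] V) :
    HasStrictLogDerivAtZero (fun y => f (L y)) (f'.comp L) where
  map_zero := by simp [hf.map_zero]
  tendsto := hf.tendsto.comp (by simpa using L.continuous.tendsto 0)
  strict := HasStrictFDerivAt.comp (0 : W) (by simpa using hf.strict) L.hasStrictFDerivAt

lemma HasStrictLogDerivAtZero.of_contDiffAt {f : V → H} {f' : V →L[ℝ] E} (h0 : f 0 = 1)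
    (hc : ContinuousAt f 0) (hf : ContDiffAt ℝ ∞ (fun y => (unitChart (f y) : E)) 0)
    (hd : HasFDerivAt (fun y => (unitChart (f y) : E)) f' 0) : HasStrictLogDerivAtZero f f' where
  map_zero := h0
  tendsto := by simpa [ContinuousAt, h0] using hc
  strict := hf.hasStrictFDerivAt' hd (by simp)

lemma HasStrictLogDerivAtZero.conj {f : V → H} {f' : V →L[ℝ] E}
    (hf : HasStrictLogDerivAtZero f f') (p : H) :
    HasStrictLogDerivAtZero (fun y => p * f y * p⁻¹) ((groupAd p).comp f') where
  map_zero := by simp [hf.map_zero]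
  tendsto := by simpa using (hf.tendsto.const_mul p).mul_const p⁻¹
  strict := by
    have h1 := (contDiffAt_unitChart_conj_const (𝕜 := ℝ) (n := ∞) (E := E) p).hasStrictFDerivAt'
      (hasFDerivAt_unitChart_conj p) (by simp)
    have h := HasStrictFDerivAt.comp (0 : V) (f := fun y => (unitChart (f y) : E))
      (g := fun b : E => (unitChart (p * unitChartInv b * p⁻¹) : E))
      (by simpa [hf.map_zero] using h1) hf.strict
    refine h.congr_of_eventuallyEq ?_
    filter_upwards [hf.tendsto.eventually (unitChartInv_unitChart (E := E))] with y hy1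
    simp [hy1]

lemma hasStrictLogDerivAtZero_groupExp [CompleteSpace E] [T2Space H] :
    HasStrictLogDerivAtZero (groupExp : E → H) (ContinuousLinearMap.id ℝ E) where
  map_zero := groupExp_zero
  tendsto := by
    have := (hasLogDerivAt_groupExp_zero (E := E) (H := H)).1
    simpa [ContinuousAt, groupExp_zero] using this
  strict := hasStrictFDerivAt_groupExp

/-- The inverse function theorem for a map to a Lie group. -/
lemma HasStrictLogDerivAtZero.exists_inverse [CompleteSpace E] {f : E → H}
    (hf : HasStrictLogDerivAtZero f (ContinuousLinearMap.id ℝ E)) :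
    ∃ g : E → E, g 0 = 0 ∧ HasFDerivAt g (ContinuousLinearMap.id ℝ E) 0 ∧
      ∀ᶠ p in 𝓝 (1 : H), f (g (unitChart p)) = p := by
  have hs : HasStrictFDerivAt (fun y => (unitChart (f y) : E))
    ((ContinuousLinearEquiv.refl ℝ E : E ≃L[ℝ] E) : E →L[ℝ] E) 0 := hf.strict
  have h0 : (unitChart (f 0) : E) = 0 := by simp [hf.map_zero]
  have hinv := hs.to_localInverse
  have hr := hs.eventually_right_inverse
  have hc := hs.localInverse_continuousAt
  have hi := hs.localInverse_apply_image
  rw [h0] at hinv hr hc hi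
  have hcont : Tendsto (hs.localInverse) (𝓝 0) (𝓝 0) := by simpa [ContinuousAt, hi] using hc
  refine ⟨hs.localInverse, hi, by simpa using! hinv.hasFDerivAt, ?_⟩
  filter_upwards [tendsto_unitChart.eventually hr,
    tendsto_unitChart.eventually ((hf.tendsto.comp hcont).eventually
      (unitChartInv_unitChart (E := E))), unitChartInv_unitChart (E := E) (H := H)] with p h1 h2 h3
  simp only [Function.comp] at h2
  rw [← h2, h1, h3]

end Strict

section Hom

variable {E : Type*} [NormedAddCommGroup E] [NormedSpace ℝ E] [CompleteSpace E]
  {G : Type*} [TopologicalSpace G] [ChartedSpace E G] [Group G]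
  [LieGroup 𝓘(ℝ, E) ∞ G] [IsTopologicalGroup G] [T2Space G]
  {F : Type*} [NormedAddCommGroup F] [NormedSpace ℂ F] [CompleteSpace F]
  {M : Type*} [TopologicalSpace M] [ChartedSpace F M] [Group M] [LieGroup 𝓘(ℂ, F) ω M]
  [IsTopologicalGroup M] [T2Space M] {ι : G →* M}

lemma hasStrictLogDerivAtZero_hom (hι : ContMDiff 𝓘(ℝ, E) 𝓘(ℝ, F) ∞ ι) :
    HasStrictLogDerivAtZero (fun a : E => ι (unitChartInv a)) (modelDeriv E F ι) := by
  have h0 : ι (unitChartInv (0 : E)) = 1 := by simp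
  refine .of_contDiffAt h0 (hasLogDerivAt_hom hι).1 ?_
    ((hasLogDerivAt_hom hι).hasFDerivAt_unitChart h0)
  rw [← contMDiffAt_iff_contDiffAt]
  have h1 : ContMDiffAt 𝓘(ℝ, E) 𝓘(ℝ, F) ∞ (fun a : E => ι (unitChartInv a)) 0 :=
    ContMDiffAt.comp (0 : E) (g := ι) hι.contMDiffAt (contMDiffAt_unitChartInv (H := G) (E := E))
  refine ContMDiffAt.comp (0 : E) (g := (unitChart : M → F)) ?_ h1
  rw [h0]
  exact contMDiffAt_unitChart (H := M) (E := F) (𝕜 := ℝ) (n := ∞)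

end Hom

/-! ### The decomposition `Gᶜ = G exp(i 𝔥) G` -/

section Cartan

variable {E : Type*} [NormedAddCommGroup E] [NormedSpace ℝ E] [FiniteDimensional ℝ E]
  [CompleteSpace E]
  {G : Type*} [TopologicalSpace G] [ChartedSpace E G] [Group G]
  [LieGroup 𝓘(ℝ, E) ∞ G] [IsTopologicalGroup G] [T2Space G]
  {F : Type*} [NormedAddCommGroup F] [NormedSpace ℂ F] [FiniteDimensional ℂ F] [CompleteSpace F]
  {M : Type*} [TopologicalSpace M] [ChartedSpace F M] [Group M] [LieGroup 𝓘(ℂ, F) ω M]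
  [IsTopologicalGroup M] [T2Space M] {ι : G →* M} {B : E →L[ℝ] E →L[ℝ] ℝ}

/-- Elements near the unit are of the form `exp(-i x) ζ₁ exp(i x) exp(i ξ) ζ₂` with `ξ` in the
centralizer of `x` and `ζ₁, ζ₂` in the compact group. -/
lemma exists_local_decomposition (hι : IsComplexification (E := E) (F := F) ι)
    (hB : IsInvariantForm G B) (x : E) :
    ∃ (ζ₁ ξ ζ₂ : F → E) (S₁ S₂ S₃ : F →L[ℝ] E), HasFDerivAt ξ S₂ 0 ∧ ξ 0 = 0 ∧
      (∀ z, groupBracket G x (ξ z) = 0) ∧ (∀ z, groupBracket G x (S₂ z) = 0) ∧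
      (∀ z, z = groupAd (imagExp F ι x)⁻¹ (modelDeriv E F ι (S₁ z)) +
        Complex.I • modelDeriv E F ι (S₂ z) + modelDeriv E F ι (S₃ z)) ∧
      ∀ᶠ p in 𝓝 (1 : M), p = (imagExp F ι x)⁻¹ * ι (unitChartInv (ζ₁ (unitChart p))) *
        imagExp F ι x * imagExp F ι (ξ (unitChart p)) * ι (unitChartInv (ζ₂ (unitChart p))) := by
  set A : F →L[ℝ] F := groupAd (imagExp F ι x)⁻¹ with hA
  let Z : Submodule ℝ E := LinearMap.ker (groupBracket G x : E →ₗ[ℝ] E)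
  let L : (E × Z) × E →ₗ[ℝ] F :=
    ((((A.comp (modelDeriv E F ι) : E →L[ℝ] F) : E →ₗ[ℝ] F).coprod
      ((((Complex.I • modelDeriv E F ι : E →L[ℝ] F)) : E →ₗ[ℝ] F) ∘ₗ Z.subtype)).coprod
        ((modelDeriv E F ι : E →L[ℝ] F) : E →ₗ[ℝ] F))
  have hL : LinearMap.range L = ⊤ := by
    refine LinearMap.range_eq_top.2 fun z => ?_
    obtain ⟨ζ₁, ξ, ζ₂, hξ, hz⟩ := exists_eq_add_add hι hB x z
    exact ⟨((ζ₁, ⟨ξ, hξ⟩), ζ₂), hz.symm⟩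
  -- A linear section of the infinitesimal decomposition parametrizes the product of the three
  -- factors by `F` with derivative the identity at `0`. Composing with the local inverse of this
  -- product gives the factors of a nearby element, the middle one lying exactly in the centralizer.
  obtain ⟨S, hS⟩ := L.exists_rightInverse_of_surjective hL
  let S₁ : F →L[ℝ] E := LinearMap.toContinuousLinearMap
    (LinearMap.fst ℝ E Z ∘ₗ LinearMap.fst ℝ (E × Z) E ∘ₗ S)
  let S₂ : F →L[ℝ] E := LinearMap.toContinuousLinearMap
    (Z.subtype ∘ₗ LinearMap.snd ℝ E Z ∘ₗ LinearMap.fst ℝ (E × Z) E ∘ₗ S)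
  let S₃ : F →L[ℝ] E := LinearMap.toContinuousLinearMap (LinearMap.snd ℝ (E × Z) E ∘ₗ S)
  have hS₂ (z : F) : groupBracket G x (S₂ z) = 0 := (S z).1.2.2
  have hSz (z : F) : z = A (modelDeriv E F ι (S₁ z)) + Complex.I • modelDeriv E F ι (S₂ z) +
      modelDeriv E F ι (S₃ z) := (LinearMap.congr_fun hS z).symm
  have hf : HasStrictLogDerivAtZero (fun z : F => ((imagExp F ι x)⁻¹ * ι (unitChartInv (S₁ z)) *
      ((imagExp F ι x)⁻¹)⁻¹) * groupExp ((Complex.I • modelDeriv E F ι).comp S₂ z) *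
        ι (unitChartInv (S₃ z))) (ContinuousLinearMap.id ℝ F) := by
    convert! ((((hasStrictLogDerivAtZero_hom hι.smooth).comp S₁).conj (imagExp F ι x)⁻¹).mul
      ((hasStrictLogDerivAtZero_groupExp (E := F) (H := M)).comp
        ((Complex.I • modelDeriv E F ι).comp S₂))).mul
      ((hasStrictLogDerivAtZero_hom hι.smooth).comp S₃) using 1
    ext z
    exact hSz z
  obtain ⟨g, hg0, hgd, hg⟩ := hf.exists_inverse
  refine ⟨fun z => S₁ (g z), fun z => S₂ (g z), fun z => S₃ (g z), S₁, S₂, S₃, ?_, ?_,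
    fun z => hS₂ _, hS₂, hSz, ?_⟩
  · exact S₂.hasFDerivAt.comp (0 : F) hgd
  · simp [hg0]
  · filter_upwards [hg] with p hp
    conv_lhs => rw [← hp]
    rw [inv_inv]
    rfl

end Cartan

/-! ### Properness and surjectivity of the decomposition map; following curves in `𝔥` -/

section Torus

variable {E : Type*} [NormedAddCommGroup E] [NormedSpace ℝ E] [FiniteDimensional ℝ E]
  [CompleteSpace E]
  {G : Type*} [TopologicalSpace G] [ChartedSpace E G] [Group G]
  [LieGroup 𝓘(ℝ, E) ∞ G] [IsTopologicalGroup G] [T2Space G]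
  {F : Type*} [NormedAddCommGroup F] [NormedSpace ℂ F] [FiniteDimensional ℂ F] [CompleteSpace F]
  {M : Type*} [TopologicalSpace M] [ChartedSpace F M] [Group M] [LieGroup 𝓘(ℂ, F) ω M]
  [IsTopologicalGroup M] [T2Space M] {ι : G →* M} {B : E →L[ℝ] E →L[ℝ] ℝ}
  {X : Type*} [NormedAddCommGroup X] [InnerProductSpace ℝ X] {e : X →L[ℝ] E}

lemma imagExp_torus_add (hι : IsComplexification (E := E) (F := F) ι)
    (hT : IsMaximalAbelian G (LinearMap.range (e : X →ₗ[ℝ] E))) (x y : X) :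
    imagExp F ι (e (x + y)) = imagExp F ι (e x) * imagExp F ι (e y) := by
  rw [map_add]
  exact imagExp_add hι (hT.comm _ ⟨x, rfl⟩ _ ⟨y, rfl⟩)

lemma hasLogDerivAt_imagExp_torus (hι : IsComplexification (E := E) (F := F) ι)
    (hT : IsMaximalAbelian G (LinearMap.range (e : X →ₗ[ℝ] E))) (x : X) :
    HasLogDerivAt (fun x : X => imagExp F ι (e x)) ((Complex.I • modelDeriv E F ι).comp e) x :=
  HasLogDerivAt.of_add (HasLogDerivAt.comp (f := (imagExp F ι : E → M)) (g := fun x : X => e x)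
    (x := (0 : X)) (by simpa using hasLogDerivAt_imagExp_zero) e.hasFDerivAt)
    (imagExp_torus_add hι hT) x

lemma contMDiff_imagExp_torus (hι : IsComplexification (E := E) (F := F) ι)
    (hT : IsMaximalAbelian G (LinearMap.range (e : X →ₗ[ℝ] E))) :
    ContMDiff 𝓘(ℝ, X) 𝓘(ℝ, F) 1 (fun x : X => imagExp F ι (e x)) :=
  contMDiff_one_of_add (hasLogDerivAt_imagExp_torus hι hT 0) (imagExp_torus_add hι hT)

/-- The double coset of `exp(i x)`. -/
def torusCoset (F : Type*) [NormedAddCommGroup F] [NormedSpace ℂ F] [ChartedSpace F M]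
    (ι : G →* M) (e : X →L[ℝ] E) (x : X) : Set M :=
  {p | ∃ a b : G, p = ι a * imagExp F ι (e x) * ι b}

/-- The decomposition map `G × 𝔥 × G → Gᶜ`. -/
def cartanMap (F : Type*) [NormedAddCommGroup F] [NormedSpace ℂ F] [ChartedSpace F M]
    (ι : G →* M) (e : X →L[ℝ] E) (q : G × X × G) : M :=
  ι q.1 * imagExp F ι (e q.2.1) * ι q.2.2

lemma continuous_cartanMap (hι : IsComplexification (E := E) (F := F) ι)
    (hT : IsMaximalAbelian G (LinearMap.range (e : X →ₗ[ℝ] E))) :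
    Continuous (cartanMap F ι e) :=
  ((hι.smooth.continuous.comp continuous_fst).mul
    ((contMDiff_imagExp_torus hι hT).continuous.comp continuous_snd.fst)).mul
      (hι.smooth.continuous.comp continuous_snd.snd)

variable [CompactSpace G] [FiniteDimensional ℝ X]

/-- Along an ultrafilter the factors in `G` converge by compactness, so `exp(i x)` converges too;
the growth estimate then confines `x` to a ball. -/
lemma isProperMap_cartanMap (hι : IsComplexification (E := E) (F := F) ι)
    (hB : IsInvariantForm G B) (hZ : ∀ v : E, (∀ w, groupBracket G v w = 0) → v = 0)
    (hT : IsMaximalAbelian G (LinearMap.range (e : X →ₗ[ℝ] E)))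
    (he : ∀ x y : X, B (e x) (e y) = inner ℝ x y) :
    IsProperMap (cartanMap F ι e) := by
  rw [isProperMap_iff_ultrafilter]
  refine ⟨continuous_cartanMap hι hT, fun 𝒰 p hp => ?_⟩
  have hcomp (f : G × X × G → G) : ∃ a, Tendsto f 𝒰 (𝓝 a) := by
    obtain ⟨a, -, ha⟩ := isCompact_univ.ultrafilter_le_nhds (𝒰.map f) (by simp)
    exact ⟨a, ha⟩
  obtain ⟨a, ha⟩ := hcomp fun q => q.1
  obtain ⟨b, hb⟩ := hcomp fun q => q.2.2
  have hιc := hι.smooth.continuous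
  have hx : Tendsto (fun q : G × X × G => imagExp F ι (e q.2.1)) 𝒰
      (𝓝 ((ι a)⁻¹ * p * (ι b)⁻¹)) := by
    have := (((hιc.tendsto a).comp ha).inv.mul hp).mul ((hιc.tendsto b).comp hb).inv
    refine this.congr fun q => ?_
    simp only [Function.comp, cartanMap]
    group
  set r := (ι a)⁻¹ * p * (ι b)⁻¹ with hr
  have hinj : Function.Injective e := by
    rw [injective_iff_map_eq_zero]
    intro x hx
    have := he x x
    rw [hx] at this
    simpa using this.symm
  obtain ⟨C, hC⟩ := exists_norm_le_groupAd_imagExp hι hB hZ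
  obtain ⟨C', hC'0, hC'⟩ := exists_norm_le_mul_norm hinj
  have hAd : Tendsto (fun q : G × X × G => ‖groupAd (E := F) (imagExp F ι (e q.2.1)) -
      groupAd (imagExp F ι (e q.2.1))⁻¹‖) 𝒰 (𝓝 ‖groupAd (E := F) r - groupAd r⁻¹‖) :=
    (((continuous_groupAd.tendsto r).comp hx).sub
      ((continuous_groupAd.tendsto r⁻¹).comp hx.inv)).norm
  set R := ‖groupAd (E := F) r - groupAd r⁻¹‖ + 1 with hR
  have hbd : ∀ᶠ q : G × X × G in 𝒰, q.2.1 ∈ Metric.closedBall (0 : X) (C' * (|C| * R)) := by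
    filter_upwards [hAd.eventually (gt_mem_nhds (show _ < R by simp [hR]))] with q hq
    rw [mem_closedBall_zero_iff]
    refine (hC' _).trans (mul_le_mul_of_nonneg_left ((hC _).trans ?_) hC'0)
    exact mul_le_mul (le_abs_self C) hq.le (norm_nonneg _) (abs_nonneg _)
  have : ProperSpace X := FiniteDimensional.proper ℝ X
  obtain ⟨x, -, hxx⟩ := (isCompact_closedBall (0 : X) (C' * (|C| * R))).ultrafilter_le_nhds
    (𝒰.map fun q : G × X × G => q.2.1) (Filter.le_principal_iff.2 hbd)
  have hlim : (𝒰 : Filter (G × X × G)) ≤ 𝓝 (a, x, b) := by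
    have h : Tendsto (fun q : G × X × G => (q.1, q.2.1, q.2.2)) 𝒰 (𝓝 (a, x, b)) :=
      ha.prodMk_nhds (Tendsto.prodMk_nhds hxx hb)
    exact h
  exact ⟨(a, x, b), tendsto_nhds_unique (((continuous_cartanMap hι hT).tendsto _).mono_left hlim) hp,
    hlim⟩

/-- An element `exp(i x) exp(i ξ)`, with `ξ` in the centralizer of `x ∈ 𝔥`, is conjugate under `G`
to `exp(i (x + y'))` with `y' ∈ 𝔥` not further than `ξ` from a given point of `𝔥`. -/
lemma exists_torus_conj (hι : IsComplexification (E := E) (F := F) ι)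
    (hB : IsInvariantForm G B) (hT : IsMaximalAbelian G (LinearMap.range (e : X →ₗ[ℝ] E)))
    (he : ∀ x y : X, B (e x) (e y) = inner ℝ x y) {x : X} {ξ : E}
    (hξ : groupBracket G (e x) ξ = 0) (y : X) :
    ∃ (b : G) (y' : X), groupAd b (e x) = e x ∧ groupAd b ξ = e y' ∧
      ‖y' - y‖ ^ 2 ≤ B (ξ - e y) (ξ - e y) ∧
      imagExp F ι (e x) * imagExp F ι ξ = ι b⁻¹ * imagExp F ι (e (x + y')) * ι b := by
  obtain ⟨b, hb, ⟨y', hy'⟩, hle⟩ := hB.exists_conj_mem hT (A := {e x}) (ξ := ξ) (y := e y)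
    (by rintro _ rfl; exact ⟨x, rfl⟩) ⟨y, rfl⟩ (by rintro _ rfl; exact hξ)
  have hbx := hb _ rfl
  replace hy' : groupAd b ξ = e y' := hy'.symm
  refine ⟨b, y', hbx, hy', ?_, ?_⟩
  · rw [hy', ← map_sub, he, real_inner_self_eq_norm_sq] at hle
    exact hle
  · rw [imagExp_torus_add hι hT, ← hy', ← imagExp_conj hι]
    have : imagExp F ι (e x) = ι b * imagExp F ι (e x) * (ι b)⁻¹ := by
      rw [imagExp_conj hι, hbx]
    conv_rhs => rw [this]
    simp only [map_inv]
    group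

/-- Near a point of the image, elements have the form `a exp(i x) exp(i ξ) b` with `ξ` centralizing
`x`, and `exp(i x) exp(i ξ)` is conjugate under `G` to an element of `exp(i 𝔥)`. -/
lemma exists_nhds_torus_decomposition (hι : IsComplexification (E := E) (F := F) ι)
    (hB : IsInvariantForm G B) (hT : IsMaximalAbelian G (LinearMap.range (e : X →ₗ[ℝ] E)))
    (he : ∀ x y : X, B (e x) (e y) = inner ℝ x y) (q : G × X × G) :
    ∀ᶠ p in 𝓝 (cartanMap F ι e q), p ∈ range (cartanMap F ι e) := by
  obtain ⟨a, x, b⟩ := q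
  obtain ⟨ζ₁, ξ, ζ₂, S₁, S₂, S₃, -, -, hξ, -, -, hloc⟩ := exists_local_decomposition hι hB (e x)
  have ht : Tendsto (fun p => (imagExp F ι (e x))⁻¹ * (ι a)⁻¹ * p * (ι b)⁻¹)
      (𝓝 (cartanMap F ι e (a, x, b))) (𝓝 1) := by
    have : Continuous fun p : M => (imagExp F ι (e x))⁻¹ * (ι a)⁻¹ * p * (ι b)⁻¹ := by fun_prop
    convert! this.tendsto _ using 2
    simp only [cartanMap]
    group
  filter_upwards [ht.eventually hloc] with p hp
  set z : F := unitChart ((imagExp F ι (e x))⁻¹ * (ι a)⁻¹ * p * (ι b)⁻¹) with hz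
  obtain ⟨c, y', -, -, -, h⟩ := exists_torus_conj (F := F) hι hB hT he (hξ z) 0
  refine ⟨(a * unitChartInv (ζ₁ z) * c⁻¹, x + y', c * unitChartInv (ζ₂ z) * b), ?_⟩
  have hp' : p = ι a * (imagExp F ι (e x) * ((imagExp F ι (e x))⁻¹ * (ι a)⁻¹ * p * (ι b)⁻¹)) * ι b := by
    group
  rw [hp', hp]
  simp only [cartanMap, map_mul]
  calc _ = ι a * ι (unitChartInv (ζ₁ z)) * (ι c⁻¹ * imagExp F ι (e (x + y')) * ι c) *
        ι (unitChartInv (ζ₂ z)) * ι b := by group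
    _ = _ := by rw [← h]; group

/-- The image is open by the local decomposition, closed by properness, and contains `ι G`, which
meets every connected component. -/
lemma surjective_cartanMap (hι : IsComplexification (E := E) (F := F) ι)
    (hB : IsInvariantForm G B) (hZ : ∀ v : E, (∀ w, groupBracket G v w = 0) → v = 0)
    (hT : IsMaximalAbelian G (LinearMap.range (e : X →ₗ[ℝ] E)))
    (he : ∀ x y : X, B (e x) (e y) = inner ℝ x y) :
    Function.Surjective (cartanMap F ι e) := by
  have hclosed : IsClosed (range (cartanMap F ι e)) :=
    (isProperMap_cartanMap hι hB hZ hT he).isClosedMap.isClosed_range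
  have hopen : IsOpen (range (cartanMap F ι e)) := by
    rw [isOpen_iff_mem_nhds]
    rintro _ ⟨q, rfl⟩
    exact exists_nhds_torus_decomposition hι hB hT he q
  intro p
  obtain ⟨a, ha⟩ := hι.components p
  refine IsClopen.connectedComponent_subset (s := range (cartanMap F ι e)) ⟨hclosed, hopen⟩ ?_ ha
  exact ⟨(a, 0, 1), by simp [cartanMap, imagExp_zero]⟩

/-- A differentiable curve in `Gᶜ` lies in the double cosets of `exp(i y(s))` for a curve `y` in `𝔥`
whose velocity is the `i 𝔥`-component of the velocity of the curve. -/
lemma exists_torus_curve (hι : IsComplexification (E := E) (F := F) ι)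
    (hB : IsInvariantForm G B) (hT : IsMaximalAbelian G (LinearMap.range (e : X →ₗ[ℝ] E)))
    (he : ∀ x y : X, B (e x) (e y) = inner ℝ x y) {γ : ℝ → M} {θ : F} {s₀ : ℝ}
    (hγ : HasLogDerivAt γ (ContinuousLinearMap.toSpanSingleton ℝ θ) s₀) {x : X}
    (hx : γ s₀ ∈ torusCoset F ι e x) :
    ∃ (a b : G) (η : X) (ζ₁ ζ₂ : E), γ s₀ = ι a * imagExp F ι (e x) * ι b ∧
      groupAd (ι b) θ = groupAd (imagExp F ι (e x))⁻¹ (modelDeriv E F ι ζ₁) +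
        Complex.I • modelDeriv E F ι (e η) + modelDeriv E F ι ζ₂ ∧
      ∃ y : ℝ → X, HasDerivAt y η s₀ ∧ y s₀ = x ∧ ∀ᶠ s in 𝓝 s₀, γ s ∈ torusCoset F ι e (y s) := by
  obtain ⟨a, b, hab⟩ := hx
  obtain ⟨ζ₁, ξ, ζ₂, S₁, S₂, S₃, hξd, hξ0, hξ, hS₂, hS, hloc⟩ :=
    exists_local_decomposition hι hB (e x)
  set δ : ℝ → M := fun s => (imagExp F ι (e x))⁻¹ * (ι a)⁻¹ * γ s * (ι b)⁻¹ with hδ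
  have hδ0 : δ s₀ = 1 := by simp only [hδ, hab]; group
  have hδd : HasLogDerivAt δ (ContinuousLinearMap.toSpanSingleton ℝ (groupAd (ι b) θ)) s₀ := by
    convert! (hγ.const_mul ((imagExp F ι (e x))⁻¹ * (ι a)⁻¹)).mul_const (ι b)⁻¹ using 1
    ext; simp
  set θ' := groupAd (ι b) θ with hθ'
  have hz := hδd.hasFDerivAt_unitChart hδ0
  have hξz : HasDerivAt (fun s => ξ (unitChart (δ s))) (S₂ θ') s₀ := by
    have := (HasFDerivAt.comp s₀ (g := ξ) (by simpa [hδ0] using hξd) hz).hasDerivAt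
    simpa using! this
  -- The derivative of the centralizer component is first rotated into `𝔥` by some `c` fixing `e x`;
  -- the whole component is then rotated by the same `c`.
  obtain ⟨c, η, hcx, hcη, -, -⟩ := exists_torus_conj (F := F) hι hB hT he (hS₂ θ') 0
  have hξ' (s : ℝ) : groupBracket G (e x) (groupAd c (ξ (unitChart (δ s)))) = 0 := by
    have := groupAd_groupBracket c (e x) (ξ (unitChart (δ s)))
    rw [hξ, map_zero, hcx] at this
    exact this.symm
  have hξ'd : HasDerivAt (fun s => groupAd c (ξ (unitChart (δ s)))) (e η) s₀ := by
    rw [← hcη]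
    exact (groupAd (E := E) c).hasFDerivAt.comp_hasDerivAt s₀ hξz
  -- The choices for different `s` are unrelated; what ties them together is the distance to the
  -- tangent line `(s - s₀) • η`, which the conjugation into `𝔥` does not increase.
  choose c' y' hc'x hc'y hy' hy'' using fun s =>
    exists_torus_conj (F := F) hι hB hT he (hξ' s) ((s - s₀) • η)
  have hy's₀ : y' s₀ = 0 := by
    have := hy' s₀
    simp only [sub_self, zero_smul, sub_zero, map_zero, hδ0, unitChart_one, hξ0] at this
    have h0 : ‖y' s₀‖ ^ 2 = 0 := le_antisymm (by simpa using this) (by positivity)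
    simpa using h0
  refine ⟨a * c⁻¹, c * b, η, groupAd c (S₁ θ'), groupAd c (S₃ θ'), ?_, ?_,
    fun s => x + y' s, ?_, by simp [hy's₀], ?_⟩
  · have : imagExp F ι (e x) = (ι c)⁻¹ * imagExp F ι (e x) * ι c := by
      have h := imagExp_conj hι c⁻¹ (e x)
      have h2 : groupAd c⁻¹ (e x) = e x := by
        conv_lhs => rw [← hcx]
        exact groupAd_inv_groupAd c (e x)
      rw [h2, map_inv, inv_inv] at h
      exact h.symm
    rw [hab]
    conv_lhs => rw [this]
    simp only [map_mul, map_inv]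
    group
  · have hcomm : ι c * (imagExp F ι (e x))⁻¹ = (imagExp F ι (e x))⁻¹ * ι c := by
      have h := imagExp_conj hι c (-(e x))
      rw [map_neg, hcx, mul_inv_eq_iff_eq_mul] at h
      rw [← imagExp_neg]
      exact h
    rw [map_mul, groupAd_mul_apply, ← hθ']
    conv_lhs => rw [hS θ']
    rw [map_add, map_add, groupAd_I_smul, ← modelDeriv_groupAd hι.smooth,
      ← modelDeriv_groupAd hι.smooth, hcη, ← groupAd_mul_apply, hcomm, groupAd_mul_apply,
      ← modelDeriv_groupAd hι.smooth]
  -- `‖y' s - (s - s₀) • η‖` is at most `√‖B‖` times the first-order error of the differentiable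
  -- curve before conjugation, hence `o(s - s₀)`.
  · have hd : HasDerivAt y' η s₀ := by
      rw [hasDerivAt_iff_isLittleO] at hξ'd ⊢
      refine Asymptotics.IsBigO.trans_isLittleO (.of_bound (√‖B‖) ?_) hξ'd
      refine Eventually.of_forall fun s => ?_
      rw [hy's₀, sub_zero]
      have h0 : groupAd c (ξ (unitChart (δ s₀))) = 0 := by simp [hδ0, hξ0]
      rw [h0, sub_zero]
      have h := hy' s
      rw [map_smul] at h
      set v := groupAd c (ξ (unitChart (δ s))) - (s - s₀) • e η
      refine le_of_sq_le_sq ?_ (by positivity)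
      rw [mul_pow, Real.sq_sqrt (norm_nonneg B)]
      calc _ ≤ B v v := h
        _ ≤ ‖B v v‖ := Real.le_norm_self _
        _ ≤ ‖B‖ * ‖v‖ * ‖v‖ := B.le_opNorm₂ _ _
        _ = _ := by ring
    exact hd.const_add x
  · have ht : Tendsto δ (𝓝 s₀) (𝓝 1) := by simpa [ContinuousAt, hδ0] using hδd.1
    filter_upwards [ht.eventually hloc] with s hs
    have hp' : γ s = ι a * (imagExp F ι (e x) * δ s) * ι b := by
      simp only [hδ]; group
    set z : F := unitChart (δ s)
    have hconj := imagExp_conj hι c (ξ z)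
    have hconjx := imagExp_conj hι c (e x)
    rw [hcx] at hconjx
    refine ⟨a * unitChartInv (ζ₁ z) * c⁻¹ * (c' s)⁻¹, c' s * c * unitChartInv (ζ₂ z) * b, ?_⟩
    rw [hp', hs]
    simp only [map_mul]
    calc _ = ι a * ι (unitChartInv (ζ₁ z)) * ι c⁻¹ * ((ι c * imagExp F ι (e x) * (ι c)⁻¹) *
          (ι c * imagExp F ι (ξ z) * (ι c)⁻¹)) * ι c * ι (unitChartInv (ζ₂ z)) * ι b := by
            rw [map_inv]; group
      _ = ι a * ι (unitChartInv (ζ₁ z)) * ι c⁻¹ * (ι (c' s)⁻¹ * imagExp F ι (e (x + y' s)) *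
          ι (c' s)) * ι c * ι (unitChartInv (ζ₂ z)) * ι b := by
            rw [hconj, hconjx, hy'']
      _ = _ := by group

end Torus

/-! ### Left-invariant derivatives of a function -/

section LogDerivFun

variable {F : Type*} [NormedAddCommGroup F] [NormedSpace ℝ F]
  {M : Type*} [TopologicalSpace M] [ChartedSpace F M] [Group M]

/-- The derivative of `K` at `p` in left-invariant directions. -/
def leftDeriv (F : Type*) [NormedAddCommGroup F] [NormedSpace ℝ F] [ChartedSpace F M]
    (K : M → ℝ) (p : M) : F →L[ℝ] ℝ :=
  fderiv ℝ (fun b : F => K (p * unitChartInv b)) 0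

/-- The second derivative of `K` at `p` in left-invariant directions: `leftDeriv₂ F K p Z W` is
`Z (W K)` for the left-invariant vector fields `Z`, `W`. -/
def leftDeriv₂ (F : Type*) [NormedAddCommGroup F] [NormedSpace ℝ F] [ChartedSpace F M]
    (K : M → ℝ) (p : M) : F →L[ℝ] F →L[ℝ] ℝ :=
  fderiv ℝ (fun a : F => leftDeriv F K (p * unitChartInv a)) 0

variable [LieGroup 𝓘(ℝ, F) ∞ M] [IsTopologicalGroup M] {K : M → ℝ}

lemma contDiffAt_mul_mul_unitChartInv (hK : ContMDiff 𝓘(ℝ, F) 𝓘(ℝ, ℝ) ∞ K) (p : M) :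
    ContDiffAt ℝ ∞ (fun x : F × F => K (p * unitChartInv x.1 * unitChartInv x.2)) 0 := by
  rw [← contMDiffAt_iff_contDiffAt]
  have h1 : ContMDiffAt 𝓘(ℝ, F × F) 𝓘(ℝ, F) ∞ (fun x : F × F => (unitChartInv x.1 : M)) 0 :=
    ContMDiffAt.comp (0 : F × F) (g := unitChartInv) (contMDiffAt_unitChartInv (H := M) (E := F))
      (by rw [contMDiffAt_iff_contDiffAt]; fun_prop)
  have h2 : ContMDiffAt 𝓘(ℝ, F × F) 𝓘(ℝ, F) ∞ (fun x : F × F => (unitChartInv x.2 : M)) 0 :=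
    ContMDiffAt.comp (0 : F × F) (g := unitChartInv) (contMDiffAt_unitChartInv (H := M) (E := F))
      (by rw [contMDiffAt_iff_contDiffAt]; fun_prop)
  exact ContMDiffAt.comp (0 : F × F) (g := K) hK.contMDiffAt
    (((contMDiffAt_const (c := p)).mul h1).mul h2)

lemma hasFDerivAt_leftDeriv_zero (hK : ContMDiff 𝓘(ℝ, F) 𝓘(ℝ, ℝ) ∞ K) (p : M) :
    HasFDerivAt (fun b : F => K (p * unitChartInv b)) (leftDeriv F K p) 0 := by
  have h := (contDiffAt_mul_mul_unitChartInv hK p).differentiableAt (by simp)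
  have h2 : HasFDerivAt (fun b : F => ((0 : F), b)) (ContinuousLinearMap.inr ℝ F F) 0 :=
    hasFDerivAt_prodMk_right 0 0
  have h3 := HasFDerivAt.comp (0 : F) (f := fun b : F => ((0 : F), b)) h.hasFDerivAt h2
  simp only [Function.comp_def, unitChartInv_zero, mul_one] at h3
  exact h3.differentiableAt.hasFDerivAt

lemma HasLogDerivAt.hasFDerivAt_fun {V : Type*} [NormedAddCommGroup V] [NormedSpace ℝ V]
    (hK : ContMDiff 𝓘(ℝ, F) 𝓘(ℝ, ℝ) ∞ K) {f : V → M} {f' : V →L[ℝ] F} {x : V}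
    (hf : HasLogDerivAt f f' x) :
    HasFDerivAt (fun y => K (f y)) ((leftDeriv F K (f x)).comp f') x := by
  have h := HasFDerivAt.comp x (g := fun b : F => K (f x * unitChartInv b))
    (by simpa using hasFDerivAt_leftDeriv_zero hK (f x)) hf.2
  exact h.congr_of_eventuallyEq (hf.eventually.mono fun y hy => by simp [hy])

lemma hasFDerivAt_leftDeriv₂_zero (hK : ContMDiff 𝓘(ℝ, F) 𝓘(ℝ, ℝ) ∞ K) (p : M) :
    HasFDerivAt (fun a : F => leftDeriv F K (p * unitChartInv a)) (leftDeriv₂ F K p) 0 := by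
  have hc := contDiffAt_mul_mul_unitChartInv hK p
  have h1 := (hc.fderiv_right (m := ∞) (by simp)).differentiableAt (by simp)
  have h2 : HasFDerivAt (fun a : F => (a, (0 : F))) (ContinuousLinearMap.inl ℝ F F) 0 :=
    hasFDerivAt_prodMk_left 0 0
  have h3 := (HasFDerivAt.comp (0 : F) (f := fun a : F => (a, (0 : F))) h1.hasFDerivAt h2).clm_comp
    (hasFDerivAt_const (ContinuousLinearMap.inr ℝ F F) (0 : F))
  have h4 : DifferentiableAt ℝ (fun a : F => leftDeriv F K (p * unitChartInv a)) 0 := by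
    refine h3.differentiableAt.congr_of_eventuallyEq ?_
    have hev := (hc.of_le (m := 1) (by exact_mod_cast le_top)).eventually (by simp)
    filter_upwards [tendsto_prodMk_zero.eventually hev] with a ha
    exact ((ha.differentiableAt (by simp)).hasFDerivAt.comp (0 : F)
      (hasFDerivAt_prodMk_right a 0)).fderiv
  exact h4.hasFDerivAt

lemma HasLogDerivAt.hasFDerivAt_leftDeriv {V : Type*} [NormedAddCommGroup V] [NormedSpace ℝ V]
    (hK : ContMDiff 𝓘(ℝ, F) 𝓘(ℝ, ℝ) ∞ K) {f : V → M} {f' : V →L[ℝ] F} {x : V}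
    (hf : HasLogDerivAt f f' x) :
    HasFDerivAt (fun y => leftDeriv F K (f y)) ((leftDeriv₂ F K (f x)).comp f') x := by
  have h := HasFDerivAt.comp x (g := fun b : F => leftDeriv F K (f x * unitChartInv b))
    (by simpa using hasFDerivAt_leftDeriv₂_zero hK (f x)) hf.2
  exact h.congr_of_eventuallyEq (hf.eventually.mono fun y hy => by simp [hy])

end LogDerivFun

/-! ### The Levi form in left-invariant directions -/

section Levi

variable {F : Type*} [NormedAddCommGroup F] [NormedSpace ℂ F]
  {M : Type*} [TopologicalSpace M] [ChartedSpace F M] [Group M] [LieGroup 𝓘(ℂ, F) ω M]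
  [IsTopologicalGroup M] {K : M → ℝ}

/-- The Levi form in left-invariant directions. -/
def leftLevi (K : M → ℝ) (p : M) (Z W : F) : ℝ :=
  leftDeriv₂ F K p Z W + leftDeriv₂ F K p (Complex.I • Z) (Complex.I • W)

lemma hasFDerivAt_chart_of_hasMFDerivAt {V : Type*} [NormedAddCommGroup V] [NormedSpace ℝ V]
    {f : V → M} {x : V} {p : M} (hp : f x = p) {L : V →L[ℝ] F}
    (h : HasMFDerivAt 𝓘(ℝ, V) 𝓘(ℝ, F) f x L) :
    HasFDerivAt (fun y => (chartAt F p (f y) : F)) L x := by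
  subst hp
  have h2 := h.2
  simp only [writtenInExtChartAt, Function.comp_def, extChartAt, mfld_simps] at h2
  exact hasFDerivWithinAt_univ.1 h2

lemma contDiffAt_chart_mul_mul (p : M) : ContDiffAt ℂ ω
    (fun x : F × F => (chartAt F p (p * unitChartInv x.1 * unitChartInv x.2) : F)) 0 := by
  rw [← contMDiffAt_iff_contDiffAt]
  have h1 : ContMDiffAt 𝓘(ℂ, F × F) 𝓘(ℂ, F) ω (fun x : F × F => (unitChartInv x.1 : M)) 0 :=
    ContMDiffAt.comp (0 : F × F) (g := unitChartInv) (contMDiffAt_unitChartInv (H := M) (E := F))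
      (by rw [contMDiffAt_iff_contDiffAt]; fun_prop)
  have h2 : ContMDiffAt 𝓘(ℂ, F × F) 𝓘(ℂ, F) ω (fun x : F × F => (unitChartInv x.2 : M)) 0 :=
    ContMDiffAt.comp (0 : F × F) (g := unitChartInv) (contMDiffAt_unitChartInv (H := M) (E := F))
      (by rw [contMDiffAt_iff_contDiffAt]; fun_prop)
  refine ContMDiffAt.comp (0 : F × F) (g := (chartAt F p : M → F)) ?_
    (((contMDiffAt_const (c := p)).mul h1).mul h2)
  have : p * unitChartInv (0 : F × F).1 * unitChartInv (0 : F × F).2 = p := by simp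
  rw [this]
  exact contMDiffAt_of_mem_maximalAtlas (IsManifold.chart_mem_maximalAtlas p) (mem_chart_source F p)

/-- Second derivatives along left-invariant fields exceed the chart Hessian by the first derivative
of `K` applied to `N' Z W`. Multiplication being holomorphic, `N'` is complex bilinear, so this
correction changes sign on `(i Z, i W)` and cancels in the sum. -/
lemma leviForm_leftTrans (hK : ContMDiff 𝓘(ℝ, F) 𝓘(ℝ, ℝ) ∞ K) (p : M) (Z W : F) :
    leviForm K p (leftTrans p Z) (leftTrans p W) = leftLevi K p Z W := by
  set k : F → ℝ := K ∘ (chartAt F p).symm with hk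
  set m : F × F → F := fun x => chartAt F p (p * unitChartInv x.1 * unitChartInv x.2) with hm
  have hm0 : m 0 = chartAt F p p := by simp [hm]
  have hmc : ContDiffAt ℂ ω m 0 := contDiffAt_chart_mul_mul p
  have hkc : ContDiffAt ℝ ∞ k (chartAt F p p) := by
    rw [← contMDiffAt_iff_contDiffAt]
    exact ContMDiffAt.comp _ (g := K) hK.contMDiffAt
      (contMDiffAt_symm_of_mem_maximalAtlas (IsManifold.chart_mem_maximalAtlas p)
        (mem_chart_target F p))
  -- the derivative in the second variable, as a complex linear map
  set N : F → F →L[ℂ] F := fun a => (fderiv ℂ m (a, 0)).comp (ContinuousLinearMap.inr ℂ F F) with hN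
  have hmd : ∀ᶠ a in 𝓝 (0 : F), HasFDerivAt (fun b => m (a, b)) ((N a).restrictScalars ℝ) 0 := by
    have hev := (hmc.of_le (m := 1) le_top).eventually (by simp)
    filter_upwards [tendsto_prodMk_zero.eventually hev] with a ha
    exact (HasFDerivAt.comp (0 : F) (ha.differentiableAt (by simp)).hasFDerivAt
      (hasFDerivAt_prodMk_right (𝕜 := ℂ) a 0)).restrictScalars ℝ
  obtain ⟨N', hN'⟩ : ∃ N' : F →L[ℂ] F →L[ℂ] F, HasFDerivAt N N' 0 := by
    have h1 := (hmc.fderiv_right (m := ω) (by simp)).differentiableAt (by simp)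
    have h2 : HasFDerivAt (fun a : F => (a, (0 : F))) (ContinuousLinearMap.inl ℂ F F) 0 :=
      hasFDerivAt_prodMk_left 0 0
    exact ⟨_, ((HasFDerivAt.comp (0 : F) (f := fun a : F => (a, (0 : F))) h1.hasFDerivAt h2).clm_comp
      (hasFDerivAt_const (ContinuousLinearMap.inr ℂ F F) (0 : F)))⟩
  have hleft : HasFDerivAt (fun b : F => (chartAt F p (p * unitChartInv b) : F)) (leftTrans p) 0 := by
    refine hasFDerivAt_chart_of_hasMFDerivAt (by simp) ?_
    have h1 : HasMFDerivAt 𝓘(ℝ, F) 𝓘(ℝ, F) (fun x : M => p * x) (unitChartInv (0 : F))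
        (leftTrans (E := F) p) := by
      rw [unitChartInv_zero]; exact hasMFDerivAt_leftTrans p
    exact h1.comp (0 : F) hasMFDerivAt_unitChartInv
  have hN0 : (N 0).restrictScalars ℝ = leftTrans p := by
    refine hmd.self_of_nhds.unique ?_
    simpa [hm] using hleft
  have hma : HasFDerivAt (fun a => m (a, 0)) (leftTrans p) 0 := by simpa [hm] using hleft
  have hmt : Tendsto (fun a : F => p * (unitChartInv a : M)) (𝓝 0) (𝓝 p) := by
    simpa using (tendsto_unitChartInv (E := F) (H := M)).const_mul p
  have hmc0 : Tendsto (fun a : F => m (a, 0)) (𝓝 0) (𝓝 (chartAt F p p)) := by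
    simpa [ContinuousAt, hm] using hma.continuousAt
  -- the first derivative of `K` through the chart at `p`
  have hD : ∀ᶠ a in 𝓝 (0 : F), leftDeriv F K (p * unitChartInv a) =
      (fderiv ℝ k (m (a, 0))).comp ((N a).restrictScalars ℝ) := by
    have hev := (hkc.of_le (m := 1) (by exact_mod_cast le_top)).eventually (by simp)
    filter_upwards [hmd, hmc0.eventually hev, hmt.eventually
      ((chartAt F p).eventually_left_inverse (mem_chart_source F p)).eventually_nhds] with a h1 h2 h3
    have h4 := HasFDerivAt.comp (0 : F) (f := fun b => m (a, b))
      (h2.differentiableAt (by simp)).hasFDerivAt h1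
    refine (h4.congr_of_eventuallyEq ?_).fderiv
    have ht : Tendsto (fun b : F => p * unitChartInv a * (unitChartInv b : M)) (𝓝 0)
        (𝓝 (p * unitChartInv a)) := by
      simpa using (tendsto_unitChartInv (E := F) (H := M)).const_mul (p * unitChartInv a)
    filter_upwards [ht.eventually h3] with b hb
    simp only [hk, hm, Function.comp, hb]
  have hk2 : HasFDerivAt (fderiv ℝ k) (fderiv ℝ (fderiv ℝ k) (chartAt F p p)) (m (0, 0)) := by
    have := ((hkc.fderiv_right (m := ∞) (by simp)).differentiableAt (by simp)).hasFDerivAt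
    have h0 : m (0, 0) = chartAt F p p := hm0
    rwa [h0]
  have hD2 (Z W : F) : leftDeriv₂ F K p Z W =
      hessianForm k (chartAt F p p) (leftTrans p Z) (leftTrans p W) +
        fderiv ℝ k (chartAt F p p) (N' Z W) := by
    have h1 := (hasFDerivAt_leftDeriv₂_zero hK p).clm_apply (hasFDerivAt_const W (0 : F))
    have h2 := (HasFDerivAt.comp (0 : F) (f := fun a => m (a, 0)) hk2 hma).clm_apply
      ((hN'.clm_apply (hasFDerivAt_const W (0 : F))).restrictScalars ℝ)
    have h3 := h1.unique (h2.congr_of_eventuallyEq (hD.mono fun a ha => by simp [ha]))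
    have h4 := congrArg (fun L : F →L[ℝ] ℝ => L Z) h3
    have h0 : m (0, 0) = chartAt F p p := hm0
    have hN0' : N 0 W = leftTrans p W := by rw [← hN0]; rfl
    simpa [h0, hN0', hessianForm, add_comm] using! h4
  have hI (Z : F) : leftTrans p (Complex.I • Z) = Complex.I • leftTrans p Z := by
    rw [← hN0]; simp
  rw [leftLevi, hD2, hD2, leviForm, hI, hI]
  have : N' (Complex.I • Z) (Complex.I • W) = -N' Z W := by
    simp [smul_smul]
  rw [this, map_neg]
  ring

end Levi

/-! ### Derivatives of a `G × G`-invariant potential along `exp(i 𝔥)` -/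

section InvariantPotential

variable {E : Type*} [NormedAddCommGroup E] [NormedSpace ℝ E] [FiniteDimensional ℝ E]
  [CompleteSpace E]
  {G : Type*} [TopologicalSpace G] [ChartedSpace E G] [Group G]
  [LieGroup 𝓘(ℝ, E) ∞ G] [IsTopologicalGroup G] [T2Space G]
  {F : Type*} [NormedAddCommGroup F] [NormedSpace ℂ F] [FiniteDimensional ℂ F] [CompleteSpace F]
  {M : Type*} [TopologicalSpace M] [ChartedSpace F M] [Group M] [LieGroup 𝓘(ℂ, F) ω M]
  [IsTopologicalGroup M] [T2Space M] {ι : G →* M}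
  {X : Type*} [NormedAddCommGroup X] [InnerProductSpace ℝ X] {e : X →L[ℝ] E}
  {K : M → ℝ} {Kt : X → ℝ}

/-- The hypotheses on a `G × G`-invariant potential with given restriction to the torus. -/
structure IsInvariantPotential (ι : G →* M) (e : X →L[ℝ] E) (K : M → ℝ) (Kt : X → ℝ) : Prop where
  smooth : ContMDiff 𝓘(ℝ, F) 𝓘(ℝ, ℝ) ∞ K
  invariant : ∀ (a b : G) (p : M), K (ι a * p * ι b) = K p
  torus : ∀ x, K (imagExp F ι (e x)) = Kt x

variable (h : IsInvariantPotential (F := F) ι e K Kt)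

include h

lemma IsInvariantPotential.left (a : G) (p : M) : K (ι a * p) = K p := by
  simpa using h.invariant a 1 p

lemma IsInvariantPotential.right (b : G) (p : M) : K (p * ι b) = K p := by
  simpa using h.invariant 1 b p

lemma IsInvariantPotential.leftDeriv_left (a : G) (p : M) :
    leftDeriv F K (ι a * p) = leftDeriv F K p := by
  simp only [leftDeriv, mul_assoc, h.left]

lemma IsInvariantPotential.leftDeriv_right (b : G) (p : M) (W : F) :
    leftDeriv F K (p * ι b) W = leftDeriv F K p (groupAd (ι b) W) := by
  have h1 := HasLogDerivAt.hasFDerivAt_fun h.smooth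
    (((hasLogDerivAt_unitChartInv (E := F) (H := M)).conj (ι b)).const_mul p)
  have h2 := HasLogDerivAt.hasFDerivAt_fun h.smooth
    ((hasLogDerivAt_unitChartInv (E := F) (H := M)).const_mul (p * ι b))
  have e1 : (fun y : F => K (p * (ι b * unitChartInv y * (ι b)⁻¹))) =
      fun y : F => K (p * ι b * unitChartInv y) := by
    funext y
    have := h.right b⁻¹ (p * ι b * unitChartInv y)
    rw [← this, map_inv]
    congr 1
    group
  rw [e1] at h1
  simpa using! congrArg (fun L : F →L[ℝ] ℝ => L W) (h2.unique h1)

lemma IsInvariantPotential.leftDeriv_real (hι : IsComplexification (E := E) (F := F) ι) (p : M)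
    (v : E) : leftDeriv F K p (modelDeriv E F ι v) = 0 := by
  have h1 := HasLogDerivAt.hasFDerivAt_fun h.smooth ((hasLogDerivAt_hom hι.smooth).const_mul p)
  simp only [h.right] at h1
  simpa using! congrArg (fun L : E →L[ℝ] ℝ => L v) (h1.unique (hasFDerivAt_const _ _))

lemma IsInvariantPotential.leftDeriv₂_left (a : G) (p : M) :
    leftDeriv₂ F K (ι a * p) = leftDeriv₂ F K p := by
  simp only [leftDeriv₂, mul_assoc, h.leftDeriv_left]

lemma IsInvariantPotential.leftDeriv₂_right (b : G) (p : M) (Z W : F) :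
    leftDeriv₂ F K (p * ι b) Z W = leftDeriv₂ F K p (groupAd (ι b) Z) (groupAd (ι b) W) := by
  have h1 := (HasLogDerivAt.hasFDerivAt_leftDeriv h.smooth
    (((hasLogDerivAt_unitChartInv (E := F) (H := M)).conj (ι b)).const_mul p)).clm_apply
      (hasFDerivAt_const (groupAd (ι b) W) (0 : F))
  have h2 := (HasLogDerivAt.hasFDerivAt_leftDeriv h.smooth
    ((hasLogDerivAt_unitChartInv (E := F) (H := M)).const_mul (p * ι b))).clm_apply
      (hasFDerivAt_const W (0 : F))
  have e1 : (fun y : F => leftDeriv F K (p * (ι b * unitChartInv y * (ι b)⁻¹)) (groupAd (ι b) W)) =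
      fun y : F => leftDeriv F K (p * ι b * unitChartInv y) W := by
    funext y
    rw [← h.leftDeriv_right]
    congr 2
    group
  rw [e1] at h1
  simpa using! congrArg (fun L : F →L[ℝ] ℝ => L Z) (h2.unique h1)

lemma IsInvariantPotential.leftDeriv₂_real (hι : IsComplexification (E := E) (F := F) ι) (p : M)
    (Z : F) (v : E) : leftDeriv₂ F K p Z (modelDeriv E F ι v) = 0 := by
  have h1 := (hasFDerivAt_leftDeriv₂_zero h.smooth p).clm_apply
    (hasFDerivAt_const (modelDeriv E F ι v) (0 : F))
  simp only [h.leftDeriv_real hι] at h1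
  simpa using! congrArg (fun L : F →L[ℝ] ℝ => L Z) (h1.unique (hasFDerivAt_const _ _))

/-- Moving `p` in the direction `Ad(p⁻¹) ζ` is multiplying it on the left by elements of `G`, which
leaves the left-invariant derivatives of `K` unchanged. -/
lemma IsInvariantPotential.leftDeriv₂_groupAd_inv_real
    (hι : IsComplexification (E := E) (F := F) ι) (p : M) (ζ : E) :
    leftDeriv₂ F K p (groupAd p⁻¹ (modelDeriv E F ι ζ)) = 0 := by
  have h1 := HasLogDerivAt.hasFDerivAt_leftDeriv h.smooth
    (((hasLogDerivAt_hom hι.smooth).conj p⁻¹).const_mul p)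
  have e1 : (fun y : E => leftDeriv F K (p * (p⁻¹ * ι (unitChartInv y) * p⁻¹⁻¹))) =
      fun _ => leftDeriv F K p := by
    funext y
    rw [← h.leftDeriv_left (unitChartInv y) p]
    congr 1
    group
  rw [e1] at h1
  simpa using! congrArg (fun L : E →L[ℝ] F →L[ℝ] ℝ => L ζ) (h1.unique (hasFDerivAt_const _ _))

/-- `exp(t v)` commutes with `exp(i x)`, so by two-sided invariance the derivative of `K` at `exp(i
x)` takes the same value on `i Ad(exp(t v)) ζ` for all `t`; differentiate at `t = 0`. -/
lemma IsInvariantPotential.leftDeriv_imag_bracket (hι : IsComplexification (E := E) (F := F) ι)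
    {x v : E} (hx : groupBracket G v x = 0) (ζ : E) :
    leftDeriv F K (imagExp F ι x) (Complex.I • modelDeriv E F ι (groupBracket G v ζ)) = 0 := by
  have key (t : ℝ) : leftDeriv F K (imagExp F ι x) (Complex.I • modelDeriv E F ι
      (groupAd (groupExp (t • v) : G) ζ)) =
        leftDeriv F K (imagExp F ι x) (Complex.I • modelDeriv E F ι ζ) := by
    set b : G := groupExp (t • v) with hb
    have h1 : groupAd b x = x := groupAd_groupExp_of_bracket_eq_zero (by simp [hx])
    have h2 := imagExp_conj hι b x
    rw [h1, mul_inv_eq_iff_eq_mul] at h2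
    rw [modelDeriv_groupAd hι.smooth, ← groupAd_I_smul, ← h.leftDeriv_right, ← h2,
      h.leftDeriv_left]
  have hd := ((leftDeriv F K (imagExp F ι x)).comp
    (Complex.I • modelDeriv E F ι)).hasFDerivAt.comp_hasDerivAt 0
      (hasDerivAt_groupAd_groupExp_apply (M := G) v ζ 0)
  have e1 : (((leftDeriv F K (imagExp F ι x)).comp (Complex.I • modelDeriv E F ι)) ∘
      fun t : ℝ => groupAd (groupExp (t • v) : G) ζ) = fun _ =>
        leftDeriv F K (imagExp F ι x) (Complex.I • modelDeriv E F ι ζ) := by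
    funext t
    exact key t
  rw [e1] at hd
  simpa using! hd.unique (hasDerivAt_const _ _)

/-- Right invariance moves the factor `exp(t ζ)` onto the argument as `Ad(exp(t ζ)) v`. The
derivative is that of `K` along `i [ζ, v]`, which vanishes by `leftDeriv_imag_bracket`. -/
lemma IsInvariantPotential.leftDeriv₂_real_imag (hι : IsComplexification (E := E) (F := F) ι)
    {x v : E} (hx : groupBracket G v x = 0) (ζ : E) :
    leftDeriv₂ F K (imagExp F ι x) (modelDeriv E F ι ζ) (Complex.I • modelDeriv E F ι v) = 0 := by
  have h1 := (HasLogDerivAt.hasFDerivAt_leftDeriv h.smooth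
    (((hasLogDerivAt_groupExp_smul (H := G) ζ 0).map_hom hι.smooth).const_mul
      (imagExp F ι x))).hasDerivAt.clm_apply
        (hasDerivAt_const 0 (Complex.I • modelDeriv E F ι v))
  have e1 : (fun t : ℝ => leftDeriv F K (imagExp F ι x * ι (groupExp (t • ζ)))
      (Complex.I • modelDeriv E F ι v)) =
      ((leftDeriv F K (imagExp F ι x)).comp (Complex.I • modelDeriv E F ι)) ∘
        fun t : ℝ => groupAd (groupExp (t • ζ) : G) v := by
    funext t
    rw [h.leftDeriv_right, groupAd_I_smul, ← modelDeriv_groupAd hι.smooth]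
    rfl
  have h2 := ((leftDeriv F K (imagExp F ι x)).comp
    (Complex.I • modelDeriv E F ι)).hasFDerivAt.comp_hasDerivAt 0
      (hasDerivAt_groupAd_groupExp_apply (M := G) ζ v 0)
  rw [← e1] at h2
  have h3 := h1.unique h2
  have h4 : leftDeriv F K (imagExp F ι x)
      (Complex.I • modelDeriv E F ι (groupBracket G ζ v)) = 0 := by
    rw [groupBracket_swap, map_neg, smul_neg, map_neg, h.leftDeriv_imag_bracket hι hx, neg_zero]
  simp only [zero_smul, groupExp_zero, groupAd_one, map_one, mul_one, map_zero, add_zero,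
    ContinuousLinearMap.comp_apply, ContinuousLinearMap.toSpanSingleton_apply, one_smul,
    ContinuousLinearMap.id_apply] at h3
  exact h3.trans h4

variable (hT : IsMaximalAbelian G (LinearMap.range (e : X →ₗ[ℝ] E)))

include hT

lemma IsInvariantPotential.leftDeriv_torus (hι : IsComplexification (E := E) (F := F) ι)
    (x : X) : HasFDerivAt Kt ((leftDeriv F K (imagExp F ι (e x))).comp
      ((Complex.I • modelDeriv E F ι).comp e)) x := by
  have := HasLogDerivAt.hasFDerivAt_fun h.smooth (hasLogDerivAt_imagExp_torus hι hT x)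
  simpa only [h.torus] using this

set_option synthInstance.maxHeartbeats 200000 in
lemma IsInvariantPotential.leftDeriv₂_torus (hι : IsComplexification (E := E) (F := F) ι)
    (x v w : X) : leftDeriv₂ F K (imagExp F ι (e x)) (Complex.I • modelDeriv E F ι (e v))
      (Complex.I • modelDeriv E F ι (e w)) = hessianForm Kt x v w := by
  have h1 : fderiv ℝ Kt = fun x => (leftDeriv F K (imagExp F ι (e x))).comp
      ((Complex.I • modelDeriv E F ι).comp e) :=
    funext fun x => (h.leftDeriv_torus hT hι x).fderiv
  have h2 := (HasLogDerivAt.hasFDerivAt_leftDeriv h.smooth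
    (hasLogDerivAt_imagExp_torus hι hT x)).clm_comp
      (hasFDerivAt_const ((Complex.I • modelDeriv E F ι).comp e) x)
  rw [hessianForm, h1, h2.fderiv]
  simp

/-- Of the two terms of the Levi form only one survives: multiplying `i v` by `i` gives a direction
in `𝔤`, along which `K` does not change. -/
lemma IsInvariantPotential.leftLevi_torus (hι : IsComplexification (E := E) (F := F) ι)
    (x v w : X) : leftLevi K (imagExp F ι (e x)) (Complex.I • modelDeriv E F ι (e v))
      (Complex.I • modelDeriv E F ι (e w)) = hessianForm Kt x v w := by
  rw [leftLevi, h.leftDeriv₂_torus hT hι, smul_smul, smul_smul, Complex.I_mul_I, neg_one_smul,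
    neg_one_smul, map_neg, h.leftDeriv₂_real hι, neg_zero, add_zero]

/-- The first argument is an arbitrary direction tangent to the double coset of `exp(i x)`; left and
right invariance dispose of its two summands separately. -/
lemma IsInvariantPotential.leftLevi_orthogonal (hι : IsComplexification (E := E) (F := F) ι)
    (x v : X) (ζ₁ ζ₂ : E) : leftLevi K (imagExp F ι (e x))
      (groupAd (imagExp F ι (e x))⁻¹ (modelDeriv E F ι ζ₁) + modelDeriv E F ι ζ₂)
      (Complex.I • modelDeriv E F ι (e v)) = 0 := by
  have hvx : groupBracket G (e v) (e x) = 0 := hT.comm _ ⟨v, rfl⟩ _ ⟨x, rfl⟩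
  rw [leftLevi, smul_smul, Complex.I_mul_I, neg_one_smul, map_neg, h.leftDeriv₂_real hι, map_add,
    add_apply, h.leftDeriv₂_groupAd_inv_real hι, h.leftDeriv₂_real_imag hι hvx]
  simp

/-- After moving to `exp(i x)`, `θ` is an orthogonal sum of a direction tangent to the double coset
and of `i η`; dropping the nonnegative first part leaves the Hessian. -/
lemma IsInvariantPotential.hessianForm_le_leftLevi (hι : IsComplexification (E := E) (F := F) ι)
    (hpos : ∀ p Z, 0 ≤ leftLevi (F := F) K p Z Z)
    (hsymm : ∀ p Z W, leftLevi (F := F) K p Z W = leftLevi K p W Z)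
    {p : M} {a b : G} {x η : X} {ζ₁ ζ₂ : E} {θ : F} (hp : p = ι a * imagExp F ι (e x) * ι b)
    (hθ : groupAd (ι b) θ = groupAd (imagExp F ι (e x))⁻¹ (modelDeriv E F ι ζ₁) +
      Complex.I • modelDeriv E F ι (e η) + modelDeriv E F ι ζ₂) :
    hessianForm Kt x η η ≤ leftLevi K p θ θ := by
  have h1 : leftLevi K p θ θ =
      leftLevi K (imagExp F ι (e x)) (groupAd (ι b) θ) (groupAd (ι b) θ) := by
    rw [hp, leftLevi, leftLevi, mul_assoc, h.leftDeriv₂_left, h.leftDeriv₂_right,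
      h.leftDeriv₂_right, groupAd_I_smul]
  have hadd (Z Z' W : F) : leftLevi K (imagExp F ι (e x)) (Z + Z') W =
      leftLevi K (imagExp F ι (e x)) Z W + leftLevi K (imagExp F ι (e x)) Z' W := by
    simp only [leftLevi, smul_add, map_add, add_apply]
    ring
  set U := groupAd (imagExp F ι (e x))⁻¹ (modelDeriv E F ι ζ₁) + modelDeriv E F ι ζ₂ with hU
  set W := Complex.I • modelDeriv E F ι (e η) with hW
  have hUW : leftLevi K (imagExp F ι (e x)) U W = 0 := h.leftLevi_orthogonal hT hι x η ζ₁ ζ₂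
  have hθ' : groupAd (ι b) θ = U + W := by rw [hθ, hU]; abel
  have h2 : leftLevi K (imagExp F ι (e x)) (U + W) (U + W) =
      leftLevi K (imagExp F ι (e x)) U U + hessianForm Kt x η η := by
    have hWW : leftLevi K (imagExp F ι (e x)) W W = hessianForm Kt x η η :=
      h.leftLevi_torus hT hι x η η
    rw [hadd U W (U + W), hsymm _ U (U + W), hsymm _ W (U + W), hadd U W U, hadd U W W,
      hsymm _ W U, hUW, hWW]
    ring
  rw [h1, hθ', h2]
  linarith [hpos (imagExp F ι (e x)) U]

end InvariantPotential

/-! ### The distance of a Riemannian metric -/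

section MetricDist

variable {E : Type*} [NormedAddCommGroup E] [NormedSpace ℝ E]
  {M : Type*} [TopologicalSpace M] [ChartedSpace E M] [IsManifold 𝓘(ℝ, E) ∞ M]
  (g : ContMDiffRiemannianMetric 𝓘(ℝ, E) ∞ E (fun p : M => TangentSpace 𝓘(ℝ, E) p))

/-- The Riemannian distance of the metric `g`. -/
def metricEDist (x y : M) : ENNReal :=
  letI : RiemannianBundle (fun p : M => TangentSpace 𝓘(ℝ, E) p) := ⟨g.toRiemannianMetric⟩
  riemannianEDist 𝓘(ℝ, E) x y

/-- The velocity of a curve. -/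
def velocity (E : Type*) [NormedAddCommGroup E] [NormedSpace ℝ E] [ChartedSpace E M] (γ : ℝ → M)
    (t : ℝ) : E :=
  mfderiv 𝓘(ℝ, ℝ) 𝓘(ℝ, E) γ t (1 : ℝ)

/-- The speed of a curve. -/
def metricSpeed (γ : ℝ → M) (t : ℝ) : ℝ := √(g.inner (γ t) (velocity E γ t) (velocity E γ t))

lemma metricSpeed_nonneg (γ : ℝ → M) (t : ℝ) : 0 ≤ metricSpeed g γ t := Real.sqrt_nonneg _

lemma riemannianMetricComplete_iff : RiemannianMetricComplete g ↔ ∀ u : ℕ → M,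
    (∀ ε : ENNReal, 0 < ε → ∃ N, ∀ m ≥ N, ∀ k ≥ N, metricEDist g (u m) (u k) < ε) →
    ∃ p, Tendsto u atTop (𝓝 p) := Iff.rfl

lemma metricEDist_self (x : M) : metricEDist g x x = 0 :=
  letI : RiemannianBundle (fun p : M => TangentSpace 𝓘(ℝ, E) p) := ⟨g.toRiemannianMetric⟩
  riemannianEDist_self

lemma metricEDist_comm (x y : M) : metricEDist g x y = metricEDist g y x :=
  letI : RiemannianBundle (fun p : M => TangentSpace 𝓘(ℝ, E) p) := ⟨g.toRiemannianMetric⟩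
  riemannianEDist_comm

lemma metricEDist_triangle (x y z : M) :
    metricEDist g x z ≤ metricEDist g x y + metricEDist g y z :=
  letI : RiemannianBundle (fun p : M => TangentSpace 𝓘(ℝ, E) p) := ⟨g.toRiemannianMetric⟩
  riemannianEDist_triangle

lemma pathELength_eq_lintegral_metricSpeed (γ : ℝ → M) (a b : ℝ) :
    letI : RiemannianBundle (fun p : M => TangentSpace 𝓘(ℝ, E) p) := ⟨g.toRiemannianMetric⟩
    pathELength 𝓘(ℝ, E) γ a b = ∫⁻ t in Icc a b, ENNReal.ofReal (metricSpeed g γ t) := by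
  let : RiemannianBundle (fun p : M => TangentSpace 𝓘(ℝ, E) p) := ⟨g.toRiemannianMetric⟩
  refine pathELength_eq_lintegral_mfderiv_Icc.trans ?_
  congr 1
  funext t
  rw [← ofReal_norm, norm_eq_sqrt_real_inner]
  rfl

lemma metricEDist_le {γ : ℝ → M} {a b : ℝ} (hγ : ContMDiffOn 𝓘(ℝ, ℝ) 𝓘(ℝ, E) 1 γ (Icc a b))
    (hab : a ≤ b) :
    metricEDist g (γ a) (γ b) ≤ ∫⁻ t in Icc a b, ENNReal.ofReal (metricSpeed g γ t) := by
  let : RiemannianBundle (fun p : M => TangentSpace 𝓘(ℝ, E) p) := ⟨g.toRiemannianMetric⟩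
  rw [← pathELength_eq_lintegral_metricSpeed]
  exact riemannianEDist_le_pathELength hγ rfl rfl hab

lemma exists_of_metricEDist_lt {x y : M} {r : ENNReal} (h : metricEDist g x y < r) :
    ∃ γ : ℝ → M, γ 0 = x ∧ γ 1 = y ∧ ContMDiff 𝓘(ℝ, ℝ) 𝓘(ℝ, E) 1 γ ∧
      ∫⁻ t in Icc (0 : ℝ) 1, ENNReal.ofReal (metricSpeed g γ t) < r := by
  let : RiemannianBundle (fun p : M => TangentSpace 𝓘(ℝ, E) p) := ⟨g.toRiemannianMetric⟩
  obtain ⟨γ, h0, h1, hγ, hl, -⟩ := exists_lt_locally_constant_of_riemannianEDist_lt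
    (I := 𝓘(ℝ, E)) h zero_lt_one
  refine ⟨γ, h0, h1, hγ, ?_⟩
  rwa [← pathELength_eq_lintegral_metricSpeed]

lemma eventually_metricEDist_lt (x : M) {c : ENNReal} (hc : 0 < c) :
    ∀ᶠ y in 𝓝 x, metricEDist g x y < c :=
  letI : RiemannianBundle (fun p : M => TangentSpace 𝓘(ℝ, E) p) := ⟨g.toRiemannianMetric⟩
  haveI : IsContinuousRiemannianBundle E (fun p : M => TangentSpace 𝓘(ℝ, E) p) :=
    ⟨⟨g.inner, g.contMDiff.continuous, fun _ _ _ => rfl⟩⟩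
  haveI : IsManifold 𝓘(ℝ, E) 1 M := IsManifold.of_le (n := ∞) (by exact_mod_cast le_top)
  eventually_riemannianEDist_lt 𝓘(ℝ, E) x hc

lemma exists_metricEDist_lt_subset [RegularSpace M] {x : M} {s : Set M} (hs : s ∈ 𝓝 x) :
    ∃ c > 0, {y | metricEDist g x y < c} ⊆ s :=
  letI : RiemannianBundle (fun p : M => TangentSpace 𝓘(ℝ, E) p) := ⟨g.toRiemannianMetric⟩
  haveI : IsContinuousRiemannianBundle E (fun p : M => TangentSpace 𝓘(ℝ, E) p) :=
    ⟨⟨g.inner, g.contMDiff.continuous, fun _ _ _ => rfl⟩⟩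
  haveI : IsManifold 𝓘(ℝ, E) 1 M := IsManifold.of_le (n := ∞) (by exact_mod_cast le_top)
  setOfPred_riemannianEDist_lt_subset_nhds' 𝓘(ℝ, E) hs

lemma continuous_metricSpeed {γ : ℝ → M} (hγ : ContMDiff 𝓘(ℝ, ℝ) 𝓘(ℝ, E) 1 γ) :
    Continuous (metricSpeed g γ) := by
  let : RiemannianBundle (fun p : M => TangentSpace 𝓘(ℝ, E) p) := ⟨g.toRiemannianMetric⟩
  have : IsContinuousRiemannianBundle E (fun p : M => TangentSpace 𝓘(ℝ, E) p) :=
    ⟨⟨g.inner, g.contMDiff.continuous, fun _ _ _ => rfl⟩⟩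
  have : IsManifold 𝓘(ℝ, E) 1 M := IsManifold.of_le (n := ∞) (by exact_mod_cast le_top)
  have h1 : Continuous fun t : ℝ => (⟨γ t, mfderiv 𝓘(ℝ, ℝ) 𝓘(ℝ, E) γ t (1 : ℝ)⟩ :
      TotalSpace E (fun p : M => TangentSpace 𝓘(ℝ, E) p)) := by
    have h2 := hγ.continuous_tangentMap le_rfl
    have h3 : Continuous fun t : ℝ => (⟨t, (1 : ℝ)⟩ : TangentBundle 𝓘(ℝ, ℝ) ℝ) := by
      have h4 : Continuous fun t : ℝ => ((t, (1 : ℝ)) : ModelProd ℝ ℝ) :=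
        (continuous_id.prodMk continuous_const : Continuous fun t : ℝ => (t, (1 : ℝ)))
      exact (tangentBundleModelSpaceHomeomorph 𝓘(ℝ, ℝ)).symm.continuous.comp h4
    exact h2.comp h3
  exact Real.continuous_sqrt.comp (Continuous.inner_bundle h1 h1)

/-- A Cauchy sequence for a Riemannian distance converges to any of its cluster points. -/
lemma tendsto_of_mapClusterPt [RegularSpace M] {u : ℕ → M}
    (hu : ∀ ε : ENNReal, 0 < ε → ∃ N, ∀ m ≥ N, ∀ k ≥ N, metricEDist g (u m) (u k) < ε) {p : M}
    (hp : MapClusterPt p atTop u) : Tendsto u atTop (𝓝 p) := by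
  rw [tendsto_def]
  intro s hs
  obtain ⟨c, hc, hcs⟩ := exists_metricEDist_lt_subset g hs
  have hc2 : 0 < c / 2 := ENNReal.half_pos hc.ne'
  obtain ⟨N, hN⟩ := hu _ hc2
  obtain ⟨k, hk, hkN⟩ := ((hp.frequently (eventually_metricEDist_lt g p hc2)).and_eventually
    (eventually_ge_atTop N)).exists
  filter_upwards [eventually_ge_atTop N] with m hm
  refine hcs ?_
  calc metricEDist g p (u m) ≤ metricEDist g p (u k) + metricEDist g (u k) (u m) :=
        metricEDist_triangle g _ _ _
    _ < c / 2 + c / 2 := ENNReal.add_lt_add hk (hN k hkN m hm)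
    _ = c := ENNReal.add_halves c

end MetricDist

/-! ### The Hessian metric on `𝔥` -/

section HessianMetric

variable {X : Type*} [NormedAddCommGroup X] [NormedSpace ℝ X] {f : X → ℝ}

lemma hasMFDerivAt_of_velocity {E : Type*} [NormedAddCommGroup E] [NormedSpace ℝ E]
    {M : Type*} [TopologicalSpace M] [ChartedSpace E M] {γ : ℝ → M} {t : ℝ} {L : ℝ →L[ℝ] E}
    (h : HasMFDerivAt 𝓘(ℝ, ℝ) 𝓘(ℝ, E) γ t L) : velocity E γ t = L 1 :=
  congrArg (fun L : ℝ →L[ℝ] E => L 1) h.mfderiv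

lemma velocity_of_hasDerivAt {σ : ℝ → X} {w : X} {t : ℝ} (h : HasDerivAt σ w t) :
    velocity X σ t = w := by
  rw [hasMFDerivAt_of_velocity h.hasFDerivAt.hasMFDerivAt]
  simp

lemma ContDiff.continuous_hessianForm (hf : ContDiff ℝ ∞ f) :
    Continuous fun z : X × X => hessianForm f z.1 z.2 z.2 := by
  have h1 : Continuous (fderiv ℝ (fderiv ℝ f)) :=
    ((hf.fderiv_right (m := ∞) (by simp)).fderiv_right (m := ∞) (by simp)).continuous
  exact ((h1.comp continuous_fst).clm_apply continuous_snd).clm_apply continuous_snd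

lemma hessianForm_smul (x v : X) (a : ℝ) :
    hessianForm f x (a • v) (a • v) = a ^ 2 * hessianForm f x v v := by
  simp only [hessianForm, map_smul, smul_apply, smul_eq_mul]
  ring

variable (q : ContMDiffRiemannianMetric 𝓘(ℝ, X) ∞ X (fun x : X => TangentSpace 𝓘(ℝ, X) x))
  (hq : ∀ x v w : X, q.inner x v w = hessianForm f x v w) (hf : ContDiff ℝ ∞ f)

include hq in
lemma metricSpeed_eq_sqrt_hessianForm (σ : ℝ → X) (t : ℝ) :
    metricSpeed q σ t = √(hessianForm f (σ t) (velocity X σ t) (velocity X σ t)) := by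
  rw [metricSpeed, ← hq]

include hq hf in
-- Compare with the straight segment from `y s₀` to `y s`, whose velocity is `s - s₀` times a slope
-- tending to `η`. Only the derivative at `s₀` enters, so the estimate applies to curves that may be
-- discontinuous elsewhere.
lemma eventually_metricEDist_le_of_hasDerivAt {y : ℝ → X} {η : X} {s₀ : ℝ}
    (hy : HasDerivAt y η s₀) {ε : ℝ} (hε : 0 < ε) :
    ∀ᶠ s in 𝓝[>] s₀, metricEDist q (y s₀) (y s) ≤
      ENNReal.ofReal ((s - s₀) * (√(hessianForm f (y s₀) η η) + ε)) := by
  have hN : ContinuousAt (fun z : X × X => √(hessianForm f z.1 z.2 z.2)) (y s₀, η) :=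
    (Real.continuous_sqrt.comp hf.continuous_hessianForm).continuousAt
  have hlt := hN.eventually (gt_mem_nhds (show √(hessianForm f (y s₀) η η) <
    √(hessianForm f (y s₀) η η) + ε by linarith))
  rw [nhds_prod_eq] at hlt
  obtain ⟨P, hP, Q, hQ, hPQ⟩ := eventually_prod_iff.1 hlt
  obtain ⟨δ, hδ, hball⟩ := Metric.eventually_nhds_iff_ball.1 hP
  have h1 : ∀ᶠ s in 𝓝[>] s₀, y s ∈ Metric.ball (y s₀) δ :=
    (hy.continuousAt.eventually (Metric.ball_mem_nhds _ hδ)).filter_mono nhdsWithin_le_nhds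
  have h2 : ∀ᶠ s in 𝓝[>] s₀, Q (slope y s₀ s) :=
    ((hasDerivAt_iff_tendsto_slope.1 hy).mono_left
      (nhdsWithin_mono _ fun s hs => ne_of_gt hs)).eventually hQ
  filter_upwards [h1, h2, self_mem_nhdsWithin] with s hs1 hs2 hs3
  have hs0 : 0 < s - s₀ := sub_pos.2 hs3
  set v := slope y s₀ s with hv
  set σ : ℝ → X := fun t => y s₀ + t • (y s - y s₀) with hσ
  have hvw : y s - y s₀ = (s - s₀) • v := (sub_smul_slope y s₀ s).symm
  have hσd (t : ℝ) : HasDerivAt σ (y s - y s₀) t := by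
    simpa [hσ] using ((hasDerivAt_id t).smul_const (y s - y s₀)).const_add (y s₀)
  have hσc : ContDiff ℝ 1 σ := by fun_prop
  have hle := metricEDist_le q (γ := σ) (a := 0) (b := 1)
    (contMDiff_iff_contDiff.2 hσc).contMDiffOn zero_le_one
  have e0 : σ 0 = y s₀ := by simp [hσ]
  have e1 : σ 1 = y s := by simp [hσ]
  rw [e0, e1] at hle
  refine hle.trans ?_
  calc _ ≤ ∫⁻ _ in Icc (0 : ℝ) 1, ENNReal.ofReal
        ((s - s₀) * (√(hessianForm f (y s₀) η η) + ε)) := by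
        refine MeasureTheory.setLIntegral_mono' measurableSet_Icc fun t ht => ?_
        refine ENNReal.ofReal_le_ofReal ?_
        have hσt : σ t ∈ Metric.ball (y s₀) δ := by
          rw [mem_ball_iff_norm] at hs1 ⊢
          simp only [hσ, add_sub_cancel_left]
          rw [norm_smul, Real.norm_of_nonneg ht.1]
          exact (mul_le_of_le_one_left (norm_nonneg _) ht.2).trans_lt hs1
        have hb : √(hessianForm f (σ t) v v) < √(hessianForm f (y s₀) η η) + ε :=
          hPQ (hball _ hσt) hs2
        rw [metricSpeed_eq_sqrt_hessianForm q hq, velocity_of_hasDerivAt (hσd t), hvw,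
          hessianForm_smul, Real.sqrt_mul (sq_nonneg _), Real.sqrt_sq hs0.le]
        exact mul_le_mul_of_nonneg_left hb.le hs0.le
    _ = _ := by simp

lemma isVonNBounded_of_pos [FiniteDimensional ℝ X] {Q : X →L[ℝ] X →L[ℝ] ℝ}
    (hQ : ∀ v, v ≠ 0 → 0 < Q v v) : Bornology.IsVonNBounded ℝ {v : X | Q v v < 1} := by
  obtain ⟨m, hm, hmQ⟩ := exists_pos_mul_sq_le hQ
  refine (NormedSpace.isVonNBounded_closedBall ℝ X (√(1 / m))).subset fun v hv => ?_
  rw [mem_closedBall_zero_iff]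
  refine Real.le_sqrt_of_sq_le ?_
  rw [le_div_iff₀ hm, mul_comm]
  exact (hmQ v).trans (le_of_lt hv)

/-- The bundle of bilinear forms on a normed space is trivialized by the identity. -/
lemma trivializationAt_bilinear_model_space (H : X → X →L[ℝ] X →L[ℝ] ℝ) (x : X) :
    (fun y : X => (trivializationAt (X →L[ℝ] X →L[ℝ] ℝ) (fun b : X =>
      TangentSpace 𝓘(ℝ, X) b →L[ℝ] TangentSpace 𝓘(ℝ, X) b →L[ℝ] ℝ) x ⟨y, H y⟩).2) = H := by
  funext y
  refine ContinuousLinearMap.ext fun v => ContinuousLinearMap.ext fun w => ?_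
  have e1 (v : X) : (trivializationAt X (TangentSpace 𝓘(ℝ, X)) x).symmL ℝ y v = v :=
    congrArg (fun L : X →L[ℝ] X => L v) (TangentBundle.symmL_model_space x y)
  have hy : y ∈ (trivializationAt (X →L[ℝ] ℝ)
      (fun b : X => TangentSpace 𝓘(ℝ, X) b →L[ℝ] ℝ) x).baseSet := by
    simpa using! mem_univ y
  have e2 (ψ : X →L[ℝ] ℝ) : ((trivializationAt (X →L[ℝ] ℝ)
      (fun b : X => TangentSpace 𝓘(ℝ, X) b →L[ℝ] ℝ) x).linearMapAt ℝ y ψ) w = ψ w := by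
    rw [Trivialization.coe_linearMapAt_of_mem _ hy]
    refine Eq.trans ?_ (congrArg ψ (e1 w))
    exact congrArg
      (fun L : ℝ →L[ℝ] ℝ => L (ψ ((trivializationAt X (TangentSpace 𝓘(ℝ, X)) x).symmL ℝ y w)))
      (Bundle.Trivial.continuousLinearMapAt_trivialization ℝ X ℝ y)
  exact (e2 _).trans (congrArg (fun v => H y v w) (e1 v))

/-- The Riemannian metric given by a positive definite Hessian. -/
def hessianMetric [FiniteDimensional ℝ X] (f : X → ℝ) (hf : ContDiff ℝ ∞ f)
    (hpos : ∀ x v : X, v ≠ 0 → 0 < hessianForm f x v v) :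
    ContMDiffRiemannianMetric 𝓘(ℝ, X) ∞ X (fun x : X => TangentSpace 𝓘(ℝ, X) x) where
  inner x := (fderiv ℝ (fderiv ℝ f) x : X →L[ℝ] X →L[ℝ] ℝ)
  symm x v w := ((hf.contDiffAt (x := x)).isSymmSndFDerivAt
    (by simpa using! ENat.LEInfty.out)) v w
  pos x v hv := hpos x v hv
  isVonNBounded x := by
    change Bornology.IsVonNBounded ℝ {v : X | fderiv ℝ (fderiv ℝ f) x v v < 1}
    exact isVonNBounded_of_pos (Q := fderiv ℝ (fderiv ℝ f) x) (hpos x)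
  contMDiff := by
    have h1 : ContDiff ℝ ∞ (fderiv ℝ (fderiv ℝ f)) :=
      (hf.fderiv_right (m := ∞) (by simp)).fderiv_right (m := ∞) (by simp)
    intro x
    refine (contMDiffAt_section x).2 ?_
    exact (trivializationAt_bilinear_model_space _ x).symm ▸ (contMDiff_iff_contDiff.2 h1).contMDiffAt

end HessianMetric

section HessianMatrix

variable {n : ℕ} {f : EuclideanSpace ℝ (Fin n) → ℝ}

lemma sum_hessianMatrix (x v w : EuclideanSpace ℝ (Fin n)) :
    ∑ i, ∑ j, hessianMatrix f x i j * (v i * w j) = hessianForm f x v w := by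
  have hdec (v : EuclideanSpace ℝ (Fin n)) :
      v = ∑ i, v i • EuclideanSpace.single i (1 : ℝ) := by
    ext j
    simp [Pi.single_apply]
  conv_rhs => rw [hdec v, hdec w]
  simp only [hessianForm, hessianMatrix, Matrix.of_apply, map_sum, map_smul, sum_apply, smul_apply,
    smul_eq_mul, Finset.mul_sum]
  rw [Finset.sum_comm]
  refine Finset.sum_congr rfl fun i _ => Finset.sum_congr rfl fun j _ => by ring

end HessianMatrix

/-! ### Velocities as left translates -/

section LeftTrans

variable {F : Type*} [NormedAddCommGroup F] [NormedSpace ℝ F]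
  {M : Type*} [TopologicalSpace M] [ChartedSpace F M] [Group M] [LieGroup 𝓘(ℝ, F) ∞ M]
  [IsTopologicalGroup M]

lemma injective_leftTrans (p : M) : Function.Injective (leftTrans (E := F) p) := by
  have h := leftTrans_mul (hasMFDerivAt_const_mul (E := F) p⁻¹ p)
  rw [inv_mul_cancel, leftTrans_one] at h
  refine Function.LeftInverse.injective fun v => (congrArg (fun L : F →L[ℝ] F => L v) h).symm

lemma exists_hasLogDerivAt_of_mdifferentiableAt [FiniteDimensional ℝ F] {γ : ℝ → M} {t : ℝ}
    (h : MDifferentiableAt 𝓘(ℝ, ℝ) 𝓘(ℝ, F) γ t) : ∃ θ : F,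
      HasLogDerivAt (E := F) γ (ContinuousLinearMap.toSpanSingleton ℝ θ) t ∧
        velocity F γ t = leftTrans (γ t) θ := by
  have hs : Function.Surjective (leftTrans (E := F) (γ t)) :=
    (LinearMap.injective_iff_surjective
      (f := ((leftTrans (E := F) (γ t) : F →L[ℝ] F) : F →ₗ[ℝ] F))).1 (injective_leftTrans (γ t))
  obtain ⟨θ, hθ⟩ := hs (velocity F γ t)
  refine ⟨θ, HasLogDerivAt.of_leftTrans (h.hasMFDerivAt.congr_mfderiv ?_), hθ.symm⟩
  refine ContinuousLinearMap.ext_ring (R₁ := ℝ) (M₁ := F) ?_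
  simpa using! hθ.symm

end LeftTrans

/-! ### Comparison of distances in `𝔥` and in `Gᶜ` -/

section Completeness

variable {E : Type*} [NormedAddCommGroup E] [NormedSpace ℝ E] [FiniteDimensional ℝ E]
  [CompleteSpace E]
  {G : Type*} [TopologicalSpace G] [ChartedSpace E G] [Group G]
  [LieGroup 𝓘(ℝ, E) ∞ G] [IsTopologicalGroup G] [T2Space G]
  {F : Type*} [NormedAddCommGroup F] [NormedSpace ℂ F] [FiniteDimensional ℂ F] [CompleteSpace F]
  {M : Type*} [TopologicalSpace M] [ChartedSpace F M] [Group M] [LieGroup 𝓘(ℂ, F) ω M]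
  [IsTopologicalGroup M] [T2Space M] {ι : G →* M} {B : E →L[ℝ] E →L[ℝ] ℝ}
  {X : Type*} [NormedAddCommGroup X] [InnerProductSpace ℝ X] {e : X →L[ℝ] E}
  {K : M → ℝ} {Kt : X → ℝ} {c : ℝ}
  {g : ContMDiffRiemannianMetric 𝓘(ℝ, F) ∞ F (fun p : M => TangentSpace 𝓘(ℝ, F) p)}
  {q : ContMDiffRiemannianMetric 𝓘(ℝ, X) ∞ X (fun x : X => TangentSpace 𝓘(ℝ, X) x)}

lemma leftLevi_eq (hc : 0 < c) (hK : ContMDiff 𝓘(ℝ, F) 𝓘(ℝ, ℝ) ∞ K)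
    (hg : ∀ (p : M) (v w : F), g.inner p v w = c * leviForm K p v w) (p : M) (Z W : F) :
    leftLevi K p Z W = g.inner p (leftTrans (E := F) p Z) (leftTrans (E := F) p W) / c := by
  rw [hg, leviForm_leftTrans hK, mul_div_cancel_left₀ _ hc.ne']

lemma leftLevi_symm (hc : 0 < c) (hK : ContMDiff 𝓘(ℝ, F) 𝓘(ℝ, ℝ) ∞ K)
    (hg : ∀ (p : M) (v w : F), g.inner p v w = c * leviForm K p v w) (p : M) (Z W : F) :
    leftLevi K p Z W = leftLevi K p W Z := by
  rw [leftLevi_eq hc hK hg, leftLevi_eq hc hK hg]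
  exact congrArg (· / c) (g.symm p _ _)

lemma leftLevi_pos (hc : 0 < c) (hK : ContMDiff 𝓘(ℝ, F) 𝓘(ℝ, ℝ) ∞ K)
    (hg : ∀ (p : M) (v w : F), g.inner p v w = c * leviForm K p v w) (p : M) {Z : F} (hZ : Z ≠ 0) :
    0 < leftLevi K p Z Z := by
  rw [leftLevi_eq hc hK hg]
  refine div_pos (g.pos p _ fun h0 => hZ ?_) hc
  exact (injective_leftTrans p) (h0.trans (map_zero (leftTrans (E := F) p)).symm)

lemma leftLevi_nonneg (hc : 0 < c) (hK : ContMDiff 𝓘(ℝ, F) 𝓘(ℝ, ℝ) ∞ K)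
    (hg : ∀ (p : M) (v w : F), g.inner p v w = c * leviForm K p v w) (p : M) (Z : F) :
    0 ≤ leftLevi K p Z Z := by
  by_cases hZ : Z = 0
  · simp [hZ, leftLevi]
  · exact (leftLevi_pos hc hK hg p hZ).le

lemma metricSpeed_eq_sqrt_leftLevi (hK : ContMDiff 𝓘(ℝ, F) 𝓘(ℝ, ℝ) ∞ K)
    (hg : ∀ (p : M) (v w : F), g.inner p v w = c * leviForm K p v w) {γ : ℝ → M} {t : ℝ} {θ : F}
    (hγ : velocity F γ t = leftTrans (γ t) θ) :
    metricSpeed g γ t = √(c * leftLevi K (γ t) θ θ) := by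
  rw [metricSpeed, hγ, hg, leviForm_leftTrans hK]

/-- The Hessian is the restriction of a positive definite Levi form to `i 𝔥`. -/
lemma hessianForm_pos (hι : IsComplexification (E := E) (F := F) ι)
    (hT : IsMaximalAbelian G (LinearMap.range (e : X →ₗ[ℝ] E))) (he : Function.Injective e)
    (h : IsInvariantPotential (F := F) ι e K Kt) (hc : 0 < c)
    (hg : ∀ (p : M) (v w : F), g.inner p v w = c * leviForm K p v w) (x : X) {v : X} (hv : v ≠ 0) :
    0 < hessianForm Kt x v v := by
  rw [← h.leftLevi_torus hT hι]
  refine leftLevi_pos hc h.smooth hg _ fun h0 => hv ?_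
  have h1 : realFormEquiv hι (0, e v) = 0 := by
    rw [realFormEquiv_apply]; simpa using h0
  have h2 := (Prod.ext_iff.1 ((map_eq_zero_iff _ (realFormEquiv hι).injective).1 h1)).2
  exact (map_eq_zero_iff e he).1 h2

lemma metricSpeed_torus (hι : IsComplexification (E := E) (F := F) ι)
    (hT : IsMaximalAbelian G (LinearMap.range (e : X →ₗ[ℝ] E)))
    (h : IsInvariantPotential (F := F) ι e K Kt)
    (hg : ∀ (p : M) (v w : F), g.inner p v w = c * leviForm K p v w) {σ : ℝ → X} {w : X} {t : ℝ}
    (hσ : HasDerivAt σ w t) :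
    metricSpeed g (fun t => imagExp F ι (e (σ t))) t = √(c * hessianForm Kt (σ t) w w) := by
  have h1 := HasLogDerivAt.comp (f := fun x : X => imagExp F ι (e x)) (g := σ)
    (hasLogDerivAt_imagExp_torus hι hT (σ t)) hσ.hasFDerivAt
  have h2 : velocity F (fun t => imagExp F ι (e (σ t))) t =
      leftTrans (imagExp F ι (e (σ t))) (Complex.I • modelDeriv E F ι (e w)) := by
    rw [hasMFDerivAt_of_velocity h1.hasMFDerivAt]
    simp
  rw [metricSpeed_eq_sqrt_leftLevi h.smooth hg h2, h.leftLevi_torus hT hι]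

/-- `x ↦ exp(i x)` multiplies the length of every path by exactly `√c`. -/
lemma metricEDist_torus_le (hι : IsComplexification (E := E) (F := F) ι)
    (hT : IsMaximalAbelian G (LinearMap.range (e : X →ₗ[ℝ] E)))
    (h : IsInvariantPotential (F := F) ι e K Kt) (hc : 0 < c)
    (hg : ∀ (p : M) (v w : F), g.inner p v w = c * leviForm K p v w)
    (hq : ∀ x v w : X, q.inner x v w = hessianForm Kt x v w) {x y : X} {r : ENNReal}
    (hr : metricEDist q x y < r) :
    metricEDist g (imagExp F ι (e x)) (imagExp F ι (e y)) ≤ ENNReal.ofReal √c * r := by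
  obtain ⟨σ, rfl, rfl, hσ, hlen⟩ := exists_of_metricEDist_lt q hr
  have hΦ : ContMDiff 𝓘(ℝ, ℝ) 𝓘(ℝ, F) 1 (fun t => imagExp F ι (e (σ t))) :=
    (contMDiff_imagExp_torus hι hT).comp hσ
  refine (metricEDist_le g (γ := fun t => imagExp F ι (e (σ t))) hΦ.contMDiffOn
    zero_le_one).trans ?_
  refine le_trans ?_ (mul_le_mul_right hlen.le _)
  rw [← MeasureTheory.lintegral_const_mul' _ _ ENNReal.ofReal_ne_top]
  refine MeasureTheory.lintegral_mono fun t => ?_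
  have hd : HasDerivAt σ (deriv σ t) t :=
    (((contMDiff_iff_contDiff.1 hσ).differentiable (by simp)) t).hasDerivAt
  rw [metricSpeed_torus hι hT h hg hd, metricSpeed_eq_sqrt_hessianForm q hq,
    velocity_of_hasDerivAt hd, Real.sqrt_mul hc.le, ENNReal.ofReal_mul (Real.sqrt_nonneg c)]

variable [CompactSpace G] [FiniteDimensional ℝ X]

/-- If points of the double cosets of `exp(i y_k)` converge, then the `y_k` accumulate. -/
lemma exists_mapClusterPt_torus (hι : IsComplexification (E := E) (F := F) ι)
    (hB : IsInvariantForm G B) (hZ : ∀ v : E, (∀ w, groupBracket G v w = 0) → v = 0)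
    (hT : IsMaximalAbelian G (LinearMap.range (e : X →ₗ[ℝ] E)))
    (he : ∀ x y : X, B (e x) (e y) = inner ℝ x y) {u : ℕ → M} {p : M}
    (hu : Tendsto u atTop (𝓝 p)) {y : ℕ → X} (hy : ∀ k, u k ∈ torusCoset F ι e (y k)) :
    ∃ x, p ∈ torusCoset F ι e x ∧ MapClusterPt x atTop y := by
  choose a b hab using hy
  have hf : MapClusterPt p (map (fun k => (a k, y k, b k)) atTop) (cartanMap F ι e) := by
    rw [MapClusterPt, Filter.map_map]
    refine (Tendsto.mapClusterPt (u := u) hu).congrFun ?_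
    exact Eventually.of_forall fun k => hab k
  obtain ⟨⟨a₀, x, b₀⟩, hx, hcl⟩ :=
    (isProperMap_cartanMap hι hB hZ hT he).clusterPt_of_mapClusterPt hf
  refine ⟨x, ⟨a₀, b₀, hx.symm⟩, ?_⟩
  have h2 : MapClusterPt (a₀, x, b₀) atTop (fun k => (a k, y k, b k)) := hcl
  exact h2.continuousAt_comp (f := fun z : G × X × G => z.2.1) continuous_snd.fst.continuousAt

/-- Distances in `𝔥` do not exceed distances between double cosets. -/
lemma exists_metricEDist_torus_le (hι : IsComplexification (E := E) (F := F) ι)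
    (hB : IsInvariantForm G B) (hZ : ∀ v : E, (∀ w, groupBracket G v w = 0) → v = 0)
    (hT : IsMaximalAbelian G (LinearMap.range (e : X →ₗ[ℝ] E)))
    (he : ∀ x y : X, B (e x) (e y) = inner ℝ x y)
    (h : IsInvariantPotential (F := F) ι e K Kt) (hKt : ContDiff ℝ ∞ Kt) (hc : 0 < c)
    (hg : ∀ (p : M) (v w : F), g.inner p v w = c * leviForm K p v w)
    (hq : ∀ x v w : X, q.inner x v w = hessianForm Kt x v w) {p p' : M} {x : X} {r : ℝ}
    (hp : p ∈ torusCoset F ι e x) (hr : metricEDist g p p' < ENNReal.ofReal r) :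
    ∃ y, p' ∈ torusCoset F ι e y ∧ metricEDist q x y ≤ ENNReal.ofReal (r / √c) := by
  obtain ⟨γ, rfl, rfl, hγ, hlen⟩ := exists_of_metricEDist_lt g hr
  have hsc := continuous_metricSpeed g hγ
  have hc' : 0 < √c := Real.sqrt_pos.2 hc
  set S : ℝ → ℝ := fun s => ∫ t in (0 : ℝ)..s, metricSpeed g γ t with hS
  have hS0 : S 0 = 0 := by simp [hS]
  have hSnn (s : ℝ) (hs : 0 ≤ s) : 0 ≤ S s :=
    intervalIntegral.integral_nonneg hs fun t _ => metricSpeed_nonneg g γ t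
  have hSd (s : ℝ) : HasDerivAt S (metricSpeed g γ s) s :=
    (hsc.integral_hasStrictDerivAt 0 s).hasDerivAt
  have hS1 : S 1 < r := by
    rw [← MeasureTheory.ofReal_integral_eq_lintegral_ofReal
      (hsc.continuousOn.integrableOn_Icc) (Eventually.of_forall fun t => metricSpeed_nonneg g γ t),
      MeasureTheory.integral_Icc_eq_integral_Ioc,
      ← intervalIntegral.integral_of_le zero_le_one] at hlen
    exact (ENNReal.ofReal_lt_ofReal_iff'.1 hlen).1
  -- The length left over, `r - S 1`, is spread linearly over `[0, 1]`. The bound `b` then grows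
  -- strictly faster than the length divided by `√c`, and `b 1 = r / √c`.
  set ε := (r - S 1) / √c with hε
  have hεpos : 0 < ε := div_pos (by linarith) hc'
  set b : ℝ → ℝ := fun s => S s / √c + ε * s with hb
  have hb0 : b 0 = 0 := by simp [hb, hS0]
  have hb1 : b 1 = r / √c := by simp only [hb, hε]; field_simp; ring
  have hbd (s : ℝ) : HasDerivAt b (metricSpeed g γ s / √c + ε) s := by
    simpa [hb] using! ((hSd s).div_const √c).add ((hasDerivAt_id s).const_mul ε)
  -- Continuous induction on `[0, 1]`: `A` is closed, and from each of its times in `[0, 1)` a later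
  -- one is reached. No continuous choice of `y` is needed.
  set A : Set ℝ := {s | ∃ y, γ s ∈ torusCoset F ι e y ∧ metricEDist q x y ≤ ENNReal.ofReal (b s)}
    with hA
  -- The representatives for times tending to `s₀` have a cluster point by properness; the bound
  -- passes to it up to two errors `δ / 2`.
  have hAclosed : IsClosed A := by
    refine IsSeqClosed.isClosed fun s s₀ hs hlim => ?_
    choose y hy hyd using hs
    obtain ⟨y₀, hy₀, hcl⟩ := exists_mapClusterPt_torus hι hB hZ hT he
      ((hγ.continuous.tendsto s₀).comp hlim) hy
    refine ⟨y₀, hy₀, ENNReal.le_of_forall_pos_le_add fun δ hδ _ => ?_⟩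
    have hδ2 : (0 : ENNReal) < ENNReal.ofReal (δ / 2) := by
      rw [ENNReal.ofReal_pos]; exact half_pos hδ
    have hblim : ∀ᶠ k in atTop, b (s k) < b s₀ + δ / 2 :=
      (((hbd s₀).continuousAt.tendsto).comp hlim).eventually
        (gt_mem_nhds (by linarith [half_pos (NNReal.coe_pos.2 hδ)]))
    obtain ⟨k, hk1, hk2⟩ := ((hcl.frequently (eventually_metricEDist_lt q y₀ hδ2)).and_eventually
      hblim).exists
    calc metricEDist q x y₀ ≤ metricEDist q x (y k) + metricEDist q (y k) y₀ :=
          metricEDist_triangle q _ _ _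
      _ ≤ ENNReal.ofReal (b s₀ + δ / 2) + ENNReal.ofReal (δ / 2) := by
          refine add_le_add ((hyd k).trans (ENNReal.ofReal_le_ofReal hk2.le)) ?_
          rw [metricEDist_comm]; exact hk1.le
      _ ≤ (ENNReal.ofReal (b s₀) + ENNReal.ofReal (δ / 2)) + ENNReal.ofReal (δ / 2) := by
          gcongr; exact ENNReal.ofReal_add_le
      _ = ENNReal.ofReal (b s₀) + δ := by
          rw [add_assoc, ← ENNReal.ofReal_add (by positivity) (by positivity), add_halves]
          simp
  have hsub : Icc (0 : ℝ) 1 ⊆ A := by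
    refine (hAclosed.inter isClosed_Icc).Icc_subset_of_forall_exists_gt
      ⟨x, hp, by simp [metricEDist_self]⟩ ?_
    rintro s₀ ⟨⟨x₀, hx₀, hxd⟩, hs₀⟩ s₁ hs₁
    obtain ⟨θ, hθ, hvel⟩ := exists_hasLogDerivAt_of_mdifferentiableAt
      (hγ.mdifferentiable (by simp) s₀)
    obtain ⟨a', b', η, ζ₁, ζ₂, hab, hdec, y, hyd, hy0, hyc⟩ :=
      exists_torus_curve hι hB hT he hθ hx₀
    have hH : √(hessianForm Kt x₀ η η) ≤ metricSpeed g γ s₀ / √c := by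
      have h1 := h.hessianForm_le_leftLevi hT hι (leftLevi_nonneg hc h.smooth hg)
        (leftLevi_symm hc h.smooth hg) hab hdec
      rw [metricSpeed_eq_sqrt_leftLevi h.smooth hg hvel, Real.sqrt_mul hc.le,
        mul_div_cancel_left₀ _ hc'.ne']
      exact Real.sqrt_le_sqrt h1
    -- One half of `ε` pays for replacing `y` by its tangent at `s₀`, the other half for replacing
    -- `b` by its tangent.
    have h1 := eventually_metricEDist_le_of_hasDerivAt q hq hKt hyd (half_pos hεpos)
    rw [hy0] at h1
    have h2 : ∀ᶠ s in 𝓝[>] s₀, metricSpeed g γ s₀ / √c + ε / 2 < slope b s₀ s :=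
      ((hasDerivAt_iff_tendsto_slope.1 (hbd s₀)).mono_left
        (nhdsWithin_mono _ fun s hs => ne_of_gt hs)).eventually
          (lt_mem_nhds (by linarith))
    have h3 : ∀ᶠ s in 𝓝[>] s₀, s ∈ Ioc s₀ s₁ := Ioc_mem_nhdsGT hs₁
    obtain ⟨s, hs1, hs2, hs3, hs4⟩ :=
      (h1.and (h2.and (h3.and (hyc.filter_mono nhdsWithin_le_nhds)))).exists
    refine ⟨s, ⟨y s, hs4, ?_⟩, hs3⟩
    have hss : 0 < s - s₀ := sub_pos.2 hs3.1
    have hbb : (s - s₀) * (√(hessianForm Kt x₀ η η) + ε / 2) ≤ b s - b s₀ := by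
      have : (s - s₀) * slope b s₀ s = b s - b s₀ := by
        have := sub_smul_slope b s₀ s
        simpa using this
      rw [← this]
      exact mul_le_mul_of_nonneg_left (by linarith) hss.le
    have hb0' : 0 ≤ b s₀ :=
      add_nonneg (div_nonneg (hSnn s₀ hs₀.1) hc'.le) (mul_nonneg hεpos.le hs₀.1)
    calc metricEDist q x (y s) ≤ metricEDist q x x₀ + metricEDist q x₀ (y s) :=
          metricEDist_triangle q _ _ _
      _ ≤ ENNReal.ofReal (b s₀) + ENNReal.ofReal (b s - b s₀) :=
          add_le_add hxd (hs1.trans (ENNReal.ofReal_le_ofReal hbb))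
      _ = ENNReal.ofReal (b s) := by
          rw [← ENNReal.ofReal_add hb0' (le_trans (by positivity) hbb)]
          congr 1; ring
  obtain ⟨y, hy, hyd⟩ := hsub (right_mem_Icc.2 zero_le_one)
  exact ⟨y, hy, hb1 ▸ hyd⟩

end Completeness

/-! ### Transfer of completeness in both directions -/

section CompletenessEquivalence

variable {E : Type*} [NormedAddCommGroup E] [NormedSpace ℝ E] [FiniteDimensional ℝ E]
  [CompleteSpace E]
  {G : Type*} [TopologicalSpace G] [ChartedSpace E G] [Group G]
  [LieGroup 𝓘(ℝ, E) ∞ G] [IsTopologicalGroup G] [T2Space G] [CompactSpace G]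
  {F : Type*} [NormedAddCommGroup F] [NormedSpace ℂ F] [FiniteDimensional ℂ F] [CompleteSpace F]
  {M : Type*} [TopologicalSpace M] [ChartedSpace F M] [Group M] [LieGroup 𝓘(ℂ, F) ω M]
  [IsTopologicalGroup M] [T2Space M] {ι : G →* M} {B : E →L[ℝ] E →L[ℝ] ℝ}
  {X : Type*} [NormedAddCommGroup X] [InnerProductSpace ℝ X] [FiniteDimensional ℝ X]
  {e : X →L[ℝ] E} {K : M → ℝ} {Kt : X → ℝ} {c : ℝ}
  {g : ContMDiffRiemannianMetric 𝓘(ℝ, F) ∞ F (fun p : M => TangentSpace 𝓘(ℝ, F) p)}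
  {q : ContMDiffRiemannianMetric 𝓘(ℝ, X) ∞ X (fun x : X => TangentSpace 𝓘(ℝ, X) x)}

/-- If the invariant metric on the group is complete, so is the metric on `𝔥`. -/
lemma metricComplete_torus (hι : IsComplexification (E := E) (F := F) ι)
    (hB : IsInvariantForm G B) (hZ : ∀ v : E, (∀ w, groupBracket G v w = 0) → v = 0)
    (hT : IsMaximalAbelian G (LinearMap.range (e : X →ₗ[ℝ] E)))
    (he : ∀ x y : X, B (e x) (e y) = inner ℝ x y)
    (h : IsInvariantPotential (F := F) ι e K Kt) (hc : 0 < c)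
    (hg : ∀ (p : M) (v w : F), g.inner p v w = c * leviForm K p v w)
    (hq : ∀ x v w : X, q.inner x v w = hessianForm Kt x v w) (hcomplete : RiemannianMetricComplete g) :
    RiemannianMetricComplete q := by
  rw [riemannianMetricComplete_iff] at hcomplete ⊢
  intro u hu
  obtain ⟨p, hp⟩ := hcomplete (fun k => imagExp F ι (e (u k))) fun ε hε => by
    obtain ⟨r, hr, hrε⟩ := ENNReal.exists_nnreal_pos_mul_lt (a := ENNReal.ofReal √c)
      ENNReal.ofReal_ne_top hε.ne'
    obtain ⟨N, hN⟩ := hu r (by exact_mod_cast hr)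
    refine ⟨N, fun m hm k hk => ?_⟩
    refine (metricEDist_torus_le hι hT h hc hg hq (hN m hm k hk)).trans_lt ?_
    rwa [mul_comm]
  -- Convergence in `Gᶜ` gives only a cluster point in `𝔥`; the Cauchy property of `u` does the
  -- rest.
  obtain ⟨x, -, hx⟩ := exists_mapClusterPt_torus hι hB hZ hT he hp (y := u)
    fun k => ⟨1, 1, by simp⟩
  exact ⟨x, tendsto_of_mapClusterPt q hu hx⟩

/-- A Cauchy sequence for a Riemannian distance has a rapidly converging subsequence. -/
lemma exists_strictMono_metricEDist_lt {E : Type*} [NormedAddCommGroup E] [NormedSpace ℝ E]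
    {M : Type*} [TopologicalSpace M] [ChartedSpace E M] [IsManifold 𝓘(ℝ, E) ∞ M]
    (g : ContMDiffRiemannianMetric 𝓘(ℝ, E) ∞ E (fun p : M => TangentSpace 𝓘(ℝ, E) p)) {u : ℕ → M}
    (hu : ∀ ε : ENNReal, 0 < ε → ∃ N, ∀ m ≥ N, ∀ k ≥ N, metricEDist g (u m) (u k) < ε) :
    ∃ φ : ℕ → ℕ, StrictMono φ ∧
      ∀ k, metricEDist g (u (φ k)) (u (φ (k + 1))) < ENNReal.ofReal ((1 / 2) ^ k) := by
  have hpos (k : ℕ) : (0 : ENNReal) < ENNReal.ofReal ((1 / 2) ^ k) := by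
    rw [ENNReal.ofReal_pos]; positivity
  obtain ⟨φ, hφ, hφu⟩ := extraction_forall_of_eventually' (P := fun k n => ∀ m ≥ n,
    metricEDist g (u n) (u m) < ENNReal.ofReal ((1 / 2) ^ k)) fun k => by
      obtain ⟨N, hN⟩ := hu _ (hpos k)
      exact ⟨N, fun n hn m hm => hN n hn m (hn.trans hm)⟩
  exact ⟨φ, hφ, fun k => hφu k _ (hφ.monotone k.le_succ)⟩

/-- A sequence with geometrically decreasing steps is Cauchy. -/
lemma metricCauchy_of_geometric {E : Type*} [NormedAddCommGroup E] [NormedSpace ℝ E]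
    {M : Type*} [TopologicalSpace M] [ChartedSpace E M] [IsManifold 𝓘(ℝ, E) ∞ M]
    (g : ContMDiffRiemannianMetric 𝓘(ℝ, E) ∞ E (fun p : M => TangentSpace 𝓘(ℝ, E) p)) {x : ℕ → M}
    {C : ℝ} (hC : 0 ≤ C)
    (hx : ∀ k, metricEDist g (x k) (x (k + 1)) ≤ ENNReal.ofReal ((1 / 2) ^ k * C)) (ε : ENNReal)
    (hε : 0 < ε) : ∃ N, ∀ m ≥ N, ∀ k ≥ N, metricEDist g (x m) (x k) < ε := by
  -- The bound is the partial sum of the geometric series, in a form that telescopes.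
  have hstep (N j : ℕ) : metricEDist g (x N) (x (N + j)) ≤
      ENNReal.ofReal (2 * C * ((1 / 2) ^ N - (1 / 2) ^ (N + j))) := by
    induction j with
    | zero => simp [metricEDist_self]
    | succ j ih =>
      refine (metricEDist_triangle g _ (x (N + j)) _).trans
        ((add_le_add ih (hx (N + j))).trans ?_)
      have hle : ((1 : ℝ) / 2) ^ (N + j) ≤ (1 / 2) ^ N :=
        pow_le_pow_of_le_one (by norm_num) (by norm_num) (Nat.le_add_right N j)
      rw [← ENNReal.ofReal_add (mul_nonneg (by positivity) (sub_nonneg.2 hle)) (by positivity)]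
      refine ENNReal.ofReal_le_ofReal (le_of_eq ?_)
      rw [← add_assoc N j 1, pow_succ]
      ring
  have hlim : Tendsto (fun N : ℕ => ENNReal.ofReal (2 * (2 * C * (1 / 2) ^ N))) atTop (𝓝 0) := by
    rw [← ENNReal.ofReal_zero]
    refine ENNReal.tendsto_ofReal ?_
    have := (tendsto_pow_atTop_nhds_zero_of_lt_one (r := (1 / 2 : ℝ)) (by norm_num)
      (by norm_num)).const_mul (2 * (2 * C))
    simpa [mul_assoc] using this
  obtain ⟨N, hN⟩ := (hlim.eventually (gt_mem_nhds hε)).exists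
  have hN' (m : ℕ) (hm : N ≤ m) : metricEDist g (x N) (x m) ≤
      ENNReal.ofReal (2 * C * (1 / 2) ^ N) := by
    obtain ⟨j, rfl⟩ := Nat.exists_eq_add_of_le hm
    refine (hstep N j).trans (ENNReal.ofReal_le_ofReal ?_)
    refine mul_le_mul_of_nonneg_left ?_ (by positivity)
    have : (0 : ℝ) ≤ (1 / 2) ^ (N + j) := by positivity
    linarith
  refine ⟨N, fun m hm k hk => ?_⟩
  calc metricEDist g (x m) (x k) ≤ metricEDist g (x m) (x N) + metricEDist g (x N) (x k) :=
        metricEDist_triangle g _ _ _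
    _ ≤ ENNReal.ofReal (2 * C * (1 / 2) ^ N) + ENNReal.ofReal (2 * C * (1 / 2) ^ N) := by
        rw [metricEDist_comm g (x m)]
        exact add_le_add (hN' m hm) (hN' k hk)
    _ = ENNReal.ofReal (2 * (2 * C * (1 / 2) ^ N)) := by
        rw [← ENNReal.ofReal_add (by positivity) (by positivity)]; congr 1; ring
    _ < ε := hN

/-- If the metric on `𝔥` is complete, so is the invariant metric on the group. -/
lemma metricComplete_of_torus (hι : IsComplexification (E := E) (F := F) ι)
    (hB : IsInvariantForm G B) (hZ : ∀ v : E, (∀ w, groupBracket G v w = 0) → v = 0)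
    (hT : IsMaximalAbelian G (LinearMap.range (e : X →ₗ[ℝ] E)))
    (he : ∀ x y : X, B (e x) (e y) = inner ℝ x y)
    (h : IsInvariantPotential (F := F) ι e K Kt) (hKt : ContDiff ℝ ∞ Kt) (hc : 0 < c)
    (hg : ∀ (p : M) (v w : F), g.inner p v w = c * leviForm K p v w)
    (hq : ∀ x v w : X, q.inner x v w = hessianForm Kt x v w) (hcomplete : RiemannianMetricComplete q) :
    RiemannianMetricComplete g := by
  rw [riemannianMetricComplete_iff] at hcomplete ⊢
  intro u hu
  obtain ⟨φ, hφ, hφu⟩ := exists_strictMono_metricEDist_lt g hu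
  obtain ⟨⟨a₀, x₀, b₀⟩, hx₀⟩ := surjective_cartanMap hι hB hZ hT he (u (φ 0))
  -- A double coset need not determine its point of `𝔥`, so the points are chosen recursively, each
  -- one close to its predecessor.
  let P (k : ℕ) (x : X) : Prop := u (φ k) ∈ torusCoset F ι e x
  have hnext (k : ℕ) (x : {x : X // P k x}) : ∃ y : {x : X // P (k + 1) x},
      metricEDist q x.1 y.1 ≤ ENNReal.ofReal ((1 / 2) ^ k / √c) := by
    obtain ⟨y, hy, hxy⟩ := exists_metricEDist_torus_le hι hB hZ hT he h hKt hc hg hq x.2 (hφu k)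
    exact ⟨⟨y, hy⟩, hxy⟩
  choose next hnext using hnext
  let x (k : ℕ) : {x : X // P k x} :=
    Nat.rec (motive := fun k => {x : X // P k x}) ⟨x₀, a₀, b₀, hx₀.symm⟩ next k
  obtain ⟨x', hx'⟩ := hcomplete (fun k => (x k).1)
    (metricCauchy_of_geometric q (C := 1 / √c) (by positivity) fun k => by
      rw [mul_one_div]; exact hnext k (x k))
  choose a b hab using fun k => (x k).2
  -- The factors in `G` only accumulate. Together with the convergent `𝔥`-component they give a
  -- cluster point of a subsequence of `u`, hence of `u`.
  obtain ⟨a', -, ha'⟩ := isCompact_univ.exists_mapClusterPt (f := atTop)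
    (u := fun k => (a k, b k)) (by simp)
  have hcl : MapClusterPt (a'.1, x', a'.2) atTop fun k => (a k, (x k).1, b k) := by
    rw [mapClusterPt_iff_ultrafilter] at ha' ⊢
    obtain ⟨𝒰, h𝒰, hlim⟩ := ha'
    exact ⟨𝒰, h𝒰, (continuous_fst.tendsto _ |>.comp hlim).prodMk_nhds
      ((hx'.mono_left h𝒰).prodMk_nhds (continuous_snd.tendsto _ |>.comp hlim))⟩
  have hcl' : MapClusterPt (cartanMap F ι e (a'.1, x', a'.2)) atTop (u ∘ φ) :=
    (hcl.continuousAt_comp (continuous_cartanMap hι hT).continuousAt).congrFun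
      (Eventually.of_forall fun k => (hab k).symm)
  exact ⟨_, tendsto_of_mapClusterPt g hu (hcl'.of_comp hφ.tendsto_atTop)⟩

end CompletenessEquivalence

end

theorem mainTheorem10
    {E : Type*} [NormedAddCommGroup E] [NormedSpace ℝ E] [FiniteDimensional ℝ E]
    [CompleteSpace E]
    {G : Type*} [TopologicalSpace G] [ChartedSpace E G] [Group G] [LieGroup 𝓘(ℝ, E) ∞ G]
    [CompactSpace G] [LieAlgebra.IsSemisimple ℝ (GroupLieAlgebra 𝓘(ℝ, E) G)]
    {F : Type*} [NormedAddCommGroup F] [NormedSpace ℂ F] [FiniteDimensional ℂ F]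
    {GC : Type*} [TopologicalSpace GC] [ChartedSpace F GC] [Group GC] [LieGroup 𝓘(ℂ, F) ω GC]
    (ι : G →* GC) (hι : IsComplexification (E := E) (F := F) ι)
    (B : LinearMap.BilinForm ℝ (GroupLieAlgebra 𝓘(ℝ, E) G)) (hB : IsAdInvariantInner B)
    {n : ℕ} (𝔥 : LieSubalgebra ℝ (GroupLieAlgebra 𝓘(ℝ, E) G)) (h𝔥 : 𝔥.IsCartanSubalgebra)
    (e : EuclideanSpace ℝ (Fin n) ≃ₗ[ℝ] 𝔥)
    (he : ∀ x y : EuclideanSpace ℝ (Fin n), B (e x) (e y) = inner ℝ x y)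
    (u Kt : EuclideanSpace ℝ (Fin n) → ℝ)
    (hu : ContDiff ℝ ∞ u) (huW : IsWeylInvariant e u)
    (hK : ContDiff ℝ ∞ Kt) (hKconv : ConvexOn ℝ univ Kt) (hKW : IsWeylInvariant e Kt)
    (hMA : SolvesWeylMongeAmpere e u Kt)
    (g : ContMDiffRiemannianMetric 𝓘(ℝ, F) ∞ F (fun p : GC => TangentSpace 𝓘(ℝ, F) p))
    (hg : IsKahlerMetricGivenBy ι (fun x => (e x : GroupLieAlgebra 𝓘(ℝ, E) G)) Kt g) :
    RiemannianMetricComplete g ↔ HessianMetricComplete Kt := by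
  have : IsTopologicalGroup G := topologicalGroup_of_lieGroup 𝓘(ℝ, E) ∞
  have : IsTopologicalGroup GC := topologicalGroup_of_lieGroup 𝓘(ℂ, F) ω
  have : CompleteSpace F := FiniteDimensional.complete ℂ F
  have : T2Space G := t2Space_of_chartedSpace E G
  have : T2Space GC := t2Space_of_chartedSpace F GC
  -- The Lie algebra is the model space `E` by definition; `L` is the coordinate map of `𝔥` read in
  -- `E`.
  let L : EuclideanSpace ℝ (Fin n) →ₗ[ℝ] E :=
    (show GroupLieAlgebra 𝓘(ℝ, E) G →ₗ[ℝ] E from LinearMap.id) ∘ₗ 𝔥.toSubmodule.subtype ∘ₗ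
      (e : EuclideanSpace ℝ (Fin n) →ₗ[ℝ] 𝔥)
  let e' : EuclideanSpace ℝ (Fin n) →L[ℝ] E := LinearMap.toContinuousLinearMap L
  have hB' := hB.isInvariantForm
  have hZ : ∀ v : E, (∀ w, groupBracket G v w = 0) → v = 0 := fun v h =>
    eq_zero_of_groupBracket_eq_zero (G := G) h
  have hrange : LinearMap.range (e' : EuclideanSpace ℝ (Fin n) →ₗ[ℝ] E) =
      (show Submodule ℝ E from 𝔥.toSubmodule) := by
    ext v
    constructor
    · rintro ⟨x, rfl⟩
      exact (e x).2
    · intro hv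
      exact ⟨e.symm ⟨v, hv⟩, congrArg (Subtype.val (p := (· ∈ 𝔥))) (e.apply_symm_apply ⟨v, hv⟩)⟩
  have hT : IsMaximalAbelian G (LinearMap.range (e' : EuclideanSpace ℝ (Fin n) →ₗ[ℝ] E)) :=
    hrange ▸ isMaximalAbelian_of_isCartanSubalgebra hB' h𝔥
  have he' : ∀ x y, continuousForm B (e' x) (e' y) = inner ℝ x y := he
  have hinj : Function.Injective e' := fun x y hxy => e.injective (Subtype.ext hxy)
  obtain ⟨c, K, hc, hsmooth, hinv, htorus, hgK⟩ := hg
  have hpot : IsInvariantPotential (F := F) ι e' K Kt := ⟨hsmooth, hinv, htorus⟩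
  constructor
  · intro hcomplete
    -- That the Hessian is a metric at all comes from the positivity of `g` along `i 𝔥`.
    have hpos := fun x v => hessianForm_pos hι hT hinj hpot hc hgK x (v := v)
    exact ⟨hessianMetric Kt hK hpos, fun x v w => (sum_hessianMatrix x v w).symm,
      metricComplete_torus hι hB' hZ hT he' hpot hc hgK (fun _ _ _ => rfl) hcomplete⟩
  · rintro ⟨q, hq, hcomplete⟩
    exact metricComplete_of_torus hι hB' hZ hT he' hpot hK hc hgK
      (fun x v w => (hq x v w).trans (sum_hessianMatrix x v w)) hcomplete
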